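/- **Setting.** For $A\in\mathbb R_{\ge 0}^{m\times n}$ and vectors $\mathbf r\in\mathbb R_{>0}^m$, $\mathbf c\in\mathbb R_{>0}^n$ of equal total mass $N$, say that $A$ is *scalable* to $(\mathbf r,\mathbf c)$, written $A\in\mathcal S(\mathbf r,\mathbf c)$, if there are positive diagonal matrices $D_1,D_2$ such that $A^{\mathbf r,\mathbf c}:=D_1AD_2$ has row sums $\mathbf r$ and column sums $\mathbf c$; then $A^{\mathbf r,\mathbf c}$ is unique. Write $\|A\|_1=\sum_{ij}|A_{ij}|$, and write $\rho_{\mathbf r}(x)=\frac mN\mathbf r(\lceil mx\rceil)$, $\rho_{\mathbf c}(y)=\frac nN\mathbf c(\lceil ny\rceil)$, $\varphi_A(x,y)=\frac{mn}{N}A(\lceil mx\rceil,\lceil ny\rceil)$ for the piecewise constant extensions to $[0,1]$ and $[0,1]^2$ (for all of these $N$ is the total mass of the margin). The margin is $\delta$-smooth if $N>0$, $\frac{\delta N}{m}\le \mathbf r(i)\le\frac{N}{\delta m}$ and $\frac{\delta N}{n}\le \mathbf c(j)\le\frac{N}{\delta n}$ for all $i,j$. For nonnegative $f,h$ let $d_H(f,h)=\bigl(\int(\sqrt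 f-\sqrt h)^2\bigr)^{1/2}$. For $\Lambda\in\mathbb R_{>0}^{m\times n}$ and $s,t>0$ let $\Lambda_{\min},\Lambda_{\max}$ be the extreme entries and $$\Phi_{\Lambda}(s,t)=\min\Bigl(n\frac{\Lambda_{\min}^4}{(s+t+\Lambda_{\max})^4},\ \sqrt n\,\frac{\Lambda_{\min}}{s+t+\Lambda_{\max}}\Bigr).$$ **Assumptions.** Let $K\ge 0$ and $\delta,\sigma,R,\gamma>0$. For each $k\in\mathbb N$ let $(\mathbf r_k,\mathbf c_k)$ be a $\delta$-smooth $m_k\times n_k$ margin of total mass $N_k$ and let $\mathbf X_k$ be an $m_k\times n_k$ random matrix (on its own probability space) with independent, almost surely nonnegative entries and mean $\mathbb E\mathbf X_k=\Lambda_k$ with positive entries, such that for some $\sigma_k\in(0,\sigma]$ and $R_k\in(0,R]$, $$\mathbb E|(\mathbf X_k)_{ij}-(\Lambda_k)_{ij}|^q\le \tfrac{q!}{2}\sigma_k^2R_k^{q-2}\qquad\text{for all integers } q\ge 2\text{ and all } i,j.$$ Suppose that there are probability densities $\rho_{\mathbf r},\rho_{\mathbf c}$ on $[0,1]$ and $\varphi_\Lambda$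 on $[0,1]^2$ with $\rho_{\mathbf r_k}\to\rho_{\mathbf r}$, $\rho_{\mathbf c_k}\to\rho_{\mathbf c}$ and $\varphi_{\Lambda_k}\to\varphi_\Lambda$ in $L^1$; that for all large $k$ $$\Bigl|\log\frac{\mathbf r_k(i)\mathbf c_k(j)\|\Lambda_k\|_1}{(\Lambda_k)_{ij}N_k^2}\Bigr|\le K\qquad\text{for all } i,j;$$ that $\liminf_k \min(m_k/n_k,\,n_k/m_k)\ge\gamma$; and that $(m_k\vee n_k)^{3/2}\sqrt{\log(m_k\vee n_k)}=o(\|\Lambda_k\|_1)$. **Conclusion.** There is a unique minimizer $\pi$ of $D_{\mathrm{KL}}(\,\cdot\,\|\,\varphi_\Lambda\,dx\,dy)$ over the couplings of $\rho_{\mathbf r}\,dx$ and $\rho_{\mathbf c}\,dy$ (the continuous static Schrödinger bridge), and it has a Lebesgue density $W=d\pi/(dx\,dy)$. Moreover, there are an absolute constant $c>0$ and, for every $G\ge 0$, a constant $C=C(K,\delta,G,\sigma,R)$ such that for every $D>0$ and every $g\in L^\infty([0,1]^2)$ with $\|g\|_\infty\le G$ the following holds for all sufficiently large $k$: with probability at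 least $$1-2(m_k\vee n_k)^{-D}-m_k^2\exp\bigl(-c\,\Phi_{\Lambda_k}(\sigma_k,R_k)\bigr)-2\exp\Bigl(-\frac{\|\Lambda_k\|_1^2}{2(m_kn_k\sigma^2+R\|\Lambda_k\|_1)}\Bigr)$$ one has $\mathbf X_k\in\mathcal S(\mathbf r_k,\mathbf c_k)$ and $$\Bigl|\int_{[0,1]^2}g\,\bigl(\varphi_{\mathbf X_k^{\mathbf r_k,\mathbf c_k}}-W\bigr)\,dx\,dy\Bigr|\le C\Bigl(\frac{(m_k\vee n_k)^{3/2}\sqrt{D\log(m_k\vee n_k)}}{\|\Lambda_k\|_1}+\sqrt{\|\rho_{\mathbf r}-\rho_{\mathbf r_k}\|_{L^1}+\|\rho_{\mathbf c}-\rho_{\mathbf c_k}\|_{L^1}}+d_H(\varphi_{\Lambda_k},\varphi_\Lambda)\Bigr).$$ The constants $c$ and $C$ do not depend on the sequences, on $\gamma$, on $D$ or on $g$ (beyond $\|g\|_\infty\le G$); how large $k$ must be may depend on all data. -/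

import Mathlib

open MeasureTheory ProbabilityTheory Filter Topology

noncomputable section

/-- The entrywise `ℓ¹` norm `‖A‖₁ = ∑ |A i j|` of a matrix. -/
def entryNorm {m n : ℕ} (A : Matrix (Fin m) (Fin n) ℝ) : ℝ := ∑ i, ∑ j, |A i j|

/-- The smallest entry of a (nonempty) matrix. -/
def minEntry {m n : ℕ} (A : Matrix (Fin m) (Fin n) ℝ) : ℝ := ⨅ p : Fin m × Fin n, A p.1 p.2

/-- The largest entry of a (nonempty) matrix. -/
def maxEntry {m n : ℕ} (A : Matrix (Fin m) (Fin n) ℝ) : ℝ := ⨆ p : Fin m × Fin n, A p.1 p.2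

/-- `(r, c)` is a `δ`-smooth `m × n` margin: both vectors have the same total mass `N > 0`,
`δ N / m ≤ r i ≤ N / (δ m)` and `δ N / n ≤ c j ≤ N / (δ n)`.
The total mass `N` is written `∑ i, r i`. -/
structure IsSmoothMargin {m n : ℕ} (δ : ℝ) (r : Fin m → ℝ) (c : Fin n → ℝ) : Prop where
  mass_pos : 0 < ∑ i, r i
  mass_eq : ∑ i, r i = ∑ j, c j
  row_bounds : ∀ i, δ * (∑ i, r i) / m ≤ r i ∧ r i ≤ (∑ i, r i) / (δ * m)
  col_bounds : ∀ j, δ * (∑ i, r i) / n ≤ c j ∧ c j ≤ (∑ i, r i) / (δ * n)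

/-- Bounded cost: `|log (r i * c j * ‖Λ‖₁ / (Λ i j * N ^ 2))| ≤ K` for all `i, j`. -/
def HasBoundedCost {m n : ℕ} (K : ℝ) (r : Fin m → ℝ) (c : Fin n → ℝ)
    (Λ : Matrix (Fin m) (Fin n) ℝ) : Prop :=
  ∀ i j, |Real.log (r i * c j * entryNorm Λ / (Λ i j * (∑ i, r i) ^ 2))| ≤ K

/-- A random matrix with independent, (almost surely) nonnegative entries, positive mean `Λ`,
and sub-exponential (Bernstein) moment growth with parameters `σ, R > 0`. -/
structure IsSubexponentialMatrix {m n : ℕ} {Ω : Type*} [MeasurableSpace Ω] (P : Measure Ω)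
    (X : Ω → Matrix (Fin m) (Fin n) ℝ) (Λ : Matrix (Fin m) (Fin n) ℝ) (σ R : ℝ) : Prop where
  measurable : ∀ i j, Measurable (fun ω => X ω i j)
  indep : iIndepFun (fun (p : Fin m × Fin n) ω => X ω p.1 p.2) P
  nonneg : ∀ᵐ ω ∂P, ∀ i j, 0 ≤ X ω i j
  integrable : ∀ i j, Integrable (fun ω => X ω i j) P
  mean : ∀ i j, ∫ ω, X ω i j ∂P = Λ i j
  mean_pos : ∀ i j, 0 < Λ i j
  sigma_pos : 0 < σ
  R_pos : 0 < R
  moment_integrable : ∀ i j, ∀ q : ℕ, 2 ≤ q → Integrable (fun ω => |X ω i j - Λ i j| ^ q) P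
  moment_le : ∀ i j, ∀ q : ℕ, 2 ≤ q →
    ∫ ω, |X ω i j - Λ i j| ^ q ∂P ≤ (q.factorial : ℝ) / 2 * σ ^ 2 * R ^ (q - 2)

/-- `Z = D₁ A D₂` for positive diagonal matrices `D₁, D₂`, and `Z` has row sums `r` and column
sums `c`. -/
def IsScalingOf {m n : ℕ} (r : Fin m → ℝ) (c : Fin n → ℝ)
    (A Z : Matrix (Fin m) (Fin n) ℝ) : Prop :=
  (∃ (d₁ : Fin m → ℝ) (d₂ : Fin n → ℝ), (∀ i, 0 < d₁ i) ∧ (∀ j, 0 < d₂ j) ∧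
    Z = Matrix.diagonal d₁ * A * Matrix.diagonal d₂) ∧
  (∀ i, ∑ j, Z i j = r i) ∧ (∀ j, ∑ i, Z i j = c j)

/-- The set `𝒮(r, c)` of nonnegative matrices that are scalable to the margin `(r, c)`. -/
def scalableSet {m n : ℕ} (r : Fin m → ℝ) (c : Fin n → ℝ) : Set (Matrix (Fin m) (Fin n) ℝ) :=
  {A | (∀ i j, 0 ≤ A i j) ∧ ∃ Z, IsScalingOf r c A Z}

open Classical in
/-- The Sinkhorn-rescaled matrix `A^{r,c}`: the (unique) matrix `D₁ A D₂` with margin `(r, c)`.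
The value off `scalableSet r c` is never used. -/
def sinkhornRescale {m n : ℕ} (r : Fin m → ℝ) (c : Fin n → ℝ) (A : Matrix (Fin m) (Fin n) ℝ) :
    Matrix (Fin m) (Fin n) ℝ :=
  if h : ∃ Z, IsScalingOf r c A Z then h.choose else 0

/-- The row-alignment rate `Φ_Λ`. -/
def rowAlignmentRate {m n : ℕ} (Λ : Matrix (Fin m) (Fin n) ℝ) (σ R : ℝ) : ℝ :=
  min (n * (minEntry Λ ^ 4 / (σ + R + maxEntry Λ) ^ 4))
    (√(n : ℝ) * (minEntry Λ / (σ + R + maxEntry Λ)))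

/-- The density `x ↦ (m / N) * v ⌈m x⌉` on `[0,1]` of a vector `v` with total mass `N`.
Indices in the text run from `1`, so `⌈m x⌉ = i + 1` selects the entry `i : Fin m`; the value at
the null set `x = 0` is `0`. -/
def marginDensity {m : ℕ} (v : Fin m → ℝ) (x : unitInterval) : ℝ :=
  (m : ℝ) / (∑ i, v i) * ∑ i : Fin m, if ⌈(m : ℝ) * (x : ℝ)⌉ = (i : ℤ) + 1 then v i else 0

/-- The piecewise constant extension `(x, y) ↦ (m n / N) * A (⌈m x⌉, ⌈n y⌉)` of a matrix to the
unit square. -/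
def matrixDensity {m n : ℕ} (N : ℝ) (A : Matrix (Fin m) (Fin n) ℝ)
    (p : unitInterval × unitInterval) : ℝ :=
  (m : ℝ) * n / N * ∑ i : Fin m, ∑ j : Fin n,
    if ⌈(m : ℝ) * (p.1 : ℝ)⌉ = (i : ℤ) + 1 ∧ ⌈(n : ℝ) * (p.2 : ℝ)⌉ = (j : ℤ) + 1
    then A i j else 0

/-- `f` is a probability density with respect to the measure of the space `α`. -/
structure IsProbDensity {α : Type*} [MeasureSpace α] (f : α → ℝ) : Prop where
  integrable : Integrable f
  nonneg : ∀ᵐ x, 0 ≤ f x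
  integral_eq : ∫ x, f x = 1

/-- The measure `f dx`. -/
def densityMeasure {α : Type*} [MeasureSpace α] (f : α → ℝ) : Measure α :=
  (volume : Measure α).withDensity (fun x => ENNReal.ofReal (f x))

/-- The `L¹` distance `∫ |f - g|`. -/
def l1Dist {α : Type*} [MeasureSpace α] (f g : α → ℝ) : ℝ := ∫ x, |f x - g x|

/-- The Hellinger distance `(∫ (√f - √g)²)^{1/2}` of the measures with densities `f`, `g`. -/
def hellingerDist {α : Type*} [MeasureSpace α] (f g : α → ℝ) : ℝ :=
  √(∫ x, (√(f x) - √(g x)) ^ 2)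

/-- Convergence of margins and kernels: the histogram densities of the margins and of the mean
matrices converge in `L¹` to probability densities `ρr`, `ρc` on `[0,1]` and `φ` on `[0,1]²`,
and the cost is bounded by the same `K` for all large `k`. -/
structure MarginKernelConvergence (K δ : ℝ) {m n : ℕ → ℕ} (r : ∀ k, Fin (m k) → ℝ)
    (c : ∀ k, Fin (n k) → ℝ) (Λ : ∀ k, Matrix (Fin (m k)) (Fin (n k)) ℝ)
    (ρr ρc : unitInterval → ℝ) (φ : unitInterval × unitInterval → ℝ) : Prop where
  smooth : ∀ k, IsSmoothMargin δ (r k) (c k)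
  row_density : IsProbDensity ρr
  col_density : IsProbDensity ρc
  kernel_density : IsProbDensity φ
  row_tendsto : Tendsto (fun k => l1Dist (marginDensity (r k)) ρr) atTop (𝓝 0)
  col_tendsto : Tendsto (fun k => l1Dist (marginDensity (c k)) ρc) atTop (𝓝 0)
  kernel_tendsto :
    Tendsto (fun k => l1Dist (matrixDensity (∑ i, r k i) (Λ k)) φ) atTop (𝓝 0)
  cost : ∀ᶠ k in atTop, HasBoundedCost K (r k) (c k) (Λ k)

/-- `π` is a static Schrödinger bridge: a minimizer of `H ↦ KL(H ‖ 𝓡)` over all couplings `H` of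
`μ₀` and `μ₁`. -/
def IsSchrodingerBridge {α β : Type*} [MeasurableSpace α] [MeasurableSpace β]
    (μ₀ : Measure α) (μ₁ : Measure β) (𝓡 π : Measure (α × β)) : Prop :=
  (π.fst = μ₀ ∧ π.snd = μ₁) ∧
  ∀ H : Measure (α × β), H.fst = μ₀ → H.snd = μ₁ →
    InformationTheory.klDiv π 𝓡 ≤ InformationTheory.klDiv H 𝓡

open Classical in
/-- The static Schrödinger bridge with marginals `μ₀`, `μ₁` and reference measure `𝓡`
(the zero measure if there is none). -/
def schrodingerBridge {α β : Type*} [MeasurableSpace α] [MeasurableSpace β]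
    (μ₀ : Measure α) (μ₁ : Measure β) (𝓡 : Measure (α × β)) : Measure (α × β) :=
  if h : ∃ π, IsSchrodingerBridge μ₀ μ₁ 𝓡 π then h.choose else 0

/-- The bridge with marginals `ρr dx`, `ρc dy` and reference measure `φ dx dy` on `[0,1]²`. -/
def limitBridge (ρr ρc : unitInterval → ℝ) (φ : unitInterval × unitInterval → ℝ) :
    Measure (unitInterval × unitInterval) :=
  schrodingerBridge (densityMeasure ρr) (densityMeasure ρc) (densityMeasure φ)

/-- The Lebesgue density `W = dπ / (dx dy)` of the bridge `limitBridge ρr ρc φ`. -/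
def limitBridgeDensity (ρr ρc : unitInterval → ℝ) (φ : unitInterval × unitInterval → ℝ)
    (p : unitInterval × unitInterval) : ℝ :=
  ((limitBridge ρr ρc φ).rnDeriv volume p).toReal

end

/-! ### Contraction in oscillation -/

/-! Write M = m ∨ n, L = ‖Λ‖₁, N for the mass of the margin, and ε = M^{3/2} √(D log M) / L. The
rescaling of X is compared with the rescaling Z of the mean Λ, which is a probabilistic step, and Z
is compared with the bridge, which is a deterministic one.

Scalings come from fixed points, up to a constant, of the Sinkhorn step on row potentials. Its
derivative is a Markov kernel, so a Doeblin minorization makes the step contract oscillations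
(`sinkhornMap_contraction`), and compactness yields the fixed point (`exists_fixed_up_to_const`).
Bounded cost says that Λ is comparable to r c L / N², so its potentials α, β are bounded up to the
constant log(N / L) (`exists_potentials_of_bounded_cost`). The matrix X may have zeros. Multiplying
it by e^{α+β} gives a matrix Y whose margins are wrong by a relative amount η, and if all pairs of
rows of X overlap enough, then Y satisfies a Doeblin condition and potentials of size O(η) repair
its margins (`exists_scaling_of_near`).

Tested against g, this alone would cost O(η). However, Z and the rescaling of X have the same
margins, so g may be replaced by h = g - p ⊕ q, and p, q can be chosen such that h is orthogonal in
ℓ²(Z) to all row and column potentials (`exists_projection`). The first-order effect of the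
correcting potentials then vanishes, and there remain one linear functional of X - Λ and a term
O(η²) (`abs_sum_mul_scaling_sub_le`). Hence it suffices to control row and column sums at the
relative scale η = √ε and the single functional at the scale ε. Both follow from Bernstein bounds
once ε is small. The overlap of rows follows from a lower tail bound for sums of independent
nonnegative products.

For the deterministic step, 4(√u - √v)² ≤ (u - v)(log u - log v) is applied to two scaled densities
φ e^{a ⊕ b}. The logarithms split into a kernel part, controlled by the Hellinger distance of the
kernels, and a separable part, whose integral sees only the marginals. The resulting L¹ stability
(`IsScaledDensity.integral_abs_sub_le`) makes the rescaled means a Cauchy sequence and also gives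
the rate. Logarithms of density ratios stay separable in the limit (`exists_add_of_tendsto_ae`), so
the limit is again φ e^{a ⊕ b} with bounded potentials. Such a density is the only bridge, by the
Pythagorean identity for relative entropy (`klDiv_tilted_add_klDiv`). -/

/-- Doeblin's inequality: two probability vectors that both dominate `κ π` differ by at most
`(1 - κ) osc h` when tested against `h`. -/
theorem sum_sub_sum_le_of_minorized {ι : Type*} [Fintype ι] {P Q π h : ι → ℝ} {κ d : ℝ}
    (hP : ∑ l, P l = 1) (hQ : ∑ l, Q l = 1) (hπ : ∑ l, π l = 1)
    (hPπ : ∀ l, κ * π l ≤ P l) (hQπ : ∀ l, κ * π l ≤ Q l) (hd : ∀ i j, h i - h j ≤ d) :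
    ∑ l, P l * h l - ∑ l, Q l * h l ≤ (1 - κ) * d := by
  rcases isEmpty_or_nonempty ι with hι | hι
  · simp at hP
  obtain ⟨i, hi⟩ := Finite.exists_max h
  obtain ⟨j, hj⟩ := Finite.exists_min h
  -- After removal of the common part κπ both remainders are nonnegative of mass 1 - κ. One average
  -- is at most (1 - κ) max h, the other at least (1 - κ) min h.
  have h1 : ∑ l, (P l - κ * π l) * h l ≤ ∑ l, (P l - κ * π l) * h i :=
    Finset.sum_le_sum fun l _ => mul_le_mul_of_nonneg_left (hi l) (sub_nonneg.2 (hPπ l))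
  have h2 : ∑ l, (Q l - κ * π l) * h j ≤ ∑ l, (Q l - κ * π l) * h l :=
    Finset.sum_le_sum fun l _ => mul_le_mul_of_nonneg_left (hj l) (sub_nonneg.2 (hQπ l))
  have h3 : ∀ R : ι → ℝ, ∑ l, R l = 1 → ∀ x : ℝ, ∑ l, (R l - κ * π l) * x = (1 - κ) * x := by
    intro R hR x
    rw [← Finset.sum_mul, Finset.sum_sub_distrib, ← Finset.mul_sum, hR, hπ, mul_one]
  rw [h3 P hP] at h1
  rw [h3 Q hQ] at h2
  have h4 : ∀ R : ι → ℝ, ∑ l, (R l - κ * π l) * h l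
      = ∑ l, R l * h l - κ * ∑ l, π l * h l := by
    intro R
    rw [Finset.mul_sum, ← Finset.sum_sub_distrib]
    exact Finset.sum_congr rfl fun l _ => by ring
  rw [h4] at h1 h2
  have hκ : κ ≤ 1 := by
    have := Finset.sum_le_sum fun l (_ : l ∈ Finset.univ) => hPπ l
    rwa [hP, ← Finset.mul_sum, hπ, mul_one] at this
  have := mul_le_mul_of_nonneg_left (hd i j) (sub_nonneg.2 hκ)
  linarith

/-- A continuous self-map that preserves `{osc u ≤ ρ}` and strictly decreases oscillations of
differences has a fixed point up to an additive constant. -/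
theorem exists_fixed_up_to_const {ι : Type*} [Fintype ι] [Nonempty ι] {F : (ι → ℝ) → ι → ℝ}
    (hF : Continuous F) {ρ : ℝ} (hρ : 0 ≤ ρ)
    (hmaps : ∀ u, (∀ i j, u i - u j ≤ ρ) → ∀ i j, F u i - F u j ≤ ρ)
    (hlt : ∀ u w, (∀ i j, u i - u j ≤ ρ) → (∀ i j, w i - w j ≤ ρ) → ∀ d, 0 < d →
      (∀ i j, (u i - w i) - (u j - w j) ≤ d) →
      ∀ i j, (F u i - F w i) - (F u j - F w j) < d) :
    ∃ u, (∀ i j, u i - u j ≤ ρ) ∧ ∃ a, ∀ i, F u i = u i + a := by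
  obtain ⟨i₀⟩ := ‹Nonempty ι›
  have : Nonempty ι := ⟨i₀⟩
  -- Pinning one coordinate to zero removes the additive constant and makes the set of admissible
  -- potentials compact.
  set S : Set (ι → ℝ) := {u | (∀ i j, u i - u j ≤ ρ) ∧ u i₀ = 0} with hS
  have hScl : IsClosed S := by
    refine IsClosed.inter ?_ (isClosed_eq (continuous_apply i₀) continuous_const)
    have h : {u : ι → ℝ | ∀ i j, u i - u j ≤ ρ} = ⋂ i, ⋂ j, {u | u i - u j ≤ ρ} := by
      ext u
      simp
    change IsClosed {u : ι → ℝ | ∀ i j, u i - u j ≤ ρ}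
    rw [h]
    exact isClosed_iInter fun i => isClosed_iInter fun j =>
      isClosed_le ((continuous_apply i).sub (continuous_apply j)) continuous_const
  have hSsub : S ⊆ Metric.closedBall 0 ρ := by
    intro u hu
    rw [mem_closedBall_zero_iff, pi_norm_le_iff_of_nonneg hρ]
    intro i
    have h1 := hu.1 i i₀
    have h2 := hu.1 i₀ i
    rw [hu.2] at h1 h2
    rw [Real.norm_eq_abs, abs_le]
    constructor <;> linarith
  have hScpt : IsCompact S := (isCompact_closedBall 0 ρ).of_isClosed_subset hScl hSsub
  -- The oscillation of F u - u, which vanishes exactly when u is fixed up to a constant. It is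
  -- minimized over S.
  set θ : (ι → ℝ) → ℝ := fun u => Finset.univ.sup' Finset.univ_nonempty
    (fun p : ι × ι => (F u p.1 - u p.1) - (F u p.2 - u p.2)) with hθ
  have hθle : ∀ u i j, (F u i - u i) - (F u j - u j) ≤ θ u := fun u i j =>
    Finset.le_sup' (fun p : ι × ι => (F u p.1 - u p.1) - (F u p.2 - u p.2))
      (Finset.mem_univ (i, j))
  have hθc : Continuous θ := by
    refine Continuous.finset_sup'_apply _ fun p _ => ?_
    have hc : ∀ i, Continuous fun u => F u i := fun i => (continuous_apply i).comp hF
    exact ((hc _).sub (continuous_apply _)).sub ((hc _).sub (continuous_apply _))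
  obtain ⟨u, huS, humin⟩ := hScpt.exists_isMinOn
    ⟨0, by simp [hS, hρ]⟩ hθc.continuousOn
  have hθ0 : 0 ≤ θ u := by simpa using hθle u i₀ i₀
  rcases hθ0.eq_or_lt with h0 | h0
  · refine ⟨u, huS.1, F u i₀ - u i₀, fun i => ?_⟩
    have h1 := hθle u i i₀
    have h2 := hθle u i₀ i
    linarith
  · exfalso
    -- One more step lowers θ: w and F u differ by a constant, so θ w is the oscillation of F w - F
    -- u, which is strictly below that of w - u, namely θ u. This contradicts minimality.
    set w : ι → ℝ := fun i => F u i - F u i₀ with hw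
    have hwS : w ∈ S := ⟨fun i j => by have := hmaps u huS.1 i j; simp only [hw]; linarith,
      by simp [hw]⟩
    have h1 := hlt w u hwS.1 huS.1 (θ u) h0 (fun i j => by
      have := hθle u i j; simp only [hw]; linarith)
    have h2 : θ w < θ u := by
      rw [hθ, Finset.sup'_lt_iff]
      rintro ⟨i, j⟩ -
      have := h1 i j
      simp only [hw] at this ⊢
      linarith
    exact absurd (humin hwS) (not_le.2 h2)

/-! ### The Sinkhorn map -/

/-- One full Sinkhorn step on row potentials. -/
noncomputable def sinkhornMap {ι κ : Type*} [Fintype ι] [Fintype κ] (Y : ι → κ → ℝ) (r : ι → ℝ)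
    (c : κ → ℝ) (u : ι → ℝ) (i : ι) : ℝ :=
  Real.log (r i) - Real.log (∑ j, c j * Y i j / ∑ l, Y l j * Real.exp (u l))

theorem colSum_exp_pos {ι κ : Type*} [Fintype ι] {Y : ι → κ → ℝ} (hY : ∀ i j, 0 ≤ Y i j) (hcol : ∀ j, 0 < ∑ l, Y l j) (u : ι → ℝ) (j : κ) :
    0 < ∑ l, Y l j * Real.exp (u l) := by
  obtain ⟨l, -, hl⟩ := Finset.exists_lt_of_sum_lt (s := Finset.univ) (f := fun _ : ι => (0 : ℝ))
    (g := fun l => Y l j) (by simpa using hcol j)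
  exact Finset.sum_pos' (fun l _ => mul_nonneg (hY l j) (Real.exp_pos _).le)
    ⟨l, Finset.mem_univ l, mul_pos hl (Real.exp_pos _)⟩

theorem rowSum_div_pos {ι κ : Type*} [Fintype κ] {Y : ι → κ → ℝ} {c : κ → ℝ} (hY : ∀ i j, 0 ≤ Y i j) (hrow : ∀ i, 0 < ∑ j, Y i j) (hc : ∀ j, 0 < c j)
    {C : κ → ℝ} (hC : ∀ j, 0 < C j) (i : ι) : 0 < ∑ j, c j * Y i j / C j := by
  obtain ⟨j, -, hj⟩ := Finset.exists_lt_of_sum_lt (s := Finset.univ) (f := fun _ : κ => (0 : ℝ))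
    (g := fun j => Y i j) (by simpa using hrow i)
  exact Finset.sum_pos' (fun j _ => div_nonneg (mul_nonneg (hc j).le (hY i j)) (hC j).le)
    ⟨j, Finset.mem_univ j, div_pos (mul_pos (hc j) hj) (hC j)⟩

section SinkhornMap

variable {ι κ : Type*} [Fintype ι] [Fintype κ] {Y : ι → κ → ℝ} {r : ι → ℝ} {c : κ → ℝ}

theorem continuous_sinkhornMap (hY : ∀ i j, 0 ≤ Y i j) (hcol : ∀ j, 0 < ∑ l, Y l j)
    (hrow : ∀ i, 0 < ∑ j, Y i j) (hc : ∀ j, 0 < c j) : Continuous (sinkhornMap Y r c) := by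
  have h1 : ∀ j, Continuous fun u : ι → ℝ => ∑ l, Y l j * Real.exp (u l) := fun j => by fun_prop
  refine continuous_pi fun i => continuous_const.sub (Continuous.log ?_ fun u =>
    (rowSum_div_pos hY hrow hc (fun j => colSum_exp_pos hY hcol u j) i).ne')
  exact continuous_finsetSum _ fun j _ =>
    continuous_const.div (h1 j) fun u => (colSum_exp_pos hY hcol u j).ne'

/-- The Markov kernel that is the derivative of the Sinkhorn map at `u`. -/
noncomputable def sinkhornKernel (Y : ι → κ → ℝ) (c : κ → ℝ) (u : ι → ℝ) (i l : ι) : ℝ :=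
  (∑ j, c j * Y i j * (Y l j * Real.exp (u l)) / (∑ l', Y l' j * Real.exp (u l')) ^ 2)
    / ∑ j, c j * Y i j / ∑ l', Y l' j * Real.exp (u l')

/-- This reflects the fact that adding a constant to u adds the same constant to the Sinkhorn map.
-/
theorem sum_sinkhornKernel (hY : ∀ i j, 0 ≤ Y i j) (hcol : ∀ j, 0 < ∑ l, Y l j)
    (hrow : ∀ i, 0 < ∑ j, Y i j) (hc : ∀ j, 0 < c j) (u : ι → ℝ) (i : ι) :
    ∑ l, sinkhornKernel Y c u i l = 1 := by
  have hC := colSum_exp_pos hY hcol u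
  have hS := rowSum_div_pos hY hrow hc hC i
  unfold sinkhornKernel
  rw [← Finset.sum_div, Finset.sum_comm, div_eq_one_iff_eq hS.ne']
  refine Finset.sum_congr rfl fun j _ => ?_
  rw [← Finset.sum_div, ← Finset.mul_sum]
  have := (hC j).ne'
  field_simp

/-- Only derivatives along segments are needed, because the contraction estimate uses the mean value
theorem in one variable. -/
theorem hasDerivAt_sinkhornMap (hY : ∀ i j, 0 ≤ Y i j) (hcol : ∀ j, 0 < ∑ l, Y l j)
    (hrow : ∀ i, 0 < ∑ j, Y i j) (hc : ∀ j, 0 < c j) (w h : ι → ℝ) (i : ι) (t : ℝ) :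
    HasDerivAt (fun t : ℝ => sinkhornMap Y r c (fun l => w l + t * h l) i)
      (∑ l, sinkhornKernel Y c (fun l => w l + t * h l) i l * h l) t := by
  set u : ι → ℝ := fun l => w l + t * h l with hu
  have hC := colSum_exp_pos hY hcol u
  have hS := rowSum_div_pos hY hrow hc hC i
  have h1 : ∀ j, HasDerivAt (fun t : ℝ => ∑ l, Y l j * Real.exp (w l + t * h l))
      (∑ l, Y l j * (Real.exp (u l) * h l)) t := by
    intro j
    refine HasDerivAt.fun_sum fun l _ => ?_
    have := (((hasDerivAt_id t).mul_const (h l)).const_add (w l)).exp.const_mul (Y l j)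
    simpa [hu] using this
  have h2 : ∀ j, HasDerivAt (fun t : ℝ => c j * Y i j / ∑ l, Y l j * Real.exp (w l + t * h l))
      (-(c j * Y i j) * (∑ l, Y l j * (Real.exp (u l) * h l))
        / (∑ l, Y l j * Real.exp (u l)) ^ 2) t := by
    intro j
    have := (hasDerivAt_const t (c j * Y i j)).div (h1 j) (hC j).ne'
    refine this.congr_deriv ?_
    simp [hu]
  have h3 := ((HasDerivAt.fun_sum fun j (_ : j ∈ Finset.univ) => h2 j).log hS.ne').const_sub
    (Real.log (r i))
  refine h3.congr_deriv ?_
  unfold sinkhornKernel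
  rw [← neg_div, ← Finset.sum_neg_distrib]
  simp_rw [div_mul_eq_mul_div]
  rw [← Finset.sum_div]
  congr 1
  simp_rw [Finset.sum_mul]
  rw [Finset.sum_comm]
  refine Finset.sum_congr rfl fun j _ => ?_
  rw [neg_mul, neg_div, neg_neg, Finset.mul_sum, Finset.sum_div]
  exact Finset.sum_congr rfl fun l _ => by ring

/-- The kernel at `u` dominates `e^{-2 osc u}` times the kernel at `0`. -/
theorem exp_mul_sinkhornKernel_zero_le (hY : ∀ i j, 0 ≤ Y i j) (hcol : ∀ j, 0 < ∑ l, Y l j)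
    (hrow : ∀ i, 0 < ∑ j, Y i j) (hc : ∀ j, 0 < c j) {u : ι → ℝ} {ρ : ℝ}
    (hu : ∀ i j, u i - u j ≤ ρ) (i l : ι) :
    Real.exp (-(2 * ρ)) * sinkhornKernel Y c 0 i l ≤ sinkhornKernel Y c u i l := by
  have : Nonempty ι := ⟨i⟩
  obtain ⟨a, ha⟩ := Finite.exists_max u
  obtain ⟨b, hb⟩ := Finite.exists_min u
  have hC := colSum_exp_pos hY hcol u
  have hC0 : ∀ j, 0 < ∑ l, Y l j * Real.exp ((0 : ι → ℝ) l) := colSum_exp_pos hY hcol 0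
  have hS := rowSum_div_pos hY hrow hc hC i
  have hS0 := rowSum_div_pos hY hrow hc hC0 i
  -- With x = e^{max u} and y = e^{min u}, the numerator of the kernel loses at most the factor y /
  -- x² and the normalizing sum grows by at most 1 / y. Altogether the loss is (y / x)² ≥ e^{-2ρ}.
  set x := Real.exp (u a) with hx
  set y := Real.exp (u b) with hy
  have hx0 : 0 < x := Real.exp_pos _
  have hy0 : 0 < y := Real.exp_pos _
  have hCle : ∀ j, ∑ l, Y l j * Real.exp (u l) ≤ x * ∑ l, Y l j * Real.exp ((0 : ι → ℝ) l) := by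
    intro j
    rw [Finset.mul_sum]
    refine Finset.sum_le_sum fun l _ => ?_
    have : Real.exp (u l) ≤ x := Real.exp_le_exp.2 (ha l)
    simp only [Pi.zero_apply, Real.exp_zero, mul_one]
    nlinarith [hY l j]
  have hCge : ∀ j, y * ∑ l, Y l j * Real.exp ((0 : ι → ℝ) l) ≤ ∑ l, Y l j * Real.exp (u l) := by
    intro j
    rw [Finset.mul_sum]
    refine Finset.sum_le_sum fun l _ => ?_
    have : y ≤ Real.exp (u l) := Real.exp_le_exp.2 (hb l)
    simp only [Pi.zero_apply, Real.exp_zero, mul_one]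
    nlinarith [hY l j]
  set A0 := ∑ j, c j * Y i j * (Y l j * Real.exp ((0 : ι → ℝ) l))
    / (∑ l', Y l' j * Real.exp ((0 : ι → ℝ) l')) ^ 2 with hA0
  set A := ∑ j, c j * Y i j * (Y l j * Real.exp (u l))
    / (∑ l', Y l' j * Real.exp (u l')) ^ 2 with hA
  set B0 := ∑ j, c j * Y i j / ∑ l', Y l' j * Real.exp ((0 : ι → ℝ) l') with hB0
  set B := ∑ j, c j * Y i j / ∑ l', Y l' j * Real.exp (u l') with hB
  have hA1 : y / x ^ 2 * A0 ≤ A := by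
    rw [hA0, Finset.mul_sum]
    refine Finset.sum_le_sum fun j _ => ?_
    have hcY : 0 ≤ c j * Y i j := mul_nonneg (hc j).le (hY i j)
    have e1 : y / x ^ 2 * (c j * Y i j * (Y l j * Real.exp ((0 : ι → ℝ) l))
        / (∑ l', Y l' j * Real.exp ((0 : ι → ℝ) l')) ^ 2)
        = c j * Y i j * (Y l j * y) / (x * ∑ l', Y l' j * Real.exp ((0 : ι → ℝ) l')) ^ 2 := by
      have := (hC0 j).ne'
      simp only [Pi.zero_apply, Real.exp_zero, mul_one] at this ⊢
      field_simp
    rw [e1]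
    refine div_le_div₀ (mul_nonneg hcY (mul_nonneg (hY l j) (Real.exp_pos _).le)) ?_
      (pow_pos (hC j) 2) (pow_le_pow_left₀ (hC j).le (hCle j) 2)
    exact mul_le_mul_of_nonneg_left (mul_le_mul_of_nonneg_left (Real.exp_le_exp.2 (hb l))
      (hY l j)) hcY
  have hB1 : B ≤ B0 / y := by
    rw [hB0, Finset.sum_div]
    refine Finset.sum_le_sum fun j _ => ?_
    rw [div_div, mul_comm _ y]
    exact div_le_div_of_nonneg_left (mul_nonneg (hc j).le (hY i j)) (mul_pos hy0 (hC0 j)) (hCge j)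
  have hA00 : 0 ≤ A0 := Finset.sum_nonneg fun j _ => div_nonneg
    (mul_nonneg (mul_nonneg (hc j).le (hY i j)) (mul_nonneg (hY l j) (Real.exp_pos _).le))
    (sq_nonneg _)
  have hexp : Real.exp (-(2 * ρ)) ≤ y ^ 2 / x ^ 2 := by
    rw [hx, hy, ← Real.exp_nat_mul, ← Real.exp_nat_mul, ← Real.exp_sub]
    refine Real.exp_le_exp.2 ?_
    have := hu a b
    push_cast
    linarith
  change Real.exp (-(2 * ρ)) * (A0 / B0) ≤ A / B
  calc Real.exp (-(2 * ρ)) * (A0 / B0) ≤ y ^ 2 / x ^ 2 * (A0 / B0) :=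
        mul_le_mul_of_nonneg_right hexp (div_nonneg hA00 hS0.le)
    _ = (y / x ^ 2 * A0) / (B0 / y) := by
        have := hS0.ne'
        field_simp
    _ ≤ A / B := div_le_div₀ (le_trans (by positivity) hA1) hA1 hS hB1

/-- Contraction of the Sinkhorn map in oscillation under a Doeblin condition. -/
theorem sinkhornMap_contraction (hY : ∀ i j, 0 ≤ Y i j) (hcol : ∀ j, 0 < ∑ l, Y l j)
    (hrow : ∀ i, 0 < ∑ j, Y i j) (hc : ∀ j, 0 < c j) {π : ι → ℝ} {ρ τ : ℝ}
    (hπ : ∑ l, π l = 1) (hτ : ∀ i l, τ * π l ≤ sinkhornKernel Y c 0 i l)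
    {u w : ι → ℝ} (hu : ∀ i j, u i - u j ≤ ρ) (hw : ∀ i j, w i - w j ≤ ρ) {d : ℝ}
    (hd : ∀ i j, (u i - w i) - (u j - w j) ≤ d) (i j : ι) :
    (sinkhornMap Y r c u i - sinkhornMap Y r c w i)
      - (sinkhornMap Y r c u j - sinkhornMap Y r c w j)
      ≤ (1 - Real.exp (-(2 * ρ)) * τ) * d := by
  set h : ι → ℝ := fun l => u l - w l with hh
  set f : ι → ℝ → ℝ := fun i t => sinkhornMap Y r c (fun l => w l + t * h l) i with hf
  have hder : ∀ i t, HasDerivAt (f i)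
      (∑ l, sinkhornKernel Y c (fun l => w l + t * h l) i l * h l) t :=
    fun i t => hasDerivAt_sinkhornMap hY hcol hrow hc w h i t
  -- The derivative of the difference of coordinates i and j tests h against two rows of the kernel
  -- at an intermediate point. That point is a convex combination of u and w, so it has oscillation
  -- at most ρ and inherits the minorization.
  obtain ⟨t, ht, hmvt⟩ := exists_hasDerivAt_eq_slope (fun t => f i t - f j t) _
    (zero_lt_one' ℝ) (fun t _ => ((hder i t).sub (hder j t)).continuousAt.continuousWithinAt)
    (fun t _ => (hder i t).sub (hder j t))
  have hf1 : ∀ i, f i 1 = sinkhornMap Y r c u i := fun i => by simp [hf, hh]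
  have hf0 : ∀ i, f i 0 = sinkhornMap Y r c w i := fun i => by simp [hf]
  have hosc : ∀ a b, (w a + t * h a) - (w b + t * h b) ≤ ρ := by
    intro a b
    have h1 := mul_le_mul_of_nonneg_left (hw a b) (sub_nonneg.2 ht.2.le)
    have h2 := mul_le_mul_of_nonneg_left (hu a b) ht.1.le
    simp only [hh]
    nlinarith
  have hker : ∀ a l, Real.exp (-(2 * ρ)) * τ * π l
      ≤ sinkhornKernel Y c (fun l => w l + t * h l) a l := fun a l => by
    refine le_trans ?_ (exp_mul_sinkhornKernel_zero_le hY hcol hrow hc hosc a l)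
    rw [mul_assoc]
    exact mul_le_mul_of_nonneg_left (hτ a l) (Real.exp_pos _).le
  have := sum_sub_sum_le_of_minorized (sum_sinkhornKernel hY hcol hrow hc _ i)
    (sum_sinkhornKernel hY hcol hrow hc _ j) hπ (hker i) (hker j) (h := h) (d := d) hd
  rw [hmvt] at this
  simp only [hf1, hf0, sub_zero, div_one] at this
  linarith

/-- A fixed point of the Sinkhorn map up to a constant gives an exact scaling. -/
theorem scaling_of_sinkhornMap_eq (hY : ∀ i j, 0 ≤ Y i j) (hcol : ∀ j, 0 < ∑ l, Y l j)
    (hrow : ∀ i, 0 < ∑ j, Y i j) (hr : ∀ i, 0 < r i) (hc : ∀ j, 0 < c j)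
    (hrc : ∑ i, r i = ∑ j, c j) {u : ι → ℝ} {a : ℝ}
    (hu : ∀ i, sinkhornMap Y r c u i = u i + a) {v : κ → ℝ}
    (hv : ∀ j, v j = Real.log (c j / ∑ l, Y l j * Real.exp (u l))) :
    (∀ i, ∑ j, Y i j * Real.exp (u i + v j) = r i) ∧
    (∀ j, ∑ i, Y i j * Real.exp (u i + v j) = c j) := by
  have hC := colSum_exp_pos hY hcol u
  have hexpv : ∀ j, Real.exp (v j) = c j / ∑ l, Y l j * Real.exp (u l) := fun j => by
    rw [hv, Real.exp_log (div_pos (hc j) (hC j))]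
  have hcols : ∀ j, ∑ i, Y i j * Real.exp (u i + v j) = c j := by
    intro j
    simp_rw [Real.exp_add, ← mul_assoc]
    rw [← Finset.sum_mul, hexpv, mul_div_cancel₀ _ (hC j).ne']
  have hrows : ∀ i, ∑ j, Y i j * Real.exp (u i + v j) = r i * Real.exp (-a) := by
    intro i
    have hS := rowSum_div_pos hY hrow hc hC i
    have h1 : Real.exp (u i) = r i * Real.exp (-a) / ∑ j, c j * Y i j / ∑ l, Y l j * Real.exp (u l) := by
      have h2 : u i = Real.log (r i)
          - Real.log (∑ j, c j * Y i j / ∑ l, Y l j * Real.exp (u l)) + -a := by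
        have := hu i
        unfold sinkhornMap at this
        linarith
      rw [h2, Real.exp_add, Real.exp_sub, Real.exp_log (hr i), Real.exp_log hS]
      ring
    have h3 : ∑ j, Y i j * Real.exp (u i + v j)
        = Real.exp (u i) * ∑ j, c j * Y i j / ∑ l, Y l j * Real.exp (u l) := by
      rw [Finset.mul_sum]
      refine Finset.sum_congr rfl fun j _ => ?_
      rw [Real.exp_add, hexpv]
      ring
    rw [h3, h1, div_mul_cancel₀ _ hS.ne']
  refine ⟨fun i => ?_, hcols⟩
  have : Nonempty ι := ⟨i⟩
  -- The columns are exact and the rows are exact up to the common factor e^{-a}. Equality of the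
  -- total masses forces this factor to be one.
  have htot : (∑ i, r i) * Real.exp (-a) = ∑ i, r i := by
    rw [Finset.sum_mul, ← Finset.sum_congr rfl fun i _ => hrows i, Finset.sum_comm, hrc]
    exact Finset.sum_congr rfl fun j _ => hcols j
  have hpos : 0 < ∑ i, r i := Finset.sum_pos (fun i _ => hr i) Finset.univ_nonempty
  have hea : Real.exp (-a) = 1 := by
    have := mul_left_cancel₀ hpos.ne' (htot.trans (mul_one _).symm)
    exact this
  rw [hrows, hea, mul_one]

end SinkhornMap

/-! ### Existence, uniqueness and bounds for scalings -/

section Scaling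

variable {ι κ : Type*} [Fintype ι] [Fintype κ] {r : ι → ℝ} {c : κ → ℝ}

/-- Positivity bounds the ratios of two rows of Y, so the image of the Sinkhorn map has oscillation
bounded independently of u. It also makes the kernel at 0 strictly positive, which is a Doeblin
condition relative to the uniform vector. -/
theorem exists_scaling_of_pos [Nonempty ι] [Nonempty κ] {Y : ι → κ → ℝ} (hY : ∀ i j, 0 < Y i j)
    (hr : ∀ i, 0 < r i) (hc : ∀ j, 0 < c j) (hrc : ∑ i, r i = ∑ j, c j) :
    ∃ (u : ι → ℝ) (v : κ → ℝ), (∀ i, ∑ j, Y i j * Real.exp (u i + v j) = r i) ∧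
      (∀ j, ∑ i, Y i j * Real.exp (u i + v j) = c j) := by
  have hY0 : ∀ i j, 0 ≤ Y i j := fun i j => (hY i j).le
  have hcol : ∀ j, 0 < ∑ l, Y l j := fun j =>
    Finset.sum_pos (fun l _ => hY l j) Finset.univ_nonempty
  have hrow : ∀ i, 0 < ∑ j, Y i j := fun i =>
    Finset.sum_pos (fun j _ => hY i j) Finset.univ_nonempty
  have hS := fun u i => rowSum_div_pos hY0 hrow hc (colSum_exp_pos hY0 hcol u) i
  set B : ι → ι → ℝ := fun i l =>
    Real.log (r i) - Real.log (r l) + Real.log (∑ j, Y l j / Y i j) with hB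
  have hosc : ∀ u i l, sinkhornMap Y r c u i - sinkhornMap Y r c u l ≤ B i l := by
    intro u i l
    have hC := colSum_exp_pos hY0 hcol u
    have hR : 0 < ∑ j, Y l j / Y i j :=
      Finset.sum_pos (fun j _ => div_pos (hY l j) (hY i j)) Finset.univ_nonempty
    have h1 : ∑ j, c j * Y l j / ∑ l', Y l' j * Real.exp (u l')
        ≤ (∑ j, Y l j / Y i j) * ∑ j, c j * Y i j / ∑ l', Y l' j * Real.exp (u l') := by
      rw [Finset.mul_sum]
      refine Finset.sum_le_sum fun j _ => ?_
      have h2 : Y l j / Y i j ≤ ∑ j, Y l j / Y i j :=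
        Finset.single_le_sum (f := fun j => Y l j / Y i j)
          (fun j _ => (div_pos (hY l j) (hY i j)).le) (Finset.mem_univ j)
      calc c j * Y l j / ∑ l', Y l' j * Real.exp (u l')
          = Y l j / Y i j * (c j * Y i j / ∑ l', Y l' j * Real.exp (u l')) := by
            have := (hY i j).ne'
            have := (hC j).ne'
            field_simp
        _ ≤ _ := mul_le_mul_of_nonneg_right h2
            (div_pos (mul_pos (hc j) (hY i j)) (hC j)).le
    have h3 := Real.log_le_log (hS u l) h1
    rw [Real.log_mul hR.ne' (hS u i).ne'] at h3
    simp only [hB, sinkhornMap]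
    linarith
  set ρ : ℝ := ∑ i, ∑ l, |B i l| with hρ
  have hBρ : ∀ i l, B i l ≤ ρ := fun i l => (le_abs_self _).trans <|
    (Finset.single_le_sum (f := fun l => |B i l|) (fun _ _ => abs_nonneg _)
      (Finset.mem_univ l)).trans <|
    Finset.single_le_sum (f := fun i => ∑ l, |B i l|)
      (fun _ _ => Finset.sum_nonneg fun _ _ => abs_nonneg _) (Finset.mem_univ i)
  have hρ0 : 0 ≤ ρ := Finset.sum_nonneg fun _ _ => Finset.sum_nonneg fun _ _ => abs_nonneg _
  have hker : ∀ i l, 0 < sinkhornKernel Y c 0 i l := fun i l =>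
    div_pos (Finset.sum_pos (fun j _ => div_pos (mul_pos (mul_pos (hc j) (hY i j))
      (mul_pos (hY l j) (Real.exp_pos _))) (pow_pos (colSum_exp_pos hY0 hcol 0 j) 2))
      Finset.univ_nonempty) (hS 0 i)
  obtain ⟨p, hp⟩ := Finite.exists_min fun p : ι × ι => sinkhornKernel Y c 0 p.1 p.2
  -- The smallest entry of the kernel, written as τ times the weight of the uniform vector.
  set τ := Fintype.card ι * sinkhornKernel Y c 0 p.1 p.2 with hτ
  have hcard : (0 : ℝ) < Fintype.card ι := by exact_mod_cast Fintype.card_pos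
  have hτ0 : 0 < τ := mul_pos hcard (hker _ _)
  obtain ⟨u, -, a, hu⟩ := exists_fixed_up_to_const
    (continuous_sinkhornMap (r := r) hY0 hcol hrow hc) hρ0
    (fun u _ i j => (hosc u i j).trans (hBρ i j))
    (fun u w hu hw d hd hdd i j => by
      have h := sinkhornMap_contraction (r := r) hY0 hcol hrow hc
        (π := fun _ => (Fintype.card ι : ℝ)⁻¹) (τ := τ)
        (by simp [hcard.ne']) (fun i l => by
          rw [hτ, mul_comm, ← mul_assoc, inv_mul_cancel₀ hcard.ne', one_mul]
          exact hp (i, l)) hu hw hdd i j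
      refine h.trans_lt ?_
      have := mul_pos (mul_pos (Real.exp_pos (-(2 * ρ))) hτ0) hd
      linarith)
  exact ⟨u, _, scaling_of_sinkhornMap_eq hY0 hcol hrow hr hc hrc hu fun _ => rfl⟩

/-- Two scalings of the same nonnegative matrix with the same margins coincide. -/
theorem scaling_unique {Z T : ι → κ → ℝ} (hZ : ∀ i j, 0 ≤ Z i j) {u : ι → ℝ} {v : κ → ℝ}
    (hT : ∀ i j, T i j = Z i j * Real.exp (u i + v j))
    (hrow : ∀ i, ∑ j, T i j = ∑ j, Z i j) (hcol : ∀ j, ∑ i, T i j = ∑ i, Z i j) (i : ι) (j : κ) :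
    T i j = Z i j := by
  -- T - Z has zero margins, so it is orthogonal to separable functions. Each term has the form Z
  -- (e^s - 1) s ≥ 0 with s = u i + v j, hence every term vanishes, and then Z i j = 0 or s = 0.
  have h0 : ∑ i, ∑ j, (T i j - Z i j) * (u i + v j) = 0 := by
    have h1 : ∑ i, ∑ j, (T i j - Z i j) * u i = 0 := by
      simp_rw [← Finset.sum_mul, Finset.sum_sub_distrib, hrow]
      simp
    have h2 : ∑ i, ∑ j, (T i j - Z i j) * v j = 0 := by
      rw [Finset.sum_comm]
      simp_rw [← Finset.sum_mul, Finset.sum_sub_distrib, hcol]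
      simp
    simp_rw [mul_add, Finset.sum_add_distrib, h1, h2, add_zero]
  have hnn : ∀ i j, 0 ≤ (T i j - Z i j) * (u i + v j) := by
    intro i j
    have h1 : (T i j - Z i j) * (u i + v j)
        = Z i j * ((Real.exp (u i + v j) - 1) * (u i + v j)) := by rw [hT]; ring
    rw [h1]
    refine mul_nonneg (hZ i j) ?_
    rcases le_total 0 (u i + v j) with h | h
    · exact mul_nonneg (sub_nonneg.2 (Real.one_le_exp h)) h
    · exact mul_nonneg_of_nonpos_of_nonpos (sub_nonpos.2 (Real.exp_le_one_iff.2 h)) h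
  have h2 := (Finset.sum_eq_zero_iff_of_nonneg fun i _ => Finset.sum_nonneg fun j _ => hnn i j).1
    h0 i (Finset.mem_univ i)
  have h3 := (Finset.sum_eq_zero_iff_of_nonneg fun j _ => hnn i j).1 h2 j (Finset.mem_univ j)
  rcases mul_eq_zero.1 h3 with h | h
  · linarith
  · rw [hT, h, Real.exp_zero, mul_one]

/-- Potentials of a kernel that is comparable to the product of the margins. -/
theorem exists_potentials_of_bounded_cost [Nonempty ι] [Nonempty κ] {Λ : ι → κ → ℝ} {K L N : ℝ}
    (hΛ : ∀ i j, 0 < Λ i j) (hr : ∀ i, 0 < r i) (hc : ∀ j, 0 < c j)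
    (hrN : ∑ i, r i = N) (hcN : ∑ j, c j = N) (hL : 0 < L)
    (hle : ∀ i j, Λ i j * N ^ 2 ≤ Real.exp K * (r i * c j * L))
    (hge : ∀ i j, r i * c j * L ≤ Real.exp K * (Λ i j * N ^ 2)) :
    ∃ (α : ι → ℝ) (β : κ → ℝ), (∀ i, ∑ j, Λ i j * Real.exp (α i + β j) = r i) ∧
      (∀ j, ∑ i, Λ i j * Real.exp (α i + β j) = c j) ∧
      (∀ i, |α i| ≤ K) ∧ ∀ j, |β j - Real.log (N / L)| ≤ 2 * K := by
  obtain ⟨u, v, hu, hv⟩ := exists_scaling_of_pos hΛ hr hc (hrN.trans hcN.symm)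
  have hN : 0 < N := hrN ▸ Finset.sum_pos (fun i _ => hr i) Finset.univ_nonempty
  set S := ∑ j, c j * Real.exp (v j) with hS
  have hS0 : 0 < S := Finset.sum_pos (fun j _ => mul_pos (hc j) (Real.exp_pos _))
    Finset.univ_nonempty
  -- For an exact product kernel Λ = r c L / N² the row equations would give e^{u i} = Q for all i.
  -- Shifting by log Q therefore fixes the gauge so that only the discrepancy e^{±K} is left.
  set Q := N ^ 2 / (L * S) with hQ
  have hQ0 : 0 < Q := by positivity
  have hsum : ∀ i j, (u i - Real.log Q) + (v j + Real.log Q) = u i + v j := fun i j => by ring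
  have hα : ∀ i, |u i - Real.log Q| ≤ K := by
    intro i
    have h1 : Real.exp (u i) * ∑ j, Λ i j * Real.exp (v j) = r i := by
      rw [← hu i, Finset.mul_sum]
      exact Finset.sum_congr rfl fun j _ => by rw [Real.exp_add]; ring
    have h2 : (∑ j, Λ i j * Real.exp (v j)) * N ^ 2 ≤ Real.exp K * (r i * L * S) := by
      rw [hS, Finset.sum_mul, Finset.mul_sum, Finset.mul_sum]
      refine Finset.sum_le_sum fun j _ => ?_
      have := mul_le_mul_of_nonneg_right (hle i j) (Real.exp_pos (v j)).le
      linarith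
    have h3 : r i * L * S ≤ Real.exp K * ((∑ j, Λ i j * Real.exp (v j)) * N ^ 2) := by
      rw [hS, Finset.sum_mul, Finset.mul_sum, Finset.mul_sum]
      refine Finset.sum_le_sum fun j _ => ?_
      have := mul_le_mul_of_nonneg_right (hge i j) (Real.exp_pos (v j)).le
      linarith
    have hexp := Real.exp_pos (u i)
    have h4 : Q ≤ Real.exp (u i + K) := by
      rw [hQ, div_le_iff₀ (by positivity), Real.exp_add]
      have := mul_le_mul_of_nonneg_left h2 hexp.le
      rw [← mul_assoc, h1] at this
      refine le_of_mul_le_mul_left ?_ (hr i)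
      linarith
    have h5 : Real.exp (u i - K) ≤ Q := by
      rw [hQ, le_div_iff₀ (by positivity), Real.exp_sub, div_mul_eq_mul_div,
        div_le_iff₀ (Real.exp_pos K)]
      have := mul_le_mul_of_nonneg_left h3 hexp.le
      have h6 : Real.exp (u i) * (Real.exp K * ((∑ j, Λ i j * Real.exp (v j)) * N ^ 2))
          = r i * (N ^ 2 * Real.exp K) := by rw [← h1]; ring
      rw [h6] at this
      refine le_of_mul_le_mul_left ?_ (hr i)
      linarith
    have h4' := (Real.log_le_iff_le_exp hQ0).2 h4
    have h5' := (Real.le_log_iff_exp_le hQ0).2 h5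
    rw [abs_le]
    constructor <;> linarith
  refine ⟨fun i => u i - Real.log Q, fun j => v j + Real.log Q, fun i => ?_, fun j => ?_, hα,
    fun j => ?_⟩
  · simp_rw [hsum]
    exact hu i
  · simp_rw [hsum]
    exact hv j
  -- In the column equation the discrepancy of Λ and the bound on the row potentials contribute K
  -- each, which gives 2K around log(N / L).
  · set b := v j + Real.log Q with hb
    have h1 : Real.exp b * ∑ i, Λ i j * Real.exp (u i - Real.log Q) = c j := by
      rw [← hv j, Finset.mul_sum]
      refine Finset.sum_congr rfl fun i _ => ?_
      rw [show u i + v j = (u i - Real.log Q) + b by rw [hb]; ring,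
        Real.exp_add (u i - Real.log Q) b, mul_comm,
        mul_assoc]
    have hexp := Real.exp_pos b
    have h2 : (∑ i, Λ i j * Real.exp (u i - Real.log Q)) * N ≤ Real.exp (2 * K) * (c j * L) := by
      refine le_of_mul_le_mul_right ?_ hN
      have : ∀ i, Λ i j * Real.exp (u i - Real.log Q) * N ^ 2
          ≤ Real.exp (2 * K) * (c j * L) * r i := by
        intro i
        have e1 : Real.exp (u i - Real.log Q) ≤ Real.exp K :=
          Real.exp_le_exp.2 (abs_le.1 (hα i)).2
        have e2 := mul_le_mul (hle i j) e1 (Real.exp_pos _).le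
          (mul_pos (Real.exp_pos K) (mul_pos (mul_pos (hr i) (hc j)) hL)).le
        have e3 : Real.exp (2 * K) = Real.exp K * Real.exp K := by
          rw [← Real.exp_add, two_mul]
        rw [e3]
        linarith
      have h3 := Finset.sum_le_sum fun i (_ : i ∈ Finset.univ) => this i
      rw [← Finset.sum_mul, ← Finset.mul_sum, hrN] at h3
      linarith
    have h3 : c j * L ≤ Real.exp (2 * K) * ((∑ i, Λ i j * Real.exp (u i - Real.log Q)) * N) := by
      refine le_of_mul_le_mul_right ?_ hN
      have : ∀ i, c j * L * r i
          ≤ Real.exp (2 * K) * (Λ i j * Real.exp (u i - Real.log Q) * N ^ 2) := by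
        intro i
        have e1 : 1 ≤ Real.exp K * Real.exp (u i - Real.log Q) := by
          rw [← Real.exp_add]
          exact Real.one_le_exp (by linarith [(abs_le.1 (hα i)).1])
        have e2 := mul_le_mul (hge i j) e1 zero_le_one
          (mul_pos (Real.exp_pos K) (mul_pos (hΛ i j) (pow_pos hN 2))).le
        have e3 : Real.exp (2 * K) = Real.exp K * Real.exp K := by
          rw [← Real.exp_add, two_mul]
        rw [e3]
        linarith
      have h3 := Finset.sum_le_sum fun i (_ : i ∈ Finset.univ) => this i
      rw [← Finset.mul_sum, ← Finset.mul_sum, hrN, ← Finset.sum_mul] at h3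
      linarith
    have h4 : N / L ≤ Real.exp (b + 2 * K) := by
      rw [div_le_iff₀ hL, Real.exp_add]
      have := mul_le_mul_of_nonneg_left h2 hexp.le
      rw [← mul_assoc, h1] at this
      refine le_of_mul_le_mul_left ?_ (hc j)
      linarith
    have h5 : Real.exp (b - 2 * K) ≤ N / L := by
      rw [le_div_iff₀ hL, Real.exp_sub, div_mul_eq_mul_div, div_le_iff₀ (Real.exp_pos _)]
      have := mul_le_mul_of_nonneg_left h3 hexp.le
      have h6 : Real.exp b * (Real.exp (2 * K)
          * ((∑ i, Λ i j * Real.exp (u i - Real.log Q)) * N))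
          = c j * (N * Real.exp (2 * K)) := by rw [← h1]; ring
      rw [h6] at this
      refine le_of_mul_le_mul_left ?_ (hc j)
      linarith
    have h4' := (Real.log_le_iff_le_exp (by positivity)).2 h4
    have h5' := (Real.le_log_iff_exp_le (by positivity)).2 h5
    rw [abs_le]
    constructor <;> linarith

/-- If the margins of `Y` are within a factor `1 ± η` of `(r, c)` and `Y` satisfies a Doeblin
condition, then `Y` can be scaled to `(r, c)` by potentials of size `O(η)`. -/
theorem exists_scaling_of_near [Nonempty ι] {Y : ι → κ → ℝ} {N η τ : ℝ}
    (hY : ∀ i j, 0 ≤ Y i j) (hr : ∀ i, 0 < r i) (hc : ∀ j, 0 < c j)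
    (hrN : ∑ i, r i = N) (hcN : ∑ j, c j = N) (hη0 : 0 ≤ η) (hη : η ≤ 1 / 2) (hτ : 0 < τ)
    (hητ : 64 * Real.exp 2 * η ≤ τ)
    (hrow : ∀ i, |∑ j, Y i j - r i| ≤ η * r i) (hcol : ∀ j, |∑ i, Y i j - c j| ≤ η * c j)
    (hD : ∀ i l, τ * (r i * r l / N) ≤ ∑ j, Y i j * Y l j / c j) :
    ∃ (u : ι → ℝ) (v : κ → ℝ), (∀ i, ∑ j, Y i j * Real.exp (u i + v j) = r i) ∧
      (∀ j, ∑ i, Y i j * Real.exp (u i + v j) = c j) ∧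
      (∀ i, |u i| ≤ 64 * Real.exp 2 * η / τ) ∧
      ∀ j, |v j| ≤ 64 * Real.exp 2 * η / τ + 2 * η := by
  have hN : 0 < N := hrN ▸ Finset.sum_pos (fun i _ => hr i) Finset.univ_nonempty
  have hrow1 : ∀ i, (1 - η) * r i ≤ ∑ j, Y i j ∧ ∑ j, Y i j ≤ (1 + η) * r i := fun i => by
    have := abs_le.1 (hrow i)
    constructor <;> linarith [this.1, this.2]
  have hcol1 : ∀ j, (1 - η) * c j ≤ ∑ i, Y i j ∧ ∑ i, Y i j ≤ (1 + η) * c j := fun j => by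
    have := abs_le.1 (hcol j)
    constructor <;> linarith [this.1, this.2]
  have h1η : 0 < 1 - η := by linarith
  have hrow0 : ∀ i, 0 < ∑ j, Y i j := fun i => (mul_pos h1η (hr i)).trans_le (hrow1 i).1
  have hcol0 : ∀ j, 0 < ∑ i, Y i j := fun j => (mul_pos h1η (hc j)).trans_le (hcol1 j).1
  have hC0 : ∀ j, ∑ l, Y l j * Real.exp ((0 : ι → ℝ) l) = ∑ l, Y l j := fun j => by simp
  set S : ι → ℝ := fun i => ∑ j, c j * Y i j / ∑ l, Y l j with hS
  have hS0 : ∀ i, 0 < S i := rowSum_div_pos hY hrow0 hc hcol0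
  have hSle : ∀ i, S i ≤ (1 + η) / (1 - η) * r i := by
    intro i
    calc S i ≤ ∑ j, Y i j / (1 - η) := by
          refine Finset.sum_le_sum fun j _ => ?_
          rw [div_le_div_iff₀ (hcol0 j) h1η]
          have := mul_le_mul_of_nonneg_left (hcol1 j).1 (hY i j)
          linarith
      _ = (∑ j, Y i j) / (1 - η) := by rw [Finset.sum_div]
      _ ≤ (1 + η) * r i / (1 - η) := div_le_div_of_nonneg_right (hrow1 i).2 h1η.le
      _ = _ := by ring
  have hSge : ∀ i, (1 - η) / (1 + η) * r i ≤ S i := by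
    intro i
    calc (1 - η) / (1 + η) * r i = (1 - η) * r i / (1 + η) := by ring
      _ ≤ (∑ j, Y i j) / (1 + η) := div_le_div_of_nonneg_right (hrow1 i).1 (by linarith)
      _ = ∑ j, Y i j / (1 + η) := by rw [Finset.sum_div]
      _ ≤ S i := by
          refine Finset.sum_le_sum fun j _ => ?_
          rw [div_le_div_iff₀ (by linarith) (hcol0 j)]
          have := mul_le_mul_of_nonneg_left (hcol1 j).2 (hY i j)
          linarith
  -- One step from 0 sees only the margin error: S i / r i lies between (1 - η)/(1 + η) and its
  -- inverse, whose logarithm is at most 4η for η ≤ 1/2.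
  have hF0 : ∀ i, |sinkhornMap Y r c 0 i| ≤ 4 * η := by
    intro i
    have e1 : sinkhornMap Y r c 0 i = Real.log (r i) - Real.log (S i) := by
      simp only [sinkhornMap, hC0, hS]
    have e2 : Real.log ((1 + η) / (1 - η)) ≤ 4 * η := by
      refine (Real.log_le_sub_one_of_pos (by positivity)).trans ?_
      rw [div_sub_one h1η.ne', div_le_iff₀ h1η]
      nlinarith
    have e3 := Real.log_le_log (hS0 i) (hSle i)
    rw [Real.log_mul (by positivity) (hr i).ne'] at e3
    have e4 := Real.log_le_log (mul_pos (by positivity) (hr i)) (hSge i)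
    rw [Real.log_mul (by positivity) (hr i).ne'] at e4
    have e5 : Real.log ((1 - η) / (1 + η)) = -Real.log ((1 + η) / (1 - η)) := by
      rw [← Real.log_inv, inv_div]
    rw [e1, abs_le]
    constructor <;> linarith
  -- Column sums at most (3/2) c give the factor 4/9, and S i ≤ 3 r i gives 1/3. Their product 4/27
  -- exceeds 1/8.
  have hker : ∀ i l, τ / 8 * (r l / N) ≤ sinkhornKernel Y c 0 i l := by
    intro i l
    have e1 : sinkhornKernel Y c 0 i l
        = (∑ j, c j * Y i j * Y l j / (∑ l', Y l' j) ^ 2) / S i := by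
      simp [sinkhornKernel, hS]
    rw [e1, le_div_iff₀ (hS0 i)]
    have e2 : 4 / 9 * ∑ j, Y i j * Y l j / c j ≤ ∑ j, c j * Y i j * Y l j / (∑ l', Y l' j) ^ 2 := by
      rw [Finset.mul_sum]
      refine Finset.sum_le_sum fun j _ => ?_
      have hh : (∑ l', Y l' j) ^ 2 ≤ (3 / 2 * c j) ^ 2 :=
        pow_le_pow_left₀ (hcol0 j).le ((hcol1 j).2.trans
          (mul_le_mul_of_nonneg_right (by linarith) (hc j).le)) 2
      calc 4 / 9 * (Y i j * Y l j / c j) = c j * Y i j * Y l j / (3 / 2 * c j) ^ 2 := by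
            have := (hc j).ne'
            field_simp
            ring
        _ ≤ _ := div_le_div_of_nonneg_left (mul_nonneg (mul_nonneg (hc j).le (hY i j)) (hY l j))
            (pow_pos (hcol0 j) 2) hh
    have e3 : S i ≤ 3 * r i := (hSle i).trans (mul_le_mul_of_nonneg_right
      (by rw [div_le_iff₀ h1η]; linarith) (hr i).le)
    have e4 := hD i l
    have e5 : 0 < τ * (r l / N) := mul_pos hτ (div_pos (hr l) hN)
    calc τ / 8 * (r l / N) * S i ≤ τ / 8 * (r l / N) * (3 * r i) :=
          mul_le_mul_of_nonneg_left e3 (by linarith)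
      _ = 3 / 8 * (τ * (r i * r l / N)) := by ring
      _ ≤ 4 / 9 * ∑ j, Y i j * Y l j / c j := by
          have : 0 ≤ τ * (r i * r l / N) :=
            mul_nonneg hτ.le (div_nonneg (mul_nonneg (hr i).le (hr l).le) hN.le)
          linarith
      _ ≤ _ := e2
  have hπ : ∑ l, r l / N = 1 := by rw [← Finset.sum_div, hrN, div_self hN.ne']
  obtain ⟨e, he⟩ : ∃ e, e = Real.exp (-(2 * 1)) := ⟨_, rfl⟩
  have he0 : 0 < e := he ▸ Real.exp_pos _
  -- The contraction rate on potentials of oscillation at most 1, with e = e^{-2}. The assumption on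
  -- η says exactly that 8η ≤ τ₁, which makes {osc ≤ 1} invariant.
  set τ₁ := e * (τ / 8) with hτ₁
  have hτ₁0 : 0 < τ₁ := mul_pos he0 (by linarith)
  have he2 : e * Real.exp 2 = 1 := by
    rw [he, ← Real.exp_add]
    norm_num
  have hητ₁ : 8 * η ≤ τ₁ := by
    have := mul_le_mul_of_nonneg_left hητ he0.le
    have h2 : e * (64 * Real.exp 2 * η) = 64 * η := by linear_combination 64 * η * he2
    rw [hτ₁]
    linarith
  have hbτ : 64 * Real.exp 2 * η / τ = 8 * η / τ₁ := by
    rw [div_eq_div_iff hτ.ne' hτ₁0.ne', hτ₁]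
    linear_combination (8 * η * τ) * he2
  have hcontr : ∀ {u w : ι → ℝ}, (∀ i j, u i - u j ≤ 1) → (∀ i j, w i - w j ≤ 1) →
      ∀ {d : ℝ}, (∀ i j, (u i - w i) - (u j - w j) ≤ d) → ∀ i j,
      (sinkhornMap Y r c u i - sinkhornMap Y r c w i)
        - (sinkhornMap Y r c u j - sinkhornMap Y r c w j) ≤ (1 - τ₁) * d := by
    intro u w hu hw d hd i j
    rw [hτ₁, he]
    exact sinkhornMap_contraction hY hcol0 hrow0 hc hπ hker hu hw hd i j
  have hself : ∀ u : ι → ℝ, (∀ i j, u i - u j ≤ 1) → ∀ d, (∀ i j, u i - u j ≤ d) → ∀ i j,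
      sinkhornMap Y r c u i - sinkhornMap Y r c u j ≤ 8 * η + (1 - τ₁) * d := by
    intro u hu d hd i j
    have h1 := hcontr hu (w := 0) (by simp) (d := d) (by simpa using hd) i j
    have h2 := abs_le.1 (hF0 i)
    have h3 := abs_le.1 (hF0 j)
    linarith [h2.1, h2.2, h3.1, h3.2]
  obtain ⟨u, hu1, a, hu⟩ := exists_fixed_up_to_const
    (continuous_sinkhornMap (r := r) hY hcol0 hrow0 hc) zero_le_one
    (fun u hu i j => by have := hself u hu 1 hu i j; linarith)
    (fun u w hu hw d hd hdd i j => by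
      refine (hcontr hu hw hdd i j).trans_lt ?_
      have := mul_pos hτ₁0 hd
      linarith)
  -- At the fixed point osc u ≤ 8η + (1 - τ₁) osc u, and solving for osc u improves the a priori
  -- bound 1 to O(η).
  have hosc : ∀ i j, u i - u j ≤ 8 * η / τ₁ := by
    obtain ⟨x, hx⟩ := Finite.exists_max u
    obtain ⟨y, hy⟩ := Finite.exists_min u
    have h1 : ∀ i j, u i - u j ≤ u x - u y := fun i j => by linarith [hx i, hy j]
    have h2 := hself u hu1 _ h1 x y
    rw [hu, hu] at h2
    intro i j
    rw [le_div_iff₀ hτ₁0]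
    have h3 := mul_le_mul_of_nonneg_right (h1 i j) hτ₁0.le
    linarith
  obtain ⟨i₀⟩ := ‹Nonempty ι›
  set b := 64 * Real.exp 2 * η / τ with hb
  rw [← hbτ] at hosc
  -- Normalization at one coordinate turns the oscillation bound into a sup bound. The column
  -- potentials absorb the constant.
  set w : ι → ℝ := fun i => u i - u i₀ with hw
  have hwb : ∀ i, |w i| ≤ b := fun i => by
    rw [abs_le]
    have h1 := hosc i i₀
    have h2 := hosc i₀ i
    simp only [hw]
    constructor <;> linarith
  have hC := colSum_exp_pos hY hcol0 u
  have hCw := colSum_exp_pos hY hcol0 w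
  have hCwu : ∀ j, ∑ l, Y l j * Real.exp (u l) = Real.exp (u i₀) * ∑ l, Y l j * Real.exp (w l) := by
    intro j
    rw [Finset.mul_sum]
    refine Finset.sum_congr rfl fun l _ => ?_
    simp only [hw]
    rw [Real.exp_sub]
    have := (Real.exp_pos (u i₀)).ne'
    field_simp
  have hscal := scaling_of_sinkhornMap_eq hY hcol0 hrow0 hr hc (hrN.trans hcN.symm) hu
    (v := fun j => Real.log (c j / ∑ l, Y l j * Real.exp (u l))) fun _ => rfl
  have hv : ∀ i j, w i + Real.log (c j / ∑ l, Y l j * Real.exp (w l))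
      = u i + Real.log (c j / ∑ l, Y l j * Real.exp (u l)) := by
    intro i j
    rw [hCwu, Real.log_div (hc j).ne' (mul_pos (Real.exp_pos _) (hCw j)).ne',
      Real.log_mul (Real.exp_pos _).ne' (hCw j).ne', Real.log_exp,
      Real.log_div (hc j).ne' (hCw j).ne']
    simp only [hw]
    ring
  refine ⟨w, fun j => Real.log (c j / ∑ l, Y l j * Real.exp (w l)), fun i => ?_, fun j => ?_, hwb,
    fun j => ?_⟩
  · simp_rw [hv]
    exact hscal.1 i
  · simp_rw [hv]
    exact hscal.2 j
  · have hlog : -(2 * η) ≤ Real.log (1 - η) := by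
      have h := Real.one_sub_inv_le_log_of_pos h1η
      refine le_trans ?_ h
      rw [← sub_nonneg]
      have : 1 - (1 - η)⁻¹ - -(2 * η) = η * (1 - 2 * η) / (1 - η) := by
        field_simp
        ring
      rw [this]
      exact div_nonneg (mul_nonneg hη0 (by linarith)) h1η.le
    have hlog2 : Real.log (1 + η) ≤ 2 * η := by
      have := Real.log_le_sub_one_of_pos (show 0 < 1 + η by linarith)
      linarith
    have hup : ∑ l, Y l j * Real.exp (w l) ≤ Real.exp b * ((1 + η) * c j) := by
      refine le_trans ?_ (mul_le_mul_of_nonneg_left (hcol1 j).2 (Real.exp_pos b).le)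
      rw [Finset.mul_sum]
      refine Finset.sum_le_sum fun l _ => ?_
      rw [mul_comm]
      exact mul_le_mul_of_nonneg_right (Real.exp_le_exp.2 (abs_le.1 (hwb l)).2) (hY l j)
    have hdn : Real.exp (-b) * ((1 - η) * c j) ≤ ∑ l, Y l j * Real.exp (w l) := by
      refine le_trans (mul_le_mul_of_nonneg_left (hcol1 j).1 (Real.exp_pos _).le) ?_
      rw [Finset.mul_sum]
      refine Finset.sum_le_sum fun l _ => ?_
      rw [mul_comm]
      exact mul_le_mul_of_nonneg_left (Real.exp_le_exp.2 (abs_le.1 (hwb l)).1) (hY l j)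
    have hcj := hc j
    have h1 := Real.log_le_log (hCw j) hup
    rw [Real.log_mul (Real.exp_pos _).ne' (by positivity), Real.log_exp,
      Real.log_mul (by positivity) hcj.ne'] at h1
    have h2 := Real.log_le_log (by positivity) hdn
    rw [Real.log_mul (Real.exp_pos _).ne' (by positivity), Real.log_exp,
      Real.log_mul (by positivity) hcj.ne'] at h2
    beta_reduce
    rw [Real.log_div hcj.ne' (hCw j).ne', abs_le]
    constructor <;> linarith

/-! ### Orthogonal projection and first-order expansion -/

/-- Orthogonal projection of `g` off the potentials `p ⊕ q` in `ℓ²(Z)`, with a sup-norm bound. -/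
theorem exists_projection [Nonempty ι] {Z g : ι → κ → ℝ} {N G τ : ℝ}
    (hZ : ∀ i j, 0 ≤ Z i j) (hr : ∀ i, 0 < r i) (hc : ∀ j, 0 < c j) (hrN : ∑ i, r i = N)
    (hrow : ∀ i, ∑ j, Z i j = r i) (hcol : ∀ j, ∑ i, Z i j = c j) (hτ : 0 < τ) (hG : 0 ≤ G)
    (hD : ∀ i l, τ * (r i * r l / N) ≤ ∑ j, Z i j * Z l j / c j) (hg : ∀ i j, |g i j| ≤ G) :
    ∃ (p : ι → ℝ) (q : κ → ℝ), (∀ i, ∑ j, Z i j * (g i j - p i - q j) = 0) ∧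
      (∀ j, ∑ i, Z i j * (g i j - p i - q j) = 0) ∧
      ∀ i j, |g i j - p i - q j| ≤ 2 * G + 4 * G / τ := by
  have hN : 0 < N := hrN ▸ Finset.sum_pos (fun i _ => hr i) Finset.univ_nonempty
  -- The normal equations are solved by alternating conditional averages: Q p is the column average
  -- of g - p, and F p the row average of g - Q p. Two values of F differ by the two-step Markov
  -- kernel P applied to the difference of the arguments, so no derivative is needed.
  set Q : (ι → ℝ) → κ → ℝ := fun p j => (∑ l, Z l j * (g l j - p l)) / c j with hQ
  set F : (ι → ℝ) → ι → ℝ := fun p i => (∑ j, Z i j * (g i j - Q p j)) / r i with hF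
  set P : ι → ι → ℝ := fun i l => (∑ j, Z i j * Z l j / c j) / r i with hP
  have hP1 : ∀ i, ∑ l, P i l = 1 := by
    intro i
    simp only [hP]
    rw [← Finset.sum_div, Finset.sum_comm, div_eq_one_iff_eq (hr i).ne', ← hrow i]
    refine Finset.sum_congr rfl fun j _ => ?_
    rw [← Finset.sum_div, ← Finset.mul_sum, hcol, mul_div_cancel_right₀ _ (hc j).ne']
  have hPτ : ∀ i l, τ * (r l / N) ≤ P i l := by
    intro i l
    simp only [hP]
    rw [le_div_iff₀ (hr i)]
    refine le_trans (le_of_eq ?_) (hD i l)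
    ring
  have hπ : ∑ l, r l / N = 1 := by rw [← Finset.sum_div, hrN, div_self hN.ne']
  have hdiff : ∀ u w i, F u i - F w i = ∑ l, P i l * (u l - w l) := by
    intro u w i
    have h1 : ∀ j, Q w j - Q u j = ∑ l, Z l j / c j * (u l - w l) := by
      intro j
      simp only [hQ]
      rw [← sub_div, ← Finset.sum_sub_distrib, Finset.sum_div]
      exact Finset.sum_congr rfl fun l _ => by ring
    simp only [hF]
    rw [← sub_div, ← Finset.sum_sub_distrib]
    have h2 : ∀ j, Z i j * (g i j - Q u j) - Z i j * (g i j - Q w j)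
        = ∑ l, Z i j * Z l j / c j * (u l - w l) := by
      intro j
      rw [← mul_sub, show g i j - Q u j - (g i j - Q w j) = Q w j - Q u j by ring, h1,
        Finset.mul_sum]
      exact Finset.sum_congr rfl fun l _ => by ring
    simp_rw [h2]
    rw [Finset.sum_comm, Finset.sum_div]
    refine Finset.sum_congr rfl fun l _ => ?_
    simp only [hP]
    rw [← Finset.sum_mul]
    ring
  have hcontr : ∀ (u w : ι → ℝ) d, (∀ i j, (u i - w i) - (u j - w j) ≤ d) → ∀ i j,
      (F u i - F w i) - (F u j - F w j) ≤ (1 - τ) * d := by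
    intro u w d hd i j
    rw [hdiff, hdiff]
    exact sum_sub_sum_le_of_minorized (hP1 i) (hP1 j) hπ (hPτ i) (hPτ j) hd
  have hQ0 : ∀ j, |Q 0 j| ≤ G := by
    intro j
    simp only [hQ, Pi.zero_apply, sub_zero]
    rw [abs_div, abs_of_pos (hc j), div_le_iff₀ (hc j), ← hcol j, Finset.mul_sum]
    refine (Finset.abs_sum_le_sum_abs _ _).trans (Finset.sum_le_sum fun l _ => ?_)
    rw [abs_mul, abs_of_nonneg (hZ l j), mul_comm]
    exact mul_le_mul_of_nonneg_right (hg l j) (hZ l j)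
  have hF0 : ∀ i, |F 0 i| ≤ 2 * G := by
    intro i
    simp only [hF]
    rw [abs_div, abs_of_pos (hr i), div_le_iff₀ (hr i), ← hrow i, Finset.mul_sum]
    refine (Finset.abs_sum_le_sum_abs _ _).trans (Finset.sum_le_sum fun j _ => ?_)
    rw [abs_mul, abs_of_nonneg (hZ i j), mul_comm]
    refine mul_le_mul_of_nonneg_right ((abs_sub _ _).trans ?_) (hZ i j)
    linarith [hg i j, hQ0 j]
  have hFc : Continuous F := by
    refine continuous_pi fun i => ?_
    simp only [hF, hQ]
    fun_prop
  -- The radius 4G/τ solves 4G + (1 - τ)ρ = ρ, where 4G bounds the oscillation of F 0.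
  obtain ⟨p, hp1, a, hp⟩ := exists_fixed_up_to_const hFc (ρ := 4 * G / τ) (by positivity)
    (fun u hu i j => by
      have h1 := hcontr u 0 _ (by simpa using hu) i j
      have h2 := abs_le.1 (hF0 i)
      have h3 := abs_le.1 (hF0 j)
      have h4 : τ * (4 * G / τ) = 4 * G := by field_simp
      linarith [h2.1, h2.2, h3.1, h3.2])
    (fun u w _ _ d hd hdd i j => by
      have := mul_pos hτ hd
      linarith [hcontr u w d hdd i j])
  have hcols : ∀ j, ∑ i, Z i j * (g i j - p i - Q p j) = 0 := by
    intro j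
    have h1 : Q p j * c j = ∑ l, Z l j * (g l j - p l) := by
      simp only [hQ]
      rw [div_mul_cancel₀ _ (hc j).ne']
    simp_rw [mul_sub _ (_ - _) (Q p j)]
    rw [Finset.sum_sub_distrib, ← h1, ← Finset.sum_mul, hcol, mul_comm, sub_self]
  have hrows : ∀ i, ∑ j, Z i j * (g i j - p i - Q p j) = r i * a := by
    intro i
    have h1 : F p i * r i = ∑ j, Z i j * (g i j - Q p j) := by
      simp only [hF]
      rw [div_mul_cancel₀ _ (hr i).ne']
    have h2 : ∀ j, Z i j * (g i j - p i - Q p j) = Z i j * (g i j - Q p j) - Z i j * p i :=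
      fun j => by ring
    simp_rw [h2]
    rw [Finset.sum_sub_distrib, ← h1, ← Finset.sum_mul, hrow, hp]
    ring
  have ha : a = 0 := by
    have h1 : ∑ i, r i * a = 0 := by
      rw [← Finset.sum_congr rfl fun i _ => hrows i, Finset.sum_comm]
      simp [hcols]
    rw [← Finset.sum_mul, hrN] at h1
    exact (mul_eq_zero.1 h1).resolve_left hN.ne'
  refine ⟨p, Q p, fun i => by rw [hrows, ha, mul_zero], hcols, fun i j => ?_⟩
  -- Neither p nor q need be bounded separately, but p i + q j is a column average of g l j + p i -
  -- p l, so only the oscillation of p enters.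
  have h1 : p i + Q p j = (∑ l, Z l j * (g l j + (p i - p l))) / c j := by
    simp only [hQ]
    rw [eq_div_iff (hc j).ne', add_mul, div_mul_cancel₀ _ (hc j).ne', ← hcol j, Finset.mul_sum,
      ← Finset.sum_add_distrib]
    exact Finset.sum_congr rfl fun l _ => by ring
  have h2 : |p i + Q p j| ≤ G + 4 * G / τ := by
    rw [h1, abs_div, abs_of_pos (hc j), div_le_iff₀ (hc j), ← hcol j, Finset.mul_sum]
    refine (Finset.abs_sum_le_sum_abs _ _).trans (Finset.sum_le_sum fun l _ => ?_)
    rw [abs_mul, abs_of_nonneg (hZ l j), mul_comm]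
    refine mul_le_mul_of_nonneg_right ((abs_add_le _ _).trans (add_le_add (hg l j) ?_)) (hZ l j)
    rw [abs_le]
    constructor <;> linarith [hp1 i l, hp1 l i]
  rw [sub_sub]
  refine (abs_sub _ _).trans ?_
  linarith [hg i j]

/-- First-order expansion of a linear functional of a scaled matrix around the matrix `Z`. -/
theorem abs_sum_mul_scaling_sub_le {Z Y T g : ι → κ → ℝ} {p u : ι → ℝ} {q v : κ → ℝ}
    {A N η b t : ℝ} (hY : ∀ i j, 0 ≤ Y i j)
    (hrN : ∑ i, r i = N) (hcN : ∑ j, c j = N)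
    (hZrow : ∀ i, ∑ j, Z i j = r i) (hZcol : ∀ j, ∑ i, Z i j = c j)
    (hTrow : ∀ i, ∑ j, T i j = r i) (hTcol : ∀ j, ∑ i, T i j = c j)
    (hT : ∀ i j, T i j = Y i j * Real.exp (u i + v j))
    (hu : ∀ i, |u i| ≤ b) (hv : ∀ j, |v j| ≤ b) (hb : b ≤ 1 / 2)
    (horow : ∀ i, ∑ j, Z i j * (g i j - p i - q j) = 0)
    (hocol : ∀ j, ∑ i, Z i j * (g i j - p i - q j) = 0)
    (hA : ∀ i j, |g i j - p i - q j| ≤ A) (hA0 : 0 ≤ A)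
    (hErow : ∀ i, |∑ j, (Y i j - Z i j) * (g i j - p i - q j)| ≤ η * r i)
    (hEcol : ∀ j, |∑ i, (Y i j - Z i j) * (g i j - p i - q j)| ≤ η * c j)
    (hE : |∑ i, ∑ j, (Y i j - Z i j) * (g i j - p i - q j)| ≤ t * N)
    (hmass : ∀ i, ∑ j, Y i j ≤ 2 * r i) :
    |∑ i, ∑ j, g i j * (T i j - Z i j)| ≤ (t + 2 * b * η + 8 * A * b ^ 2) * N := by
  set h : ι → κ → ℝ := fun i j => g i j - p i - q j with hh
  -- T and Z have equal margins, so subtracting p ⊕ q from g changes nothing.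
  have e1 : ∑ i, ∑ j, g i j * (T i j - Z i j) = ∑ i, ∑ j, h i j * (T i j - Z i j) := by
    have h1 : ∑ i, ∑ j, p i * (T i j - Z i j) = 0 := by
      simp_rw [← Finset.mul_sum, Finset.sum_sub_distrib, hTrow, hZrow]
      simp
    have h2 : ∑ i, ∑ j, q j * (T i j - Z i j) = 0 := by
      rw [Finset.sum_comm]
      simp_rw [← Finset.mul_sum, Finset.sum_sub_distrib, hTcol, hZcol]
      simp
    have h3 : ∀ i j, h i j * (T i j - Z i j)
        = g i j * (T i j - Z i j) - p i * (T i j - Z i j) - q j * (T i j - Z i j) :=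
      fun i j => by simp only [hh]; ring
    have h4 : ∑ i, ∑ j, h i j * (T i j - Z i j) = ∑ i, ∑ j, g i j * (T i j - Z i j)
        - ∑ i, ∑ j, p i * (T i j - Z i j) - ∑ i, ∑ j, q j * (T i j - Z i j) := by
      simp_rw [h3, Finset.sum_sub_distrib]
    rw [h4, h1, h2]
    ring
  -- With s = u + v and T = Y e^s, this writes T - Z as (Y - Z) + s (Y - Z) + s Z + Y (e^s - 1 - s).
  have e2 : ∀ i j, h i j * (T i j - Z i j) = (Y i j - Z i j) * h i j
      + u i * ((Y i j - Z i j) * h i j) + v j * ((Y i j - Z i j) * h i j)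
      + u i * (Z i j * h i j) + v j * (Z i j * h i j)
      + h i j * (Y i j * (Real.exp (u i + v j) - 1 - (u i + v j))) := by
    intro i j
    rw [hT]
    ring
  -- Here the orthogonality of h pays off: the terms linear in the potentials, which would be of
  -- size b, vanish. All others except the linear functional are products of two small quantities.
  have e3 : ∑ i, ∑ j, u i * (Z i j * h i j) = 0 := by
    simp_rw [← Finset.mul_sum]
    simp [hh, horow]
  have e4 : ∑ i, ∑ j, v j * (Z i j * h i j) = 0 := by
    rw [Finset.sum_comm]
    simp_rw [← Finset.mul_sum]
    simp [hh, hocol]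
  have e5 : |∑ i, ∑ j, u i * ((Y i j - Z i j) * h i j)| ≤ b * η * N := by
    simp_rw [← Finset.mul_sum]
    rw [← hrN, Finset.mul_sum]
    refine (Finset.abs_sum_le_sum_abs _ _).trans (Finset.sum_le_sum fun i _ => ?_)
    rw [abs_mul, mul_assoc]
    exact mul_le_mul (hu i) (hErow i) (abs_nonneg _) ((abs_nonneg _).trans (hu i))
  have e6 : |∑ i, ∑ j, v j * ((Y i j - Z i j) * h i j)| ≤ b * η * N := by
    rw [Finset.sum_comm]
    simp_rw [← Finset.mul_sum]
    rw [← hcN, Finset.mul_sum]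
    refine (Finset.abs_sum_le_sum_abs _ _).trans (Finset.sum_le_sum fun j _ => ?_)
    rw [abs_mul, mul_assoc]
    exact mul_le_mul (hv j) (hEcol j) (abs_nonneg _) ((abs_nonneg _).trans (hv j))
  -- The Taylor remainder is at most (2b)² = 4b², and the total mass of Y is at most 2N.
  have e7 : |∑ i, ∑ j, h i j * (Y i j * (Real.exp (u i + v j) - 1 - (u i + v j)))|
      ≤ 8 * A * b ^ 2 * N := by
    have h1 : ∀ i j, |h i j * (Y i j * (Real.exp (u i + v j) - 1 - (u i + v j)))|
        ≤ A * (4 * b ^ 2) * Y i j := by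
      intro i j
      have hs : |u i + v j| ≤ 2 * b := (abs_add_le _ _).trans (by linarith [hu i, hv j])
      have hb0 : 0 ≤ b := (abs_nonneg _).trans (hu i)
      have h2 := Real.abs_exp_sub_one_sub_id_le (x := u i + v j) (by linarith)
      have h3 : (u i + v j) ^ 2 ≤ 4 * b ^ 2 := by
        rw [← sq_abs]
        nlinarith [abs_nonneg (u i + v j)]
      rw [abs_mul, abs_mul, abs_of_nonneg (hY i j)]
      calc |h i j| * (Y i j * |Real.exp (u i + v j) - 1 - (u i + v j)|)
          ≤ A * (Y i j * (4 * b ^ 2)) := mul_le_mul (hA i j)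
            (mul_le_mul_of_nonneg_left (h2.trans h3) (hY i j))
            (mul_nonneg (hY i j) (abs_nonneg _)) hA0
        _ = _ := by ring
    calc _ ≤ ∑ i, ∑ j, A * (4 * b ^ 2) * Y i j :=
          (Finset.abs_sum_le_sum_abs _ _).trans (Finset.sum_le_sum fun i _ =>
            (Finset.abs_sum_le_sum_abs _ _).trans (Finset.sum_le_sum fun j _ => h1 i j))
      _ = ∑ i, A * (4 * b ^ 2) * ∑ j, Y i j := by simp_rw [Finset.mul_sum]
      _ ≤ ∑ i, A * (4 * b ^ 2) * (2 * r i) := Finset.sum_le_sum fun i _ =>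
          mul_le_mul_of_nonneg_left (hmass i) (by positivity)
      _ = 8 * A * b ^ 2 * N := by
          rw [← hrN, ← Finset.mul_sum, ← Finset.mul_sum]
          ring
  rw [e1]
  simp_rw [e2, Finset.sum_add_distrib]
  rw [e3, e4]
  rw [abs_le] at e5 e6 e7 hE ⊢
  constructor <;> nlinarith [e5.1, e5.2, e6.1, e6.2, e7.1, e7.2, hE.1, hE.2]

end Scaling

/-! ### Concentration -/

/-- This is the reciprocal of 1 + x + x²/2 ≤ e^x, because (1 + x + x²/2)(1 - x + x²/2) = 1 + x⁴/4 ≥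
1. -/
theorem exp_neg_le_quadratic {x : ℝ} (hx : 0 ≤ x) : Real.exp (-x) ≤ 1 - x + x ^ 2 / 2 := by
  have h1 := Real.quadratic_le_exp_of_nonneg hx
  have h2 : 0 < 1 + x + x ^ 2 / 2 := by positivity
  rw [Real.exp_neg, inv_le_comm₀ (Real.exp_pos x) (by nlinarith [sq_nonneg (x - 1)])]
  refine le_trans ?_ h1
  rw [inv_le_iff_one_le_mul₀ (by nlinarith [sq_nonneg (x - 1)])]
  nlinarith [sq_nonneg (x ^ 2)]

theorem hasSum_exp_sub_one_sub (x : ℝ) :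
    HasSum (fun k : ℕ => x ^ (k + 2) / ((k + 2).factorial : ℝ)) (Real.exp x - 1 - x) := by
  have h := NormedSpace.expSeries_div_hasSum_exp (𝔸 := ℝ) x
  rw [← Real.exp_eq_exp_ℝ] at h
  have h2 := (hasSum_nat_add_iff' 2).2 h
  have h3 : Real.exp x - ∑ i ∈ Finset.range 2, x ^ i / (i.factorial : ℝ) = Real.exp x - 1 - x := by
    simp [Finset.sum_range_succ]
    ring
  rwa [h3] at h2

/-- Bernstein's moment condition controls the moment generating function. -/
theorem mgf_le_of_moment_le {Ω : Type*} [MeasurableSpace Ω] {P : Measure Ω}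
    [IsProbabilityMeasure P] {ξ : Ω → ℝ} {σ R s : ℝ} (hint : Integrable ξ P)
    (hmean : ∫ ω, ξ ω ∂P = 0) (hR : 0 ≤ R)
    (hmi : ∀ q : ℕ, 2 ≤ q → Integrable (fun ω => |ξ ω| ^ q) P)
    (hm : ∀ q : ℕ, 2 ≤ q → ∫ ω, |ξ ω| ^ q ∂P ≤ (q.factorial : ℝ) / 2 * σ ^ 2 * R ^ (q - 2))
    (hs : |s| * R ≤ 1 / 2) :
    Integrable (fun ω => Real.exp (s * ξ ω)) P ∧ mgf ξ P s ≤ Real.exp (s ^ 2 * σ ^ 2) := by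
  -- The centred variable kills the linear term, so the moment generating function is at most 1 + E
  -- h. Taking |sξ| makes all Taylor terms of h nonnegative.
  set h : Ω → ℝ := fun ω => Real.exp |s * ξ ω| - 1 - |s * ξ ω| with hh
  have hh0 : ∀ ω, 0 ≤ h ω := fun ω => by
    have := Real.add_one_le_exp |s * ξ ω|
    simp only [hh]
    linarith
  have hhm : AEStronglyMeasurable h P := by
    have h1 := hint.aestronglyMeasurable
    have h2 : AEMeasurable ξ P := h1.aemeasurable
    exact AEMeasurable.aestronglyMeasurable (by fun_prop)
  set F : ℕ → Ω → ℝ := fun k ω => |s * ξ ω| ^ (k + 2) / ((k + 2).factorial : ℝ) with hF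
  have hFi : ∀ k, Integrable (F k) P := fun k => by
    have : F k = fun ω => |s| ^ (k + 2) / ((k + 2).factorial : ℝ) * |ξ ω| ^ (k + 2) := by
      ext ω
      simp only [hF, abs_mul, mul_pow]
      ring
    rw [this]
    exact (hmi (k + 2) (by omega)).const_mul _
  have hF0 : ∀ k ω, 0 ≤ F k ω := fun k ω => by positivity
  -- The factorial in the moment condition cancels that of the Taylor term, and |s| R ≤ 1/2 leaves a
  -- geometric series.
  have hFb : ∀ k, ∫ ω, F k ω ∂P ≤ s ^ 2 * σ ^ 2 / 2 * (1 / 2) ^ k := by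
    intro k
    have h1 : ∀ ω, F k ω = |s| ^ (k + 2) / ((k + 2).factorial : ℝ) * |ξ ω| ^ (k + 2) := by
      intro ω
      simp only [hF, abs_mul, mul_pow]
      ring
    simp_rw [h1]
    rw [integral_const_mul]
    have h2 := hm (k + 2) (by omega)
    have hfac : (0 : ℝ) < ((k + 2).factorial : ℝ) := by positivity
    calc |s| ^ (k + 2) / ((k + 2).factorial : ℝ) * ∫ ω, |ξ ω| ^ (k + 2) ∂P
        ≤ |s| ^ (k + 2) / ((k + 2).factorial : ℝ)
          * (((k + 2).factorial : ℝ) / 2 * σ ^ 2 * R ^ (k + 2 - 2)) :=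
          mul_le_mul_of_nonneg_left h2 (by positivity)
      _ = |s| ^ 2 * σ ^ 2 / 2 * (|s| * R) ^ k := by
          rw [Nat.add_sub_cancel, mul_pow, pow_add]
          field_simp
      _ ≤ s ^ 2 * σ ^ 2 / 2 * (1 / 2) ^ k := by
          rw [sq_abs]
          exact mul_le_mul_of_nonneg_left (pow_le_pow_left₀ (by positivity) hs k) (by positivity)
  -- The sum is exchanged with the lower integral, which gives integrability of h and its bound at
  -- once.
  have hlin : ∫⁻ ω, ENNReal.ofReal (h ω) ∂P ≤ ENNReal.ofReal (s ^ 2 * σ ^ 2) := by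
    have h1 : ∀ ω, ENNReal.ofReal (h ω) = ∑' k, ENNReal.ofReal (F k ω) := fun ω => by
      have := hasSum_exp_sub_one_sub |s * ξ ω|
      rw [← ENNReal.ofReal_tsum_of_nonneg (fun k => hF0 k ω) this.summable, this.tsum_eq]
    simp_rw [h1]
    rw [lintegral_tsum fun k => (hFi k).aestronglyMeasurable.aemeasurable.ennreal_ofReal]
    have h2 : ∀ k, ∫⁻ ω, ENNReal.ofReal (F k ω) ∂P
        ≤ ENNReal.ofReal (s ^ 2 * σ ^ 2 / 2 * (1 / 2) ^ k) := fun k => by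
      rw [← ofReal_integral_eq_lintegral_ofReal (hFi k) (Eventually.of_forall (hF0 k))]
      exact ENNReal.ofReal_le_ofReal (hFb k)
    refine (ENNReal.tsum_le_tsum h2).trans (le_of_eq ?_)
    have h3 : HasSum (fun k : ℕ => s ^ 2 * σ ^ 2 / 2 * (1 / 2 : ℝ) ^ k) (s ^ 2 * σ ^ 2) := by
      have := hasSum_geometric_two.mul_left (s ^ 2 * σ ^ 2 / 2)
      rwa [div_mul_cancel₀ _ (two_ne_zero' ℝ)] at this
    rw [← ENNReal.ofReal_tsum_of_nonneg (fun k => by positivity) h3.summable, h3.tsum_eq]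
  have hhi : Integrable h P := by
    refine ⟨hhm, ?_⟩
    rw [hasFiniteIntegral_iff_ofReal (Eventually.of_forall hh0)]
    exact hlin.trans_lt ENNReal.ofReal_lt_top
  have hhle : ∫ ω, h ω ∂P ≤ s ^ 2 * σ ^ 2 := by
    rw [integral_eq_lintegral_of_nonneg_ae (Eventually.of_forall hh0) hhm]
    exact ENNReal.toReal_le_of_le_ofReal (by positivity) hlin
  have hle : ∀ ω, Real.exp (s * ξ ω) ≤ 1 + s * ξ ω + h ω := by
    intro ω
    simp only [hh]
    -- For negative x this is the inequality y ≤ sinh y at y = -x.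
    have hmono : ∀ x : ℝ, Real.exp x - 1 - x ≤ Real.exp |x| - 1 - |x| := by
      intro x
      rcases le_total 0 x with hx | hx
      · rw [abs_of_nonneg hx]
      · rw [abs_of_nonpos hx]
        have := Real.self_le_sinh_iff.2 (neg_nonneg.2 hx)
        rw [Real.sinh_eq, neg_neg] at this
        linarith
    linarith [hmono (s * ξ ω)]
  have hli : Integrable (fun ω => 1 + s * ξ ω) P := (integrable_const _).add (hint.const_mul s)
  have hbi : Integrable (fun ω => 1 + s * ξ ω + h ω) P := hli.add hhi
  have hei : Integrable (fun ω => Real.exp (s * ξ ω)) P := by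
    refine hbi.mono' ?_ (Eventually.of_forall fun ω => ?_)
    · have h2 : AEMeasurable ξ P := hint.aestronglyMeasurable.aemeasurable
      exact AEMeasurable.aestronglyMeasurable (by fun_prop)
    · rw [Real.norm_eq_abs, abs_of_pos (Real.exp_pos _)]
      exact hle ω
  refine ⟨hei, ?_⟩
  calc mgf ξ P s ≤ ∫ ω, (1 + s * ξ ω + h ω) ∂P := integral_mono hei hbi hle
    _ = 1 + ∫ ω, h ω ∂P := by
        rw [integral_add hli hhi,
          integral_add (integrable_const _) (hint.const_mul s), integral_const_mul, hmean]
        simp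
    _ ≤ Real.exp (s ^ 2 * σ ^ 2) := by
        have := Real.add_one_le_exp (s ^ 2 * σ ^ 2)
        linarith

namespace IsSubexponentialMatrix

variable {m n : ℕ} {Ω : Type*} [MeasurableSpace Ω] {P : Measure Ω} [IsProbabilityMeasure P]
  {X : Ω → Matrix (Fin m) (Fin n) ℝ} {Λ : Matrix (Fin m) (Fin n) ℝ} {σ R : ℝ}

theorem mgf_sub_le (hX : IsSubexponentialMatrix P X Λ σ R) {s : ℝ} (hs : |s| * R ≤ 1 / 2)
    (i : Fin m) (j : Fin n) :
    Integrable (fun ω => Real.exp (s * (X ω i j - Λ i j))) P ∧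
      mgf (fun ω => X ω i j - Λ i j) P s ≤ Real.exp (s ^ 2 * σ ^ 2) :=
  mgf_le_of_moment_le ((hX.integrable i j).sub (integrable_const _))
    (by rw [integral_sub (hX.integrable i j) (integrable_const _), hX.mean]; simp)
    hX.R_pos.le (hX.moment_integrable i j) (hX.moment_le i j) hs

/-- Chernoff bound for weighted sums of the centred entries. -/
theorem chernoff (hX : IsSubexponentialMatrix P X Λ σ R) (w : Fin m → Fin n → ℝ) {A B s t : ℝ}
    (hA : ∀ i j, |w i j| ≤ A) (hB : ∑ i, ∑ j, w i j ^ 2 ≤ B) (hs : 0 ≤ s)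
    (hsA : s * A * R ≤ 1 / 2) :
    P.real {ω | t < ∑ i, ∑ j, w i j * (X ω i j - Λ i j)}
      ≤ Real.exp (-(s * t) + s ^ 2 * σ ^ 2 * B) := by
  set Y : Fin m × Fin n → Ω → ℝ := fun p ω => w p.1 p.2 * (X ω p.1 p.2 - Λ p.1 p.2) with hY
  have hYm : ∀ p, Measurable (Y p) := fun p => by
    have := hX.measurable p.1 p.2
    simp only [hY]
    fun_prop
  have hind : iIndepFun Y P := hX.indep.comp
    (fun p x => w p.1 p.2 * (x - Λ p.1 p.2)) fun p => by fun_prop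
  have hsw : ∀ p : Fin m × Fin n, |s * w p.1 p.2| * R ≤ 1 / 2 := fun p => by
    refine le_trans (mul_le_mul_of_nonneg_right ?_ hX.R_pos.le) hsA
    rw [abs_mul, abs_of_nonneg hs]
    exact mul_le_mul_of_nonneg_left (hA _ _) hs
  have hint : ∀ p, Integrable (fun ω => Real.exp (s * Y p ω)) P := fun p => by
    simp only [hY, ← mul_assoc]
    exact (hX.mgf_sub_le (hsw p) p.1 p.2).1
  have hmgf : ∀ p, mgf (Y p) P s ≤ Real.exp ((s * w p.1 p.2) ^ 2 * σ ^ 2) := fun p => by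
    refine le_of_eq_of_le ?_ (hX.mgf_sub_le (hsw p) p.1 p.2).2
    simp only [mgf, hY, ← mul_assoc]
  have hsumeq : ∀ ω, ∑ i, ∑ j, w i j * (X ω i j - Λ i j) = (∑ p, Y p) ω := fun ω => by
    rw [Finset.sum_apply, Fintype.sum_prod_type]
  calc P.real {ω | t < ∑ i, ∑ j, w i j * (X ω i j - Λ i j)}
      ≤ P.real {ω | t ≤ (∑ p, Y p) ω} := by
        refine measureReal_mono fun ω hω => ?_
        have : t < ∑ i, ∑ j, w i j * (X ω i j - Λ i j) := hω
        rw [hsumeq] at this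
        exact this.le
    _ ≤ Real.exp (-s * t) * mgf (∑ p, Y p) P s :=
        measure_ge_le_exp_mul_mgf t hs (hind.integrable_exp_mul_sum hYm fun p _ => hint p)
    _ ≤ Real.exp (-s * t) * Real.exp (s ^ 2 * σ ^ 2 * B) := by
        refine mul_le_mul_of_nonneg_left ?_ (Real.exp_pos _).le
        rw [hind.mgf_sum hYm]
        calc ∏ p, mgf (Y p) P s ≤ ∏ p : Fin m × Fin n, Real.exp ((s * w p.1 p.2) ^ 2 * σ ^ 2) :=
              Finset.prod_le_prod (fun _ _ => mgf_nonneg) fun p _ => hmgf p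
          _ = Real.exp (s ^ 2 * σ ^ 2 * ∑ i, ∑ j, w i j ^ 2) := by
              rw [← Real.exp_sum, Fintype.sum_prod_type, Finset.mul_sum]
              simp_rw [Finset.mul_sum]
              congr 1
              exact Finset.sum_congr rfl fun i _ => Finset.sum_congr rfl fun j _ => by ring
          _ ≤ _ := Real.exp_le_exp.2 (mul_le_mul_of_nonneg_left hB (by positivity))
    _ = _ := by rw [← Real.exp_add]; ring_nf

/-- Two-sided Chernoff bound. -/
theorem chernoff_abs (hX : IsSubexponentialMatrix P X Λ σ R) (w : Fin m → Fin n → ℝ)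
    {A B s t : ℝ} (hA : ∀ i j, |w i j| ≤ A) (hB : ∑ i, ∑ j, w i j ^ 2 ≤ B) (hs : 0 ≤ s)
    (hsA : s * A * R ≤ 1 / 2) :
    P.real {ω | t < |∑ i, ∑ j, w i j * (X ω i j - Λ i j)|}
      ≤ 2 * Real.exp (-(s * t) + s ^ 2 * σ ^ 2 * B) := by
  have h1 := hX.chernoff w (t := t) hA hB hs hsA
  have h2 := hX.chernoff (fun i j => -w i j) (t := t) (A := A) (B := B)
    (by simpa using hA) (by simpa using hB) hs hsA
  have h3 : {ω | t < |∑ i, ∑ j, w i j * (X ω i j - Λ i j)|}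
      ⊆ {ω | t < ∑ i, ∑ j, w i j * (X ω i j - Λ i j)}
        ∪ {ω | t < ∑ i, ∑ j, -w i j * (X ω i j - Λ i j)} := by
    intro ω hω
    have : t < |∑ i, ∑ j, w i j * (X ω i j - Λ i j)| := hω
    rcases lt_abs.1 this with h | h
    · exact Or.inl h
    · refine Or.inr ?_
      change t < ∑ i, ∑ j, -w i j * (X ω i j - Λ i j)
      simpa [Finset.sum_neg_distrib] using h
  calc _ ≤ _ := measureReal_mono h3
    _ ≤ _ := measureReal_union_le _ _
    _ ≤ _ := by linarith

theorem second_moment (hX : IsSubexponentialMatrix P X Λ σ R) (i : Fin m) (j : Fin n) :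
    Integrable (fun ω => X ω i j ^ 2) P ∧ ∫ ω, X ω i j ^ 2 ∂P ≤ σ ^ 2 + Λ i j ^ 2 := by
  have h1 := hX.moment_integrable i j 2 le_rfl
  have h2 := hX.moment_le i j 2 le_rfl
  simp only [sq_abs] at h1 h2
  have h3 : ∀ ω, X ω i j ^ 2
      = (X ω i j - Λ i j) ^ 2 + 2 * Λ i j * X ω i j - Λ i j ^ 2 := fun ω => by ring
  simp_rw [h3]
  have h4 := (hX.integrable i j).const_mul (2 * Λ i j)
  have h5 : Integrable (fun ω => (X ω i j - Λ i j) ^ 2 + 2 * Λ i j * X ω i j) P := h1.add h4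
  refine ⟨h5.sub (integrable_const _), ?_⟩
  rw [integral_sub h5 (integrable_const _), integral_add h1 h4, integral_const_mul,
    hX.mean]
  simp at h2 ⊢
  nlinarith

/-- The products in different columns depend on disjoint sets of entries, so one column at a time
splits off by independence of blocks. -/
theorem integral_exp_neg_sum_mul (hX : IsSubexponentialMatrix P X Λ σ R) (i l : Fin m)
    (s : ℝ) (T : Finset (Fin n)) :
    ∫ ω, Real.exp (-(s * ∑ j ∈ T, X ω i j * X ω l j)) ∂P
      = ∏ j ∈ T, ∫ ω, Real.exp (-(s * (X ω i j * X ω l j))) ∂P := by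
  classical
  induction T using Finset.induction_on with
  | empty => simp
  | insert j T hj ih =>
    rw [Finset.prod_insert hj, ← ih]
    set S₁ : Finset (Fin m × Fin n) := {(i, j), (l, j)} with hS₁
    set S₂ : Finset (Fin m × Fin n) := ({i, l} : Finset (Fin m)) ×ˢ T with hS₂
    have hdisj : Disjoint S₁ S₂ := by
      rw [Finset.disjoint_left]
      rintro ⟨a, b⟩ h1 h2
      simp only [hS₁, hS₂, Finset.mem_insert, Finset.mem_singleton, Prod.mk.injEq,
        Finset.mem_product] at h1 h2
      have : b = j := by tauto
      exact hj (this ▸ h2.2)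
    have hi1 : (i, j) ∈ S₁ := by simp [hS₁]
    have hl1 : (l, j) ∈ S₁ := by simp [hS₁]
    have hind := hX.indep.indepFun_finset S₁ S₂ hdisj fun p => hX.measurable p.1 p.2
    have hcomp := hind.comp
      (φ := fun a : S₁ → ℝ => Real.exp (-(s * (a ⟨_, hi1⟩ * a ⟨_, hl1⟩))))
      (ψ := fun a : S₂ → ℝ => Real.exp (-(s * ∑ j' ∈ T.attach,
        a ⟨(i, j'.1), by simp [hS₂]⟩ * a ⟨(l, j'.1), by simp [hS₂]⟩)))
      (by fun_prop) (by fun_prop)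
    have hmul := hcomp.integral_fun_mul_eq_mul_integral
      (by
        have h1 := hX.measurable i j
        have h2 := hX.measurable l j
        exact Measurable.aestronglyMeasurable (by simp only [Function.comp_def]; fun_prop))
      (by
        have h1 := fun j => hX.measurable i j
        have h2 := fun j => hX.measurable l j
        exact Measurable.aestronglyMeasurable (by simp only [Function.comp_def]; fun_prop))
    simp only [Function.comp_def] at hmul
    have hatt : ∀ ω, ∑ j' ∈ T.attach, X ω i j'.1 * X ω l j'.1 = ∑ j ∈ T, X ω i j * X ω l j :=
      fun ω => Finset.sum_attach T fun j => X ω i j * X ω l j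
    simp only [hatt] at hmul
    rw [← hmul]
    refine integral_congr_ae (Eventually.of_forall fun ω => ?_)
    change Real.exp _ = Real.exp _ * Real.exp _
    rw [← Real.exp_add, Finset.sum_insert hj]
    ring_nf

/-- Lower tail for the inner product of two distinct rows. -/
theorem row_inner_lower_tail (hX : IsSubexponentialMatrix P X Λ σ R) {i l : Fin m} (hil : i ≠ l)
    {a b : ℝ} (ha : 0 < a) (haΛ : ∀ i j, a ≤ Λ i j) (hb : ∀ i j, Λ i j ≤ b) :
    P.real {ω | ∑ j, X ω i j * X ω l j < n * a ^ 2 / 2}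
      ≤ Real.exp (-(n * (a ^ 4 / (8 * (σ ^ 2 + b ^ 2) ^ 2)))) := by
  set v := (σ ^ 2 + b ^ 2) ^ 2 with hv
  have hσ := hX.sigma_pos
  have hv0 : 0 < v := by positivity
  -- The minimizer of -s a²/2 + s² v/2, the exponent per column after the threshold a²/2 is
  -- included. Its value there is -a⁴/(8v).
  set s := a ^ 2 / (2 * v) with hs
  have hs0 : 0 < s := by positivity
  have hfac : ∀ j, ∫ ω, Real.exp (-(s * (X ω i j * X ω l j))) ∂P
      ≤ Real.exp (-(s * a ^ 2) + s ^ 2 * v / 2) := by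
    intro j
    have hind : IndepFun (fun ω => X ω i j) (fun ω => X ω l j) P :=
      hX.indep.indepFun (i := (i, j)) (j := (l, j)) (by simp [hil])
    have hYi : Integrable (fun ω => X ω i j * X ω l j) P :=
      hind.integrable_mul (hX.integrable i j) (hX.integrable l j)
    have hYm : ∫ ω, X ω i j * X ω l j ∂P = Λ i j * Λ l j := by
      rw [hind.integral_fun_mul_eq_mul_integral (hX.integrable i j).aestronglyMeasurable
        (hX.integrable l j).aestronglyMeasurable, hX.mean, hX.mean]
    have hind2 : IndepFun (fun ω => X ω i j ^ 2) (fun ω => X ω l j ^ 2) P :=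
      hind.comp (φ := fun x => x ^ 2) (ψ := fun x => x ^ 2) (by fun_prop) (by fun_prop)
    have hYi2 : Integrable (fun ω => X ω i j ^ 2 * X ω l j ^ 2) P :=
      hind2.integrable_mul (hX.second_moment i j).1 (hX.second_moment l j).1
    have hb2 : ∀ i, σ ^ 2 + Λ i j ^ 2 ≤ σ ^ 2 + b ^ 2 := fun i => by
      have := pow_le_pow_left₀ (ha.le.trans (haΛ i j)) (hb i j) 2
      linarith
    have hYm2 : ∫ ω, X ω i j ^ 2 * X ω l j ^ 2 ∂P ≤ v := by
      rw [hind2.integral_fun_mul_eq_mul_integral (hX.second_moment i j).1.aestronglyMeasurable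
        (hX.second_moment l j).1.aestronglyMeasurable, hv, sq (σ ^ 2 + b ^ 2)]
      exact mul_le_mul ((hX.second_moment i j).2.trans (hb2 i))
        ((hX.second_moment l j).2.trans (hb2 l)) (integral_nonneg fun ω => sq_nonneg _)
        (by positivity)
    have hli : Integrable (fun ω => 1 - s * (X ω i j * X ω l j)) P :=
      (integrable_const _).sub (hYi.const_mul s)
    have hbi : Integrable (fun ω => 1 - s * (X ω i j * X ω l j)
        + s ^ 2 / 2 * (X ω i j ^ 2 * X ω l j ^ 2)) P :=
      hli.add (hYi2.const_mul _)
    have hle : ∀ᵐ ω ∂P, Real.exp (-(s * (X ω i j * X ω l j)))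
        ≤ 1 - s * (X ω i j * X ω l j) + s ^ 2 / 2 * (X ω i j ^ 2 * X ω l j ^ 2) := by
      filter_upwards [hX.nonneg] with ω hω
      refine (exp_neg_le_quadratic
        (mul_nonneg hs0.le (mul_nonneg (hω i j) (hω l j)))).trans (le_of_eq ?_)
      ring
    calc ∫ ω, Real.exp (-(s * (X ω i j * X ω l j))) ∂P
        ≤ ∫ ω, (1 - s * (X ω i j * X ω l j) + s ^ 2 / 2 * (X ω i j ^ 2 * X ω l j ^ 2)) ∂P :=
          integral_mono_of_nonneg (Eventually.of_forall fun ω => (Real.exp_pos _).le) hbi hle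
      _ = 1 - s * (Λ i j * Λ l j) + s ^ 2 / 2 * ∫ ω, X ω i j ^ 2 * X ω l j ^ 2 ∂P := by
          rw [integral_add hli (hYi2.const_mul _),
            integral_sub (integrable_const _) (hYi.const_mul s), integral_const_mul,
            integral_const_mul, hYm]
          simp
      _ ≤ 1 + (-(s * a ^ 2) + s ^ 2 * v / 2) := by
          have h1 : a ^ 2 ≤ Λ i j * Λ l j := by
            rw [sq]
            exact mul_le_mul (haΛ i j) (haΛ l j) ha.le (ha.le.trans (haΛ i j))
          have h2 := mul_le_mul_of_nonneg_left h1 hs0.le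
          have h3 := mul_le_mul_of_nonneg_left hYm2 (by positivity : 0 ≤ s ^ 2 / 2)
          linarith
      _ ≤ _ := by
          have := Real.add_one_le_exp (-(s * a ^ 2) + s ^ 2 * v / 2)
          linarith
  have hmeas : Measurable fun ω => ∑ j, X ω i j * X ω l j := by
    have h1 := fun j => hX.measurable i j
    have h2 := fun j => hX.measurable l j
    fun_prop
  have hint : Integrable (fun ω => Real.exp (-s * ∑ j, X ω i j * X ω l j)) P := by
    refine Integrable.mono' (integrable_const 1)
      (Real.measurable_exp.comp (hmeas.const_mul (-s))).aestronglyMeasurable ?_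
    filter_upwards [hX.nonneg] with ω hω
    rw [Real.norm_eq_abs, abs_of_pos (Real.exp_pos _), Real.exp_le_one_iff]
    have : 0 ≤ ∑ j, X ω i j * X ω l j :=
      Finset.sum_nonneg fun j _ => mul_nonneg (hω i j) (hω l j)
    nlinarith
  calc P.real {ω | ∑ j, X ω i j * X ω l j < n * a ^ 2 / 2}
      ≤ P.real {ω | ∑ j, X ω i j * X ω l j ≤ n * a ^ 2 / 2} :=
        measureReal_mono fun ω hω => by
          have h : ∑ j, X ω i j * X ω l j < n * a ^ 2 / 2 := hω
          exact h.le
    _ ≤ Real.exp (-(-s) * (n * a ^ 2 / 2)) * mgf (fun ω => ∑ j, X ω i j * X ω l j) P (-s) :=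
        measure_le_le_exp_mul_mgf _ (by linarith) hint
    _ ≤ Real.exp (-(-s) * (n * a ^ 2 / 2)) * Real.exp (-(s * a ^ 2) + s ^ 2 * v / 2) ^ n := by
        refine mul_le_mul_of_nonneg_left ?_ (Real.exp_pos _).le
        simp only [mgf, neg_mul]
        rw [hX.integral_exp_neg_sum_mul i l s Finset.univ]
        calc _ ≤ ∏ _j : Fin n, Real.exp (-(s * a ^ 2) + s ^ 2 * v / 2) :=
              Finset.prod_le_prod (fun j _ => integral_nonneg fun ω => (Real.exp_pos _).le)
                fun j _ => hfac j
          _ = _ := by simp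
    _ = _ := by
        rw [← Real.exp_nat_mul, ← Real.exp_add]
        congr 1
        rw [hs]
        field_simp
        ring

/-- All pairs of distinct rows are aligned, up to an exponentially small probability. -/
theorem row_alignment (hX : IsSubexponentialMatrix P X Λ σ R) {a b : ℝ} (ha : 0 < a)
    (haΛ : ∀ i j, a ≤ Λ i j) (hb : ∀ i j, Λ i j ≤ b) :
    P.real {ω | ∃ i l, i ≠ l ∧ ∑ j, X ω i j * X ω l j < n * a ^ 2 / 2}
      ≤ ((m : ℝ) ^ 2 - m) * Real.exp (-(n * (a ^ 4 / (8 * (σ ^ 2 + b ^ 2) ^ 2)))) := by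
  classical
  have h1 : {ω | ∃ i l, i ≠ l ∧ ∑ j, X ω i j * X ω l j < n * a ^ 2 / 2}
      = ⋃ p ∈ (Finset.univ : Finset (Fin m)).offDiag,
        {ω | ∑ j, X ω p.1 j * X ω p.2 j < n * a ^ 2 / 2} := by
    ext ω
    simp
  rw [h1]
  refine (measureReal_biUnion_finset_le _ _).trans ?_
  refine (Finset.sum_le_card_nsmul _ _ _ fun p hp =>
    hX.row_inner_lower_tail (Finset.mem_offDiag.1 hp).2.2 ha haΛ hb).trans (le_of_eq ?_)
  rw [Finset.offDiag_card, nsmul_eq_mul, Nat.cast_sub (Nat.le_mul_self _)]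
  simp [sq]

end IsSubexponentialMatrix

/-! ### Scalings of matrices -/

theorem IsScalingOf.apply_eq {m n : ℕ} {r : Fin m → ℝ} {c : Fin n → ℝ}
    {A Z : Matrix (Fin m) (Fin n) ℝ} (h : IsScalingOf r c A Z) :
    ∃ (u : Fin m → ℝ) (v : Fin n → ℝ), ∀ i j, Z i j = A i j * Real.exp (u i + v j) := by
  obtain ⟨⟨d₁, d₂, h₁, h₂, rfl⟩, -⟩ := h
  refine ⟨fun i => Real.log (d₁ i), fun j => Real.log (d₂ j), fun i j => ?_⟩
  rw [Real.exp_add, Real.exp_log (h₁ i), Real.exp_log (h₂ j), Matrix.mul_diagonal,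
    Matrix.diagonal_mul]
  ring

theorem isScalingOf_of_exp {m n : ℕ} {r : Fin m → ℝ} {c : Fin n → ℝ}
    {A : Matrix (Fin m) (Fin n) ℝ} {u : Fin m → ℝ} {v : Fin n → ℝ}
    (hrow : ∀ i, ∑ j, A i j * Real.exp (u i + v j) = r i)
    (hcol : ∀ j, ∑ i, A i j * Real.exp (u i + v j) = c j) :
    IsScalingOf r c A fun i j => A i j * Real.exp (u i + v j) := by
  refine ⟨⟨fun i => Real.exp (u i), fun j => Real.exp (v j), fun i => Real.exp_pos _,
    fun j => Real.exp_pos _, ?_⟩, hrow, hcol⟩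
  ext i j
  rw [Matrix.mul_diagonal, Matrix.diagonal_mul, Real.exp_add]
  ring

/-- The Sinkhorn rescaling is the given scaling. -/
theorem sinkhornRescale_eq {m n : ℕ} {r : Fin m → ℝ} {c : Fin n → ℝ}
    {A : Matrix (Fin m) (Fin n) ℝ} {u : Fin m → ℝ} {v : Fin n → ℝ} (hA : ∀ i j, 0 ≤ A i j)
    (hrow : ∀ i, ∑ j, A i j * Real.exp (u i + v j) = r i)
    (hcol : ∀ j, ∑ i, A i j * Real.exp (u i + v j) = c j) (i : Fin m) (j : Fin n) :
    sinkhornRescale r c A i j = A i j * Real.exp (u i + v j) := by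
  have hex : ∃ Z, IsScalingOf r c A Z := ⟨_, isScalingOf_of_exp hrow hcol⟩
  unfold sinkhornRescale
  rw [dif_pos hex]
  have hs := hex.choose_spec
  obtain ⟨u', v', h⟩ := hs.apply_eq
  -- The matrix picked by choice and the given one are scalings of each other with the same margins,
  -- so they agree.
  refine scaling_unique (Z := fun i j => A i j * Real.exp (u i + v j))
    (T := hex.choose) (u := fun i => u' i - u i) (v := fun j => v' j - v j)
    (fun i j => mul_nonneg (hA i j) (Real.exp_pos _).le) (fun i j => ?_)
    (fun i => by rw [hs.2.1, hrow]) (fun j => by rw [hs.2.2, hcol]) i j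
  rw [h, mul_assoc, ← Real.exp_add]
  congr 2
  ring

/-! ### Consequences of smooth margins and bounded cost -/

namespace IsSmoothMargin

variable {m n : ℕ} {δ : ℝ} {r : Fin m → ℝ} {c : Fin n → ℝ}

theorem nonempty_left (h : IsSmoothMargin δ r c) : Nonempty (Fin m) := by
  by_contra hm
  rw [not_nonempty_iff] at hm
  simpa using h.mass_pos

theorem nonempty_right (h : IsSmoothMargin δ r c) : Nonempty (Fin n) := by
  by_contra hn
  rw [not_nonempty_iff] at hn
  have := h.mass_eq ▸ h.mass_pos
  simp at this

theorem left_pos (h : IsSmoothMargin δ r c) : 0 < (m : ℝ) := by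
  obtain ⟨i⟩ := h.nonempty_left
  exact_mod_cast i.pos

theorem right_pos (h : IsSmoothMargin δ r c) : 0 < (n : ℝ) := by
  obtain ⟨j⟩ := h.nonempty_right
  exact_mod_cast j.pos

theorem row_pos (h : IsSmoothMargin δ r c) (hδ : 0 < δ) (i : Fin m) : 0 < r i :=
  lt_of_lt_of_le (div_pos (mul_pos hδ h.mass_pos) h.left_pos) (h.row_bounds i).1

theorem col_pos (h : IsSmoothMargin δ r c) (hδ : 0 < δ) (j : Fin n) : 0 < c j :=
  lt_of_lt_of_le (div_pos (mul_pos hδ h.mass_pos) h.right_pos) (h.col_bounds j).1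

theorem le_one (h : IsSmoothMargin δ r c) (hδ : 0 < δ) : δ ≤ 1 := by
  obtain ⟨i⟩ := h.nonempty_left
  have h1 := (h.row_bounds i).1.trans (h.row_bounds i).2
  have hm := h.left_pos
  have hN := h.mass_pos
  rw [div_le_div_iff₀ hm (by positivity)] at h1
  have h2 : (∑ i, r i) * m * δ ^ 2 ≤ (∑ i, r i) * m * 1 := by linarith
  have h3 := le_of_mul_le_mul_left h2 (by positivity)
  nlinarith

end IsSmoothMargin

/-- The two-sided bounds contained in the bounded cost condition. -/
theorem HasBoundedCost.bounds {m n : ℕ} {K : ℝ} {r : Fin m → ℝ} {c : Fin n → ℝ}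
    {Λ : Matrix (Fin m) (Fin n) ℝ} (h : HasBoundedCost K r c Λ) (hr : ∀ i, 0 < r i)
    (hc : ∀ j, 0 < c j) (hΛ : ∀ i j, 0 < Λ i j) (hL : 0 < entryNorm Λ) (hN : 0 < ∑ i, r i)
    (i : Fin m) (j : Fin n) :
    Λ i j * (∑ i, r i) ^ 2 ≤ Real.exp K * (r i * c j * entryNorm Λ) ∧
      r i * c j * entryNorm Λ ≤ Real.exp K * (Λ i j * (∑ i, r i) ^ 2) := by
  have h1 : 0 < r i * c j * entryNorm Λ := mul_pos (mul_pos (hr i) (hc j)) hL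
  have h2 : 0 < Λ i j * (∑ i, r i) ^ 2 := mul_pos (hΛ i j) (pow_pos hN 2)
  have h3 := abs_le.1 (h i j)
  have h4 := (Real.le_log_iff_exp_le (div_pos h1 h2)).1 h3.1
  have h5 := (Real.log_le_iff_le_exp (div_pos h1 h2)).1 h3.2
  rw [le_div_iff₀ h2, Real.exp_neg, inv_mul_le_iff₀ (Real.exp_pos K)] at h4
  rw [div_le_iff₀ h2] at h5
  exact ⟨h4, h5⟩

/-! ### Typical matrices and their scalings -/

/-- The properties of potentials `α, β` that scale the mean matrix `Λ` to the margin `(r, c)`. -/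
structure IsPotentialPair {m n : ℕ} (K : ℝ) (r : Fin m → ℝ) (c : Fin n → ℝ)
    (Λ : Matrix (Fin m) (Fin n) ℝ) (α : Fin m → ℝ) (β : Fin n → ℝ) : Prop where
  row : ∀ i, ∑ j, Λ i j * Real.exp (α i + β j) = r i
  col : ∀ j, ∑ i, Λ i j * Real.exp (α i + β j) = c j
  left_le : ∀ i, |α i| ≤ K
  right_le : ∀ j, |β j - Real.log ((∑ i, r i) / entryNorm Λ)| ≤ 2 * K

theorem entryNorm_pos {m n : ℕ} [Nonempty (Fin m)] [Nonempty (Fin n)]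
    {Λ : Matrix (Fin m) (Fin n) ℝ} (hΛ : ∀ i j, 0 < Λ i j) : 0 < entryNorm Λ :=
  Finset.sum_pos (fun i _ => Finset.sum_pos (fun j _ => abs_pos.2 (hΛ i j).ne')
    Finset.univ_nonempty) Finset.univ_nonempty

theorem exists_isPotentialPair {m n : ℕ} {K δ : ℝ} {r : Fin m → ℝ} {c : Fin n → ℝ}
    {Λ : Matrix (Fin m) (Fin n) ℝ} (hs : IsSmoothMargin δ r c) (hδ : 0 < δ)
    (hK : HasBoundedCost K r c Λ) (hΛ : ∀ i j, 0 < Λ i j) :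
    ∃ α β, IsPotentialPair K r c Λ α β := by
  have := hs.nonempty_left
  have := hs.nonempty_right
  have hb := hK.bounds (hs.row_pos hδ) (hs.col_pos hδ) hΛ (entryNorm_pos hΛ) hs.mass_pos
  obtain ⟨α, β, h1, h2, h3, h4⟩ := exists_potentials_of_bounded_cost hΛ (hs.row_pos hδ)
    (hs.col_pos hδ) rfl hs.mass_eq.symm (entryNorm_pos hΛ) (fun i j => (hb i j).1)
    (fun i j => (hb i j).2)
  exact ⟨α, β, h1, h2, h3, h4⟩

/-- The constant in the Doeblin condition of an aligned matrix. -/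
noncomputable def alignConst (K δ : ℝ) : ℝ := Real.exp (-(8 * K)) * δ ^ 7 / 4

/-- The factor between the relative deviation of the margins and the size of the potentials. -/
noncomputable def potentialConst (K δ : ℝ) : ℝ := 64 * Real.exp 2 / alignConst K δ + 2

/-- The sup-norm bound for the projected test matrix. -/
noncomputable def projectionConst (K G : ℝ) : ℝ := 2 * G + 4 * G / Real.exp (-(8 * K))

theorem alignConst_pos {K δ : ℝ} (hδ : 0 < δ) : 0 < alignConst K δ := by
  unfold alignConst
  positivity

/-- `X` is close enough to its mean `Λ`: the weighted fluctuations of its row sums, its column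
sums and one linear functional are small and distinct rows are aligned. -/
structure IsTypical {m n : ℕ} (δ η t : ℝ) (Λ X : Matrix (Fin m) (Fin n) ℝ)
    (w h : Fin m → Fin n → ℝ) : Prop where
  nonneg : ∀ i j, 0 ≤ X i j
  align : ∀ i l, i ≠ l → n * minEntry Λ ^ 2 / 2 ≤ ∑ j, X i j * X l j
  row : ∀ i, |∑ j, w i j * (X i j - Λ i j)| ≤ η * (δ * entryNorm Λ / m)
  col : ∀ j, |∑ i, w i j * (X i j - Λ i j)| ≤ η * (δ * entryNorm Λ / n)
  row' : ∀ i, |∑ j, w i j * h i j * (X i j - Λ i j)| ≤ η * (δ * entryNorm Λ / m)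
  col' : ∀ j, |∑ i, w i j * h i j * (X i j - Λ i j)| ≤ η * (δ * entryNorm Λ / n)
  total : |∑ i, ∑ j, w i j * h i j * (X i j - Λ i j)| ≤ t * entryNorm Λ

theorem minEntry_le {m n : ℕ} (Λ : Matrix (Fin m) (Fin n) ℝ) (i : Fin m) (j : Fin n) :
    minEntry Λ ≤ Λ i j :=
  ciInf_le (Set.finite_range _).bddBelow (i, j)

theorem le_maxEntry {m n : ℕ} (Λ : Matrix (Fin m) (Fin n) ℝ) (i : Fin m) (j : Fin n) :
    Λ i j ≤ maxEntry Λ :=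
  le_ciSup (f := fun p : Fin m × Fin n => Λ p.1 p.2) (Set.finite_range _).bddAbove (i, j)

theorem exists_eq_minEntry {m n : ℕ} [Nonempty (Fin m)] [Nonempty (Fin n)]
    (Λ : Matrix (Fin m) (Fin n) ℝ) : ∃ i j, Λ i j = minEntry Λ := by
  obtain ⟨p, hp⟩ := exists_eq_ciInf_of_finite (f := fun p : Fin m × Fin n => Λ p.1 p.2)
  exact ⟨p.1, p.2, hp⟩

namespace IsPotentialPair

variable {m n : ℕ} {K δ : ℝ} {r : Fin m → ℝ} {c : Fin n → ℝ} {Λ : Matrix (Fin m) (Fin n) ℝ}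
  {α : Fin m → ℝ} {β : Fin n → ℝ}

/-- The exponent 3K is K from the row potential plus 2K from the column potential, the latter
measured from log(N / L). -/
theorem exp_bounds (h : IsPotentialPair K r c Λ α β) (hL : 0 < entryNorm Λ)
    (hN : 0 < ∑ i, r i) (i : Fin m) (j : Fin n) :
    Real.exp (-(3 * K)) ≤ entryNorm Λ / (∑ i, r i) * Real.exp (α i + β j) ∧
      entryNorm Λ / (∑ i, r i) * Real.exp (α i + β j) ≤ Real.exp (3 * K) := by
  have h1 : entryNorm Λ / (∑ i, r i) * Real.exp (α i + β j)
      = Real.exp (α i + (β j - Real.log ((∑ i, r i) / entryNorm Λ))) := by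
    rw [← add_sub_assoc, Real.exp_sub, Real.exp_log (div_pos hN hL)]
    field_simp
  have h2 := abs_le.1 (h.left_le i)
  have h3 := abs_le.1 (h.right_le j)
  rw [h1]
  constructor <;> refine Real.exp_le_exp.2 ?_ <;> linarith [h2.1, h2.2, h3.1, h3.2]

/-- The lower bound `Z ≥ e^{-4K} r c / N` for the scaled mean matrix. -/
theorem scaled_ge (h : IsPotentialPair K r c Λ α β) (hs : IsSmoothMargin δ r c) (hδ : 0 < δ)
    (hK : HasBoundedCost K r c Λ) (hΛ : ∀ i j, 0 < Λ i j) (i : Fin m) (j : Fin n) :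
    Real.exp (-(4 * K)) * (r i * c j / ∑ i, r i) ≤ Λ i j * Real.exp (α i + β j) := by
  have := hs.nonempty_left
  have := hs.nonempty_right
  have hL := entryNorm_pos hΛ
  have hN := hs.mass_pos
  have h1 := (hK.bounds (hs.row_pos hδ) (hs.col_pos hδ) hΛ hL hN i j).2
  have h2 := (h.exp_bounds hL hN i j).1
  have h3 : Real.exp (-(4 * K)) * Real.exp K = Real.exp (-(3 * K)) := by
    rw [← Real.exp_add]
    ring_nf
  have h4 := mul_le_mul_of_nonneg_left h1 (Real.exp_pos (-(4 * K))).le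
  rw [← mul_assoc _ (Real.exp K), h3] at h4
  have h5 := mul_le_mul_of_nonneg_right h2 (mul_pos (hΛ i j) (pow_pos hN 2)).le
  have h6 : Real.exp (-(4 * K)) * (r i * c j / ∑ i, r i)
      = Real.exp (-(4 * K)) * (r i * c j * entryNorm Λ) / (entryNorm Λ * ∑ i, r i) := by
    field_simp
  rw [h6, div_le_iff₀ (mul_pos hL hN)]
  refine (h4.trans h5).trans (le_of_eq ?_)
  field_simp

/-- The scaled mean is at least e^{-4K} times the product of the margins. Multiplying this bound for
two rows gives the Doeblin constant e^{-8K} that appears in `projectionConst`. -/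
theorem exists_projection (h : IsPotentialPair K r c Λ α β) (hs : IsSmoothMargin δ r c)
    (hδ : 0 < δ) (hK : HasBoundedCost K r c Λ) (hΛ : ∀ i j, 0 < Λ i j) {G : ℝ} (hG : 0 ≤ G)
    {g : Fin m → Fin n → ℝ} (hg : ∀ i j, |g i j| ≤ G) :
    ∃ (p : Fin m → ℝ) (q : Fin n → ℝ),
      (∀ i, ∑ j, Λ i j * Real.exp (α i + β j) * (g i j - p i - q j) = 0) ∧
      (∀ j, ∑ i, Λ i j * Real.exp (α i + β j) * (g i j - p i - q j) = 0) ∧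
      ∀ i j, |g i j - p i - q j| ≤ projectionConst K G := by
  have := hs.nonempty_left
  have hc := hs.col_pos hδ
  have hN := hs.mass_pos
  refine _root_.exists_projection (r := r) (c := c)
    (fun i j => mul_nonneg (hΛ i j).le (Real.exp_pos _).le) (hs.row_pos hδ) hc rfl
    h.row h.col (Real.exp_pos _) hG (fun i l => ?_) hg
  have h1 : ∀ j, Real.exp (-(8 * K)) * (r i * r l / (∑ i, r i)) * (c j / ∑ i, r i)
      ≤ Λ i j * Real.exp (α i + β j) * (Λ l j * Real.exp (α l + β j)) / c j := by
    intro j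
    have e1 := h.scaled_ge hs hδ hK hΛ i j
    have e2 := h.scaled_ge hs hδ hK hΛ l j
    rw [le_div_iff₀ (hc j)]
    refine le_trans (le_of_eq ?_) (mul_le_mul e1 e2
      (mul_nonneg (Real.exp_pos _).le (div_nonneg (mul_pos (hs.row_pos hδ l) (hc j)).le hN.le))
      (mul_pos (hΛ i j) (Real.exp_pos _)).le)
    have e3 : Real.exp (-(8 * K)) = Real.exp (-(4 * K)) * Real.exp (-(4 * K)) := by
      rw [← Real.exp_add]
      ring_nf
    rw [e3]
    ring
  refine le_trans (le_of_eq ?_) (Finset.sum_le_sum fun j _ => h1 j)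
  rw [← Finset.mul_sum, ← Finset.sum_div, ← hs.mass_eq, div_self hN.ne', mul_one]

set_option maxHeartbeats 1000000 in
/-- Typical matrices can be scaled, and the scaling is close to the scaling of the mean. -/
theorem scaling_of_isTypical (hp : IsPotentialPair K r c Λ α β) (hs : IsSmoothMargin δ r c)
    (hδ : 0 < δ) (hK0 : 0 ≤ K) (hK : HasBoundedCost K r c Λ) (hΛ : ∀ i j, 0 < Λ i j) {G : ℝ}
    (hG : 0 ≤ G)
    {g : Fin m → Fin n → ℝ} {p : Fin m → ℝ} {q : Fin n → ℝ}
    (horow : ∀ i, ∑ j, Λ i j * Real.exp (α i + β j) * (g i j - p i - q j) = 0)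
    (hocol : ∀ j, ∑ i, Λ i j * Real.exp (α i + β j) * (g i j - p i - q j) = 0)
    (hA : ∀ i j, |g i j - p i - q j| ≤ projectionConst K G)
    {X : Matrix (Fin m) (Fin n) ℝ} {η t : ℝ} (hη0 : 0 ≤ η)
    (hη : potentialConst K δ * η ≤ 1 / 2)
    (hX : IsTypical δ η t Λ X (fun i j => entryNorm Λ / (∑ i, r i) * Real.exp (α i + β j))
      (fun i j => g i j - p i - q j)) :
    X ∈ scalableSet r c ∧
      |∑ i, ∑ j, g i j * (sinkhornRescale r c X i j - Λ i j * Real.exp (α i + β j))|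
        ≤ (t + (2 * potentialConst K δ + 8 * projectionConst K G * potentialConst K δ ^ 2)
          * η ^ 2) * ∑ i, r i := by
  have := hs.nonempty_left
  have := hs.nonempty_right
  set L := entryNorm Λ with hLdef
  set N := ∑ i, r i with hNdef
  have hL : 0 < L := entryNorm_pos hΛ
  have hN : 0 < N := hs.mass_pos
  have hr := hs.row_pos hδ
  have hc := hs.col_pos hδ
  have hm := hs.left_pos
  have hn := hs.right_pos
  set τ := alignConst K δ with hτ
  have hτ0 : 0 < τ := alignConst_pos hδ
  set B := potentialConst K δ with hB
  have hB2 : 2 ≤ B := by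
    have : 0 ≤ 64 * Real.exp 2 / τ := by positivity
    rw [hB, potentialConst]
    linarith
  have hη4 : η ≤ 1 / 4 := by nlinarith
  have hbη : 64 * Real.exp 2 * η / τ + 2 * η = B * η := by
    rw [hB, potentialConst]
    ring
  -- The potentials of the mean are applied to X first, so only potentials of size O(η) remain to be
  -- found. The weights in `IsTypical` are L / N times the same exponentials.
  set Y : Fin m → Fin n → ℝ := fun i j => X i j * Real.exp (α i + β j) with hY
  have hY0 : ∀ i j, 0 ≤ Y i j := fun i j => mul_nonneg (hX.nonneg i j) (Real.exp_pos _).le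
  have hrowdev : ∀ (f : Fin m → Fin n → ℝ) i,
      |∑ j, L / N * Real.exp (α i + β j) * f i j * (X i j - Λ i j)| ≤ η * (δ * L / m) →
      |∑ j, (Y i j - Λ i j * Real.exp (α i + β j)) * f i j| ≤ η * r i := by
    intro f i h
    have e1 : ∑ j, (Y i j - Λ i j * Real.exp (α i + β j)) * f i j
        = N / L * ∑ j, L / N * Real.exp (α i + β j) * f i j * (X i j - Λ i j) := by
      rw [Finset.mul_sum]
      refine Finset.sum_congr rfl fun j _ => ?_
      simp only [hY]
      field_simp
    rw [e1, abs_mul, abs_of_pos (div_pos hN hL)]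
    calc _ ≤ N / L * (η * (δ * L / m)) := mul_le_mul_of_nonneg_left h (div_pos hN hL).le
      _ = η * (δ * N / m) := by field_simp
      _ ≤ η * r i := mul_le_mul_of_nonneg_left (hs.row_bounds i).1 hη0
  have hcoldev : ∀ (f : Fin m → Fin n → ℝ) j,
      |∑ i, L / N * Real.exp (α i + β j) * f i j * (X i j - Λ i j)| ≤ η * (δ * L / n) →
      |∑ i, (Y i j - Λ i j * Real.exp (α i + β j)) * f i j| ≤ η * c j := by
    intro f j h
    have e1 : ∑ i, (Y i j - Λ i j * Real.exp (α i + β j)) * f i j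
        = N / L * ∑ i, L / N * Real.exp (α i + β j) * f i j * (X i j - Λ i j) := by
      rw [Finset.mul_sum]
      refine Finset.sum_congr rfl fun i _ => ?_
      simp only [hY]
      field_simp
    rw [e1, abs_mul, abs_of_pos (div_pos hN hL)]
    calc _ ≤ N / L * (η * (δ * L / n)) := mul_le_mul_of_nonneg_left h (div_pos hN hL).le
      _ = η * (δ * N / n) := by field_simp
      _ ≤ η * c j := mul_le_mul_of_nonneg_left (hs.col_bounds j).1 hη0
  have hYrow : ∀ i, |∑ j, Y i j - r i| ≤ η * r i := fun i => by
    have := hrowdev (fun _ _ => 1) i (by simpa using hX.row i)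
    simpa [Finset.sum_sub_distrib, hp.row] using this
  have hYcol : ∀ j, |∑ i, Y i j - c j| ≤ η * c j := fun j => by
    have := hcoldev (fun _ _ => 1) j (by simpa using hX.col j)
    simpa [Finset.sum_sub_distrib, hp.col] using this
  -- Bounded cost together with the lower margin bounds makes the smallest entry comparable to the
  -- average L / (mn).
  have hamin : Real.exp (-K) * δ ^ 2 * L / (m * n) ≤ minEntry Λ := by
    obtain ⟨i, j, hij⟩ := exists_eq_minEntry Λ
    rw [← hij]
    have h1 := (hK.bounds hr hc hΛ hL hN i j).2
    have h2 : δ * N / m * (δ * N / n) ≤ r i * c j :=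
      mul_le_mul (hs.row_bounds i).1 (hs.col_bounds j).1 (by positivity) (hr i).le
    have h3 : δ * N / m * (δ * N / n) * L ≤ Real.exp K * (Λ i j * N ^ 2) :=
      (mul_le_mul_of_nonneg_right h2 hL.le).trans h1
    rw [Real.exp_neg]
    have h4 : N ^ 2 * ((Real.exp K)⁻¹ * δ ^ 2 * L / (m * n))
        = (Real.exp K)⁻¹ * (δ * N / m * (δ * N / n) * L) := by ring
    refine le_of_mul_le_mul_left ?_ (pow_pos hN 2)
    rw [h4, inv_mul_le_iff₀ (Real.exp_pos K)]
    linarith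
  have hδ1 := hs.le_one hδ
  have hD : ∀ i l, τ * (r i * r l / N) ≤ ∑ j, Y i j * Y l j / c j := by
    intro i l
    rcases eq_or_ne i l with rfl | hil
    -- The diagonal pair is not part of the alignment event. It follows from Cauchy–Schwarz, since
    -- the row sum is at least r i / 2.
    · have hτ4 : τ ≤ 1 / 4 := by
        rw [hτ, alignConst]
        have h1 : Real.exp (-(8 * K)) ≤ 1 := Real.exp_le_one_iff.2 (by linarith)
        have h2 : δ ^ 7 ≤ 1 := pow_le_one₀ hδ.le hδ1
        have := mul_le_one₀ h1 (by positivity) h2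
        linarith
      have h1 : (1 / 2 * r i) ^ 2 ≤ (∑ j, Y i j) ^ 2 := by
        refine pow_le_pow_left₀ (by linarith [hr i]) ?_ 2
        have := (abs_le.1 (hYrow i)).1
        nlinarith [hr i]
      have h2 := Finset.sq_sum_div_le_sum_sq_div Finset.univ (fun j => Y i j)
        (fun j _ => hc j)
      rw [← hs.mass_eq] at h2
      calc τ * (r i * r i / N) ≤ 1 / 4 * (r i * r i / N) :=
            mul_le_mul_of_nonneg_right hτ4 (div_pos (mul_pos (hr i) (hr i)) hN).le
        _ = (1 / 2 * r i) ^ 2 / N := by ring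
        _ ≤ (∑ j, Y i j) ^ 2 / N := div_le_div_of_nonneg_right h1 hN.le
        _ ≤ ∑ j, Y i j ^ 2 / c j := h2
        _ = _ := Finset.sum_congr rfl fun j _ => by rw [sq]
    · have h1 := hX.align i l hil
      have he : ∀ i j, N / L * Real.exp (-(3 * K)) ≤ Real.exp (α i + β j) := fun i j => by
        have := mul_le_mul_of_nonneg_left (hp.exp_bounds hL hN i j).1 (div_pos hN hL).le
        refine this.trans (le_of_eq ?_)
        rw [← hNdef, ← hLdef]
        field_simp
      have h2 : ∀ j, δ * n / N ≤ 1 / c j := fun j => by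
        rw [div_le_div_iff₀ hN (hc j)]
        have := (hs.col_bounds j).2
        rw [le_div_iff₀ (by positivity)] at this
        linarith
      have h3 : ∀ j, (N / L * Real.exp (-(3 * K))) ^ 2 * (δ * n / N) * (X i j * X l j)
          ≤ Y i j * Y l j / c j := fun j => by
        have e1 := mul_le_mul (he i j) (he l j) (by positivity) (Real.exp_pos _).le
        have e2 := mul_le_mul e1 (h2 j) (by positivity)
          (mul_pos (Real.exp_pos _) (Real.exp_pos _)).le
        have e3 := mul_le_mul_of_nonneg_right e2 (mul_nonneg (hX.nonneg i j) (hX.nonneg l j))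
        simp only [hY]
        refine le_trans (le_of_eq ?_) (e3.trans (le_of_eq ?_)) <;> ring
      have h4 : (Real.exp (-K) * δ ^ 2 * L / (m * n)) ^ 2 ≤ minEntry Λ ^ 2 :=
        pow_le_pow_left₀ (by positivity) hamin 2
      have h5 : r i * r l ≤ N / (δ * m) * (N / (δ * m)) :=
        mul_le_mul (hs.row_bounds i).2 (hs.row_bounds l).2 (hr l).le (by positivity)
      have h6 : Real.exp (-(8 * K)) = Real.exp (-(3 * K)) ^ 2 * Real.exp (-K) ^ 2 := by
        rw [← Real.exp_nat_mul, ← Real.exp_nat_mul, ← Real.exp_add]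
        push_cast
        ring_nf
      -- Bookkeeping for `alignConst`: e^{-6K} comes from two potentials and e^{-2K} from the
      -- squared smallest entry; δ⁴ comes from that entry, δ from c and δ² from the two row masses.
      -- The alignment threshold gives 1/2, and the second 1/2 is slack.
      calc τ * (r i * r l / N) ≤ τ * (N / (δ * m) * (N / (δ * m)) / N) :=
            mul_le_mul_of_nonneg_left (div_le_div_of_nonneg_right h5 hN.le) hτ0.le
        _ = (N / L * Real.exp (-(3 * K))) ^ 2 * (δ * n / N)
            * (n * (Real.exp (-K) * δ ^ 2 * L / (m * n)) ^ 2 / 2) / 2 := by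
            rw [hτ, alignConst, h6]
            field_simp
            norm_num
        _ ≤ (N / L * Real.exp (-(3 * K))) ^ 2 * (δ * n / N)
            * (n * (Real.exp (-K) * δ ^ 2 * L / (m * n)) ^ 2 / 2) :=
            half_le_self (by positivity)
        _ ≤ (N / L * Real.exp (-(3 * K))) ^ 2 * (δ * n / N) * ∑ j, X i j * X l j := by
            refine mul_le_mul_of_nonneg_left (le_trans ?_ h1) (by positivity)
            exact div_le_div_of_nonneg_right (mul_le_mul_of_nonneg_left h4 hn.le) zero_le_two
        _ ≤ ∑ j, Y i j * Y l j / c j := by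
            rw [Finset.mul_sum]
            exact Finset.sum_le_sum fun j _ => h3 j
  have h64 : 64 * Real.exp 2 * η ≤ τ := by
    have h1 : 64 * Real.exp 2 * η / τ ≤ 1 / 2 := by linarith
    rw [div_le_iff₀ hτ0] at h1
    linarith
  obtain ⟨u, v, hu, hv, hub, hvb⟩ := exists_scaling_of_near hY0 hr hc rfl hs.mass_eq.symm hη0
    (by linarith) hτ0 h64 hYrow hYcol hD
  have hexp : ∀ i j, Y i j * Real.exp (u i + v j)
      = X i j * Real.exp ((α i + u i) + (β j + v j)) := fun i j => by
    simp only [hY]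
    rw [mul_assoc, ← Real.exp_add]
    congr 2
    ring
  have hu' : ∀ i, ∑ j, X i j * Real.exp ((α i + u i) + (β j + v j)) = r i := fun i => by
    simpa only [hexp] using hu i
  have hv' : ∀ j, ∑ i, X i j * Real.exp ((α i + u i) + (β j + v j)) = c j := fun j => by
    simpa only [hexp] using hv j
  refine ⟨⟨hX.nonneg, _, isScalingOf_of_exp hu' hv'⟩, ?_⟩
  have hT := fun i j => (sinkhornRescale_eq hX.nonneg hu' hv' i j).trans (hexp i j).symm
  have hA0 : 0 ≤ projectionConst K G := by
    unfold projectionConst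
    positivity
  have hmain := abs_sum_mul_scaling_sub_le (Z := fun i j => Λ i j * Real.exp (α i + β j))
    (Y := Y) (T := fun i j => sinkhornRescale r c X i j) (g := g) (p := p) (u := u) (q := q)
    (v := v) (A := projectionConst K G) (N := N) (η := η) (b := B * η) (t := t) hY0 rfl
    hs.mass_eq.symm hp.row hp.col (fun i => by simp_rw [hT]; exact hu i)
    (fun j => by simp_rw [hT]; exact hv j) hT (fun i => (hub i).trans (by linarith))
    (fun j => (hvb j).trans hbη.le) hη horow hocol hA hA0
    (fun i => hrowdev (fun i j => g i j - p i - q j) i (hX.row' i))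
    (fun j => hcoldev (fun i j => g i j - p i - q j) j (hX.col' j)) ?_ (fun i => ?_)
  · refine hmain.trans (le_of_eq ?_)
    ring
  · have e1 : ∑ i, ∑ j, (Y i j - Λ i j * Real.exp (α i + β j)) * (g i j - p i - q j)
        = N / L * ∑ i, ∑ j, L / N * Real.exp (α i + β j) * (g i j - p i - q j)
          * (X i j - Λ i j) := by
      simp_rw [Finset.mul_sum]
      refine Finset.sum_congr rfl fun i _ => Finset.sum_congr rfl fun j _ => ?_
      simp only [hY]
      field_simp
    rw [e1, abs_mul, abs_of_pos (div_pos hN hL)]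
    calc _ ≤ N / L * (t * L) := mul_le_mul_of_nonneg_left hX.total (div_pos hN hL).le
      _ = t * N := by field_simp
  · have := (abs_le.1 (hYrow i)).2
    nlinarith [hr i]

end IsPotentialPair

/-! ### Probability of typical matrices -/

namespace IsSubexponentialMatrix

variable {m n : ℕ} {Ω : Type*} [MeasurableSpace Ω] {P : Measure Ω} [IsProbabilityMeasure P]
  {X : Ω → Matrix (Fin m) (Fin n) ℝ} {Λ : Matrix (Fin m) (Fin n) ℝ} {σ R : ℝ}

/-- Chernoff bound for a weighted row sum. -/
theorem row_chernoff (hX : IsSubexponentialMatrix P X Λ σ R) (w : Fin m → Fin n → ℝ)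
    {A s t : ℝ} (hA : ∀ i j, |w i j| ≤ A) (hs : 0 ≤ s) (hsA : s * A * R ≤ 1 / 2) (i₀ : Fin m) :
    P.real {ω | t < |∑ j, w i₀ j * (X ω i₀ j - Λ i₀ j)|}
      ≤ 2 * Real.exp (-(s * t) + s ^ 2 * σ ^ 2 * (n * A ^ 2)) := by
  classical
  rcases isEmpty_or_nonempty (Fin n) with hn | ⟨⟨j₀⟩⟩
  · rcases lt_or_ge t 0 with ht | ht
    · refine measureReal_le_one.trans ?_
      have h1 : 1 ≤ Real.exp (-(s * t) + s ^ 2 * σ ^ 2 * (n * A ^ 2)) :=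
        Real.one_le_exp (add_nonneg (by nlinarith) (by positivity))
      linarith
    · have : {ω | t < |∑ j, w i₀ j * (X ω i₀ j - Λ i₀ j)|} = ∅ := by
        ext ω
        simpa using ht
      rw [this, measureReal_empty]
      positivity
  have hA0 : 0 ≤ A := (abs_nonneg _).trans (hA i₀ j₀)
  have h := hX.chernoff_abs (fun i j => if i = i₀ then w i₀ j else 0) (A := A)
    (B := n * A ^ 2) (s := s) (t := t)
    (fun i j => by
      split_ifs
      · exact hA _ _
      · simpa using hA0)
    (by
      rw [Finset.sum_eq_single i₀ (fun i _ hi => by simp [hi]) (by simp)]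
      simp only [if_true]
      refine (Finset.sum_le_card_nsmul _ _ (A ^ 2) fun j _ => ?_).trans (by simp)
      rw [← sq_abs]
      exact pow_le_pow_left₀ (abs_nonneg _) (hA _ _) 2) hs hsA
  have e : ∀ ω, ∑ i, ∑ j, (if i = i₀ then w i₀ j else 0) * (X ω i j - Λ i j)
      = ∑ j, w i₀ j * (X ω i₀ j - Λ i₀ j) := fun ω => by
    rw [Finset.sum_eq_single i₀ (fun i _ hi => by simp [hi]) (by simp)]
    simp
  simpa only [e] using h

/-- Chernoff bound for a weighted column sum. -/
theorem col_chernoff (hX : IsSubexponentialMatrix P X Λ σ R) (w : Fin m → Fin n → ℝ)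
    {A s t : ℝ} (hA : ∀ i j, |w i j| ≤ A) (hs : 0 ≤ s) (hsA : s * A * R ≤ 1 / 2) (j₀ : Fin n) :
    P.real {ω | t < |∑ i, w i j₀ * (X ω i j₀ - Λ i j₀)|}
      ≤ 2 * Real.exp (-(s * t) + s ^ 2 * σ ^ 2 * (m * A ^ 2)) := by
  classical
  rcases isEmpty_or_nonempty (Fin m) with hm | ⟨⟨i₀⟩⟩
  · rcases lt_or_ge t 0 with ht | ht
    · refine measureReal_le_one.trans ?_
      have h1 : 1 ≤ Real.exp (-(s * t) + s ^ 2 * σ ^ 2 * (m * A ^ 2)) :=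
        Real.one_le_exp (add_nonneg (by nlinarith) (by positivity))
      linarith
    · have : {ω | t < |∑ i, w i j₀ * (X ω i j₀ - Λ i j₀)|} = ∅ := by
        ext ω
        simpa using ht
      rw [this, measureReal_empty]
      positivity
  have hA0 : 0 ≤ A := (abs_nonneg _).trans (hA i₀ j₀)
  have h := hX.chernoff_abs (fun i j => if j = j₀ then w i j₀ else 0) (A := A)
    (B := m * A ^ 2) (s := s) (t := t)
    (fun i j => by
      split_ifs
      · exact hA _ _
      · simpa using hA0)
    (by
      simp only [ite_pow, zero_pow two_ne_zero, Finset.sum_ite_eq', Finset.mem_univ, if_true]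
      refine (Finset.sum_le_card_nsmul _ _ (A ^ 2) fun i _ => ?_).trans (by simp)
      rw [← sq_abs]
      exact pow_le_pow_left₀ (abs_nonneg _) (hA _ _) 2) hs hsA
  have e : ∀ ω, ∑ i, ∑ j, (if j = j₀ then w i j₀ else 0) * (X ω i j - Λ i j)
      = ∑ i, w i j₀ * (X ω i j₀ - Λ i j₀) := fun ω => by
    simp only [ite_mul, zero_mul, Finset.sum_ite_eq', Finset.mem_univ, if_true]
  simpa only [e] using h

/-- A subexponential matrix is typical up to a small probability. -/
theorem measure_not_isTypical_le (hX : IsSubexponentialMatrix P X Λ σ R) (hm : 0 < m)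
    (hn : 0 < n) {w h : Fin m → Fin n → ℝ}
    {δ A s₁ s₂ η t : ℝ} (hw : ∀ i j, |w i j| ≤ A) (hwh : ∀ i j, |w i j * h i j| ≤ A)
    (hs₁ : 0 ≤ s₁) (hs₂ : 0 ≤ s₂) (hs₁A : s₁ * A * R ≤ 1 / 2) (hs₂A : s₂ * A * R ≤ 1 / 2)
    {M : ℝ} (hmM : (m : ℝ) ≤ M) (hnM : (n : ℝ) ≤ M) (hη : 0 ≤ η) (hδ : 0 ≤ δ) :
    P.real {ω | ¬ IsTypical δ η t Λ (X ω) w h}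
      ≤ ((m : ℝ) ^ 2 - m) * Real.exp (-(1 / 8) * rowAlignmentRate Λ σ R)
        + 8 * M * Real.exp (-(s₁ * (η * (δ * entryNorm Λ / M))) + s₁ ^ 2 * σ ^ 2 * (M * A ^ 2))
        + 2 * Real.exp (-(s₂ * (t * entryNorm Λ)) + s₂ ^ 2 * σ ^ 2 * (m * n * A ^ 2)) := by
  have : Nonempty (Fin m) := ⟨⟨0, hm⟩⟩
  have : Nonempty (Fin n) := ⟨⟨0, hn⟩⟩
  have hm' : (1 : ℝ) ≤ m := by exact_mod_cast hm
  have hL := entryNorm_pos hX.mean_pos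
  set L := entryNorm Λ with hLdef
  have hM : 0 < M := by linarith
  set a := minEntry Λ with ha
  set b := maxEntry Λ with hb
  have ha0 : 0 < a := by
    obtain ⟨i, j, hij⟩ := exists_eq_minEntry Λ
    rw [ha, ← hij]
    exact hX.mean_pos i j
  have hb0 : 0 < b := ha0.trans_le ((minEntry_le Λ ⟨0, hm⟩ ⟨0, hn⟩).trans (le_maxEntry Λ _ _))
  set E₁ := Real.exp (-(s₁ * (η * (δ * L / M))) + s₁ ^ 2 * σ ^ 2 * (M * A ^ 2)) with hE₁
  set E₂ := Real.exp (-(s₂ * (t * L)) + s₂ ^ 2 * σ ^ 2 * (m * n * A ^ 2)) with hE₂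
  -- Replacing both dimensions by M lowers the threshold and raises the variance, so one exponential
  -- serves rows and columns.
  have hmono : ∀ k l : ℝ, 0 < k → k ≤ M → l ≤ M →
      2 * Real.exp (-(s₁ * (η * (δ * L / k))) + s₁ ^ 2 * σ ^ 2 * (l * A ^ 2)) ≤ 2 * E₁ := by
    intro k l hk hkM hlM
    refine mul_le_mul_of_nonneg_left (Real.exp_le_exp.2 ?_) zero_le_two
    have h1 : s₁ * (η * (δ * L / M)) ≤ s₁ * (η * (δ * L / k)) :=
      mul_le_mul_of_nonneg_left (mul_le_mul_of_nonneg_left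
        (div_le_div_of_nonneg_left (by positivity) hk hkM) hη) hs₁
    have h2 : s₁ ^ 2 * σ ^ 2 * (l * A ^ 2) ≤ s₁ ^ 2 * σ ^ 2 * (M * A ^ 2) :=
      mul_le_mul_of_nonneg_left (mul_le_mul_of_nonneg_right hlM (sq_nonneg A)) (by positivity)
    linarith
  have hrow : ∀ f : Fin m → Fin n → ℝ, (∀ i j, |f i j| ≤ A) →
      P.real (⋃ i, {ω | η * (δ * L / m) < |∑ j, f i j * (X ω i j - Λ i j)|}) ≤ M * (2 * E₁) := by
    intro f hf
    calc _ ≤ ∑ i, P.real {ω | η * (δ * L / m) < |∑ j, f i j * (X ω i j - Λ i j)|} :=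
          measureReal_iUnion_fintype_le _
      _ ≤ ∑ _i : Fin m, 2 * E₁ := Finset.sum_le_sum fun i _ =>
          (hX.row_chernoff f hf hs₁ hs₁A i).trans (hmono m n (by linarith) hmM hnM)
      _ = m * (2 * E₁) := by simp
      _ ≤ _ := mul_le_mul_of_nonneg_right hmM (by positivity)
  have hcol : ∀ f : Fin m → Fin n → ℝ, (∀ i j, |f i j| ≤ A) →
      P.real (⋃ j, {ω | η * (δ * L / n) < |∑ i, f i j * (X ω i j - Λ i j)|}) ≤ M * (2 * E₁) := by
    intro f hf
    calc _ ≤ ∑ j, P.real {ω | η * (δ * L / n) < |∑ i, f i j * (X ω i j - Λ i j)|} :=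
          measureReal_iUnion_fintype_le _
      _ ≤ ∑ _j : Fin n, 2 * E₁ := Finset.sum_le_sum fun j _ =>
          (hX.col_chernoff f hf hs₁ hs₁A j).trans (hmono n m (by exact_mod_cast hn) hnM hmM)
      _ = n * (2 * E₁) := by simp
      _ ≤ _ := mul_le_mul_of_nonneg_right hnM (by positivity)
  have htot : P.real {ω | t * L < |∑ i, ∑ j, w i j * h i j * (X ω i j - Λ i j)|} ≤ 2 * E₂ := by
    refine hX.chernoff_abs (fun i j => w i j * h i j) hwh ?_ hs₂ hs₂A
    calc ∑ i, ∑ j, (w i j * h i j) ^ 2 ≤ ∑ _i : Fin m, ∑ _j : Fin n, A ^ 2 :=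
          Finset.sum_le_sum fun i _ => Finset.sum_le_sum fun j _ => by
            rw [← sq_abs]
            exact pow_le_pow_left₀ (abs_nonneg _) (hwh i j) 2
      _ = _ := by simp [mul_assoc]
  have halign : P.real {ω | ∃ i l, i ≠ l ∧ ∑ j, X ω i j * X ω l j < n * a ^ 2 / 2}
      ≤ ((m : ℝ) ^ 2 - m) * Real.exp (-(1 / 8) * rowAlignmentRate Λ σ R) := by
    refine (hX.row_alignment ha0 (minEntry_le Λ) (le_maxEntry Λ)).trans ?_
    refine mul_le_mul_of_nonneg_left (Real.exp_le_exp.2 ?_) (by nlinarith)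
    have h1 : rowAlignmentRate Λ σ R ≤ n * (a ^ 4 / (σ + R + b) ^ 4) := min_le_left _ _
    have hσ := hX.sigma_pos
    have hR := hX.R_pos
    -- This turns the second-moment proxy into the denominator of the first branch of
    -- `rowAlignmentRate`. The factor 1/8 comes from the row inner products.
    have h2 : (σ ^ 2 + b ^ 2) ^ 2 ≤ (σ + R + b) ^ 4 := by
      have : σ ^ 2 + b ^ 2 ≤ (σ + R + b) ^ 2 := by
        have h3 := mul_pos hσ hb0
        have h4 := mul_pos hσ hR
        have h5 := mul_pos hR hb0
        nlinarith [sq_nonneg R]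
      calc (σ ^ 2 + b ^ 2) ^ 2 ≤ ((σ + R + b) ^ 2) ^ 2 :=
            pow_le_pow_left₀ (by positivity) this 2
        _ = _ := by ring
    have h3 : a ^ 4 / (σ + R + b) ^ 4 ≤ a ^ 4 / (σ ^ 2 + b ^ 2) ^ 2 :=
      div_le_div_of_nonneg_left (by positivity) (by positivity) h2
    have h4 : n * (a ^ 4 / (8 * (σ ^ 2 + b ^ 2) ^ 2))
        = 1 / 8 * (n * (a ^ 4 / (σ ^ 2 + b ^ 2) ^ 2)) := by
      field_simp
    have h5 := mul_le_mul_of_nonneg_left h3 (Nat.cast_nonneg (α := ℝ) n)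
    linarith
  set S₀ := {ω | ¬ ∀ i j, 0 ≤ X ω i j} with hS₀
  have hS₀0 : P.real S₀ = 0 := by
    rw [measureReal_def, show P S₀ = 0 from hX.nonneg]
    rfl
  set S₁ := {ω | ∃ i l, i ≠ l ∧ ∑ j, X ω i j * X ω l j < n * a ^ 2 / 2} with hS₁
  set S₂ := ⋃ i, {ω | η * (δ * L / m) < |∑ j, w i j * (X ω i j - Λ i j)|} with hS₂
  set S₃ := ⋃ j, {ω | η * (δ * L / n) < |∑ i, w i j * (X ω i j - Λ i j)|} with hS₃
  set S₄ := ⋃ i, {ω | η * (δ * L / m) < |∑ j, w i j * h i j * (X ω i j - Λ i j)|} with hS₄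
  set S₅ := ⋃ j, {ω | η * (δ * L / n) < |∑ i, w i j * h i j * (X ω i j - Λ i j)|} with hS₅
  set S₆ := {ω | t * L < |∑ i, ∑ j, w i j * h i j * (X ω i j - Λ i j)|} with hS₆
  have hsub : {ω | ¬ IsTypical δ η t Λ (X ω) w h}
      ⊆ S₀ ∪ (S₁ ∪ (S₂ ∪ (S₃ ∪ (S₄ ∪ (S₅ ∪ S₆))))) := by
    intro ω hω
    by_contra hcon
    simp only [Set.mem_union, not_or] at hcon
    obtain ⟨h0, h1, h2, h3, h4, h5, h6⟩ := hcon
    simp only [hS₂, hS₃, hS₄, hS₅, Set.mem_iUnion, not_exists] at h2 h3 h4 h5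
    refine hω ⟨not_not.1 h0, fun i l hil => ?_, fun i => not_lt.1 (h2 i),
      fun j => not_lt.1 (h3 j), fun i => not_lt.1 (h4 i), fun j => not_lt.1 (h5 j), not_lt.1 h6⟩
    by_contra hlt
    exact h1 ⟨i, l, hil, not_le.1 hlt⟩
  have e2 := hrow w hw
  have e3 := hcol w hw
  have e4 := hrow (fun i j => w i j * h i j) hwh
  have e5 := hcol (fun i j => w i j * h i j) hwh
  have u0 := measureReal_mono (μ := P) hsub
  have u1 := measureReal_union_le (μ := P) S₀ (S₁ ∪ (S₂ ∪ (S₃ ∪ (S₄ ∪ (S₅ ∪ S₆)))))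
  have u2 := measureReal_union_le (μ := P) S₁ (S₂ ∪ (S₃ ∪ (S₄ ∪ (S₅ ∪ S₆))))
  have u3 := measureReal_union_le (μ := P) S₂ (S₃ ∪ (S₄ ∪ (S₅ ∪ S₆)))
  have u4 := measureReal_union_le (μ := P) S₃ (S₄ ∪ (S₅ ∪ S₆))
  have u5 := measureReal_union_le (μ := P) S₄ (S₅ ∪ S₆)
  have u6 := measureReal_union_le (μ := P) S₅ S₆
  linarith

end IsSubexponentialMatrix

/-- The Chernoff exponent for the linear functional. -/
theorem exists_linear_chernoff_param {M x s₀ V C₁ : ℝ} (hM : 1 ≤ M) (hx : Real.log 2 ≤ x)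
    (hs₀ : 0 < s₀) (hV : 0 ≤ V) (hC : 2 + s₀ ^ 2 * V ≤ s₀ * C₁) :
    ∃ s, 0 ≤ s ∧ s ≤ s₀ ∧
      2 * Real.exp (-(s * (C₁ * (M ^ (3 / 2 : ℝ) * √x))) + s ^ 2 * V * M ^ 2)
        ≤ Real.exp (-x) + Real.exp (-(√M / 8)) := by
  have hM0 : 0 < M := by linarith
  set p := M ^ (3 / 2 : ℝ) with hp
  have hp0 : 0 < p := Real.rpow_pos_of_pos hM0 _
  have hp2 : p ^ 2 = M ^ 3 := by
    rw [hp, ← Real.rpow_natCast, ← Real.rpow_mul hM0.le]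
    norm_num
  have hlog2 : 0 < Real.log 2 := Real.log_pos one_lt_two
  have hx0 : 0 < x := hlog2.trans_le hx
  have hsx : √x ^ 2 = x := Real.sq_sqrt hx0.le
  have hsx0 : 0 < √x := Real.sqrt_pos.2 hx0
  have hM2 : M ^ 2 ≤ p ^ 2 := by
    rw [hp2]
    exact pow_le_pow_right₀ hM (by norm_num)
  have htwo : ∀ y, Real.log 2 ≤ y → ∀ z, z ≤ -(2 * y) → 2 * Real.exp z ≤ Real.exp (-y) := by
    intro y hy z hz
    calc 2 * Real.exp z = Real.exp (Real.log 2 + z) := by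
          rw [Real.exp_add, Real.exp_log two_pos]
      _ ≤ Real.exp (-y) := Real.exp_le_exp.2 (by linarith)
  rcases le_total √x p with h | h
  -- Moderate deviations: the exponent is at most -(s₀ C₁ - s₀² V) x ≤ -2x, because M² ≤ p² = M³.
  -- One of the two copies of x pays for the prefactor 2.
  · refine ⟨s₀ * √x / p, by positivity, ?_, ?_⟩
    · rw [mul_div_assoc]
      exact mul_le_of_le_one_right hs₀.le ((div_le_one hp0).2 h)
    · have h1 : s₀ * √x / p * (C₁ * (p * √x)) = s₀ * C₁ * x := by
        have e : s₀ * √x / p * (C₁ * (p * √x)) = s₀ * C₁ * √x ^ 2 := by field_simp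
        rw [e, hsx]
      have h2 : (s₀ * √x / p) ^ 2 * V * M ^ 2 ≤ s₀ ^ 2 * V * x := by
        have e : (s₀ * √x / p) ^ 2 * V * M ^ 2 = s₀ ^ 2 * V * x * (M ^ 2 / p ^ 2) := by
          rw [div_pow, mul_pow, hsx]
          ring
        rw [e]
        exact mul_le_of_le_one_right (by positivity) ((div_le_one (by positivity)).2 hM2)
      have h3 := mul_le_mul_of_nonneg_right hC hx0.le
      have := htwo x hx (-(s₀ * √x / p * (C₁ * (p * √x))) + (s₀ * √x / p) ^ 2 * V * M ^ 2)
        (by rw [h1]; linarith)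
      linarith [Real.exp_pos (-(√M / 8))]
  -- Very large x: s is capped by the moment condition and e^{-x} is out of reach, but the exponent
  -- is still at most -2M³. This suffices for the second error term.
  · refine ⟨s₀, hs₀.le, le_rfl, ?_⟩
    have hC0 : 0 < s₀ * C₁ := lt_of_lt_of_le (by positivity) hC
    have h1 : s₀ * C₁ * M ^ 3 ≤ s₀ * (C₁ * (p * √x)) := by
      have : p ^ 2 ≤ p * √x := by
        rw [sq]
        exact mul_le_mul_of_nonneg_left h hp0.le
      rw [← hp2, ← mul_assoc]
      exact mul_le_mul_of_nonneg_left this hC0.le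
    have h2 : s₀ ^ 2 * V * M ^ 2 ≤ s₀ ^ 2 * V * M ^ 3 := by
      rw [← hp2]
      exact mul_le_mul_of_nonneg_left hM2 (by positivity)
    have hM3 : 1 ≤ M ^ 3 := one_le_pow₀ hM
    have h3 := mul_le_mul_of_nonneg_right hC (zero_le_one.trans hM3)
    have hl : Real.log 2 ≤ M ^ 3 := by
      have := Real.log_two_lt_d9
      linarith
    have := htwo (M ^ 3) hl (-(s₀ * (C₁ * (p * √x))) + s₀ ^ 2 * V * M ^ 2) (by linarith)
    have h4 : Real.exp (-(M ^ 3)) ≤ Real.exp (-(√M / 8)) := by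
      refine Real.exp_le_exp.2 (neg_le_neg ?_)
      have e1 : √M ≤ M := Real.sqrt_le_iff.2 ⟨hM0.le, by nlinarith⟩
      have e2 : M ≤ M ^ 3 := le_self_pow₀ hM (by norm_num)
      have e3 := Real.sqrt_nonneg M
      linarith
    linarith [Real.exp_pos (-x)]

/-! ### Stability of scaled densities -/

/-- `4 (√u - √v)² ≤ (u - v) (log u - log v)`. -/
theorem four_mul_sqrt_sub_sq_le {u v : ℝ} (hu : 0 < u) (hv : 0 < v) :
    4 * (√u - √v) ^ 2 ≤ (u - v) * (Real.log u - Real.log v) := by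
  have key : ∀ u v : ℝ, 0 < v → v ≤ u →
      4 * (√u - √v) ^ 2 ≤ (u - v) * (Real.log u - Real.log v) := by
    intro u v hv huv
    have hu : 0 < u := hv.trans_le huv
    obtain ⟨p, hp⟩ : ∃ p, p = √u := ⟨_, rfl⟩
    obtain ⟨q, hq⟩ : ∃ q, q = √v := ⟨_, rfl⟩
    have hp0 : 0 < p := hp ▸ Real.sqrt_pos.2 hu
    have hq0 : 0 < q := hq ▸ Real.sqrt_pos.2 hv
    have hqp : q ≤ p := hp ▸ hq ▸ Real.sqrt_le_sqrt huv
    have hup : u = p ^ 2 := hp ▸ (Real.sq_sqrt hu.le).symm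
    have huq : v = q ^ 2 := hq ▸ (Real.sq_sqrt hv.le).symm
    rw [← hp, ← hq, hup, huq, Real.log_pow, Real.log_pow]
    push_cast
    -- This is log(1 + z) ≥ 2z/(z + 2) at z = (p - q)/q. Multiplication by 2(p - q) gives the claim,
    -- since u - v = (p - q)(p + q) and log u - log v = 2(log p - log q).
    have h0 : 2 * (p - q) ≤ (p + q) * (Real.log p - Real.log q) := by
      have h2 := Real.le_log_one_add_of_nonneg (div_nonneg (sub_nonneg.2 hqp) hq0.le)
      have h3 : 1 + (p - q) / q = p / q := by field_simp; ring
      have h4 : 2 * ((p - q) / q) / ((p - q) / q + 2) = 2 * (p - q) / (p + q) := by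
        have : p - q + 2 * q = p + q := by ring
        field_simp
        rw [this, mul_div_cancel_right₀ _ (by linarith)]
      rw [h3, h4, Real.log_div hp0.ne' hq0.ne', div_le_iff₀ (by linarith)] at h2
      linarith
    nlinarith [mul_le_mul_of_nonneg_left h0 (sub_nonneg.2 hqp)]
  rcases le_total v u with h | h
  · exact key u v hv h
  · have := key v u hu h
    nlinarith

/-- The logarithm is twice the logarithm of the square root, and log t ≤ t - 1 applies at t = √y/√z.
In this form a lower bound on the kernels suffices to pass to the Hellinger distance. -/
theorem abs_log_sub_log_le {lo y z : ℝ} (hlo : 0 < lo) (hy : lo ≤ y) (hz : lo ≤ z) :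
    |Real.log y - Real.log z| ≤ 2 * |√y - √z| / √lo := by
  have key : ∀ y z : ℝ, lo ≤ z → z ≤ y →
      |Real.log y - Real.log z| ≤ 2 * |√y - √z| / √lo := by
    intro y z hz hzy
    have hz0 := hlo.trans_le hz
    have hy0 := hz0.trans_le hzy
    have hq := Real.sqrt_pos.2 hz0
    have hp := Real.sqrt_pos.2 hy0
    have hl := Real.sqrt_pos.2 hlo
    have hlq := Real.sqrt_le_sqrt hz
    have hqp := Real.sqrt_le_sqrt hzy
    have h1 := Real.log_le_sub_one_of_pos (div_pos hp hq)
    rw [Real.log_div hp.ne' hq.ne', Real.log_sqrt hy0.le, Real.log_sqrt hz0.le] at h1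
    rw [abs_of_nonneg (sub_nonneg.2 (Real.log_le_log hz0 hzy)), abs_of_nonneg (sub_nonneg.2 hqp)]
    have h2 : √y / √z - 1 = (√y - √z) / √z := by field_simp
    have h3 : (√y - √z) / √z ≤ (√y - √z) / √lo :=
      div_le_div_of_nonneg_left (sub_nonneg.2 hqp) hl hlq
    rw [mul_div_assoc]
    linarith
  rcases le_total z y with h | h
  · exact key y z hz h
  · rw [abs_sub_comm, abs_sub_comm (√y)]
    exact key z y hy h

/-- The pointwise inequality behind the stability estimate. -/
theorem sqrt_sub_sq_le_of_scaled {x x' y y' s s' w lo : ℝ} (hlo : 0 < lo) (hy : lo ≤ y)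
    (hy' : lo ≤ y') (hx : x = y * Real.exp s) (hx' : x' = y' * Real.exp s') (hxw : x ≤ w)
    (hxw' : x' ≤ w) :
    2 * (√x - √x') ^ 2 ≤ 2 * (w / lo) * (√y - √y') ^ 2 + (x - x') * (s - s') := by
  have hy0 : 0 < y := hlo.trans_le hy
  have hy0' : 0 < y' := hlo.trans_le hy'
  have hx0 : 0 < x := hx ▸ mul_pos hy0 (Real.exp_pos _)
  have hx0' : 0 < x' := hx' ▸ mul_pos hy0' (Real.exp_pos _)
  have hw : 0 < w := hx0.trans_le hxw
  have h1 := four_mul_sqrt_sub_sq_le hx0 hx0'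
  have h2 : Real.log x - Real.log x' = (Real.log y - Real.log y') + (s - s') := by
    rw [hx, hx', Real.log_mul hy0.ne' (Real.exp_pos _).ne', Real.log_exp,
      Real.log_mul hy0'.ne' (Real.exp_pos _).ne', Real.log_exp]
    ring
  have h3 := abs_log_sub_log_le hlo hy hy'
  have h4 : |x - x'| ≤ 2 * √w * |√x - √x'| := by
    have e : x - x' = (√x + √x') * (√x - √x') := by
      linear_combination -(Real.sq_sqrt hx0.le) + Real.sq_sqrt hx0'.le
    rw [e, abs_mul, abs_of_nonneg (by positivity)]
    refine mul_le_mul_of_nonneg_right ?_ (abs_nonneg _)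
    linarith [Real.sqrt_le_sqrt hxw, Real.sqrt_le_sqrt hxw']
  -- Young's inequality: half of the left side 4(√x - √x')² is spent here, and the other half
  -- survives.
  have h5 : (x - x') * (Real.log y - Real.log y')
      ≤ 2 * (√x - √x') ^ 2 + 2 * (w / lo) * (√y - √y') ^ 2 := by
    have hl := Real.sqrt_pos.2 hlo
    have e : w / lo = (√w / √lo) ^ 2 := by
      rw [div_pow, Real.sq_sqrt hw.le, Real.sq_sqrt hlo.le]
    calc (x - x') * (Real.log y - Real.log y') ≤ |x - x'| * |Real.log y - Real.log y'| := by
          rw [← abs_mul]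
          exact le_abs_self _
      _ ≤ (2 * √w * |√x - √x'|) * (2 * |√y - √y'| / √lo) :=
          mul_le_mul h4 h3 (abs_nonneg _) (by positivity)
      _ = 4 * |√x - √x'| * (√w / √lo * |√y - √y'|) := by
          ring
      _ ≤ 2 * |√x - √x'| ^ 2 + 2 * (√w / √lo * |√y - √y'|) ^ 2 := by
          nlinarith [sq_nonneg (|√x - √x'| - √w / √lo * |√y - √y'|)]
      _ = _ := by
          rw [mul_pow, sq_abs, sq_abs, e]
          ring
  rw [h2, mul_add] at h1
  linarith

theorem sq_integral_le_integral_sq {Ω : Type*} [MeasurableSpace Ω] {μ : Measure Ω}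
    [IsProbabilityMeasure μ] {f : Ω → ℝ} (hf : Integrable f μ)
    (hf2 : Integrable (fun x => f x ^ 2) μ) : (∫ x, f x ∂μ) ^ 2 ≤ ∫ x, f x ^ 2 ∂μ := by
  set c := ∫ x, f x ∂μ with hc
  have h1 : 0 ≤ ∫ x, (f x - c) ^ 2 ∂μ := integral_nonneg fun x => sq_nonneg _
  have h2 : ∀ x, (f x - c) ^ 2 = f x ^ 2 - 2 * c * f x + c ^ 2 := fun x => by ring
  have h3 : Integrable (fun x => f x ^ 2 - 2 * c * f x) μ := hf2.sub (hf.const_mul _)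
  simp_rw [h2] at h1
  rw [integral_add h3 (integrable_const _), integral_sub hf2 (hf.const_mul _),
    integral_const_mul, ← hc] at h1
  simp at h1
  nlinarith

section Stability

variable {α β : Type*} [MeasureSpace α] [MeasureSpace β]

/-- `W` is the scaling `φ e^{a ⊕ b}` of the kernel `φ ∈ [lo, hi]` by potentials bounded by `B`, and
has the marginal densities `ρ₁`, `ρ₂`. -/
structure IsScaledDensity (lo hi B : ℝ) (φ W : α × β → ℝ) (ρ₁ : α → ℝ) (ρ₂ : β → ℝ) (a : α → ℝ)
    (b : β → ℝ) : Prop where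
  kernel_meas : AEStronglyMeasurable φ
  kernel_bounds : ∀ᵐ p, lo ≤ φ p ∧ φ p ≤ hi
  left_meas : Measurable a
  right_meas : Measurable b
  left_le : ∀ x, |a x| ≤ B
  right_le : ∀ y, |b y| ≤ B
  eq : ∀ᵐ p, W p = φ p * Real.exp (a p.1 + b p.2)
  left_int : Integrable ρ₁
  right_int : Integrable ρ₂
  fst : ∀ f : α → ℝ, Measurable f → (∃ C, ∀ x, |f x| ≤ C) →
    ∫ p, W p * f p.1 = ∫ x, ρ₁ x * f x
  snd : ∀ f : β → ℝ, Measurable f → (∃ C, ∀ y, |f y| ≤ C) →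
    ∫ p, W p * f p.2 = ∫ y, ρ₂ y * f y

namespace IsScaledDensity

variable {lo hi B : ℝ} {φ W φ' W' : α × β → ℝ} {ρ₁ ρ₁' : α → ℝ} {ρ₂ ρ₂' : β → ℝ} {a a' : α → ℝ}
  {b b' : β → ℝ}

theorem meas (h : IsScaledDensity lo hi B φ W ρ₁ ρ₂ a b) : AEStronglyMeasurable W := by
  have h1 := h.left_meas
  have h2 := h.right_meas
  refine (h.kernel_meas.mul (g := fun p : α × β => Real.exp (a p.1 + b p.2)) ?_).congr ?_
  · exact Measurable.aestronglyMeasurable (by fun_prop)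
  · filter_upwards [h.eq] with p hp
    rw [hp]
    rfl

theorem bounds (h : IsScaledDensity lo hi B φ W ρ₁ ρ₂ a b) (hlo : 0 < lo) :
    ∀ᵐ p, lo * Real.exp (-(2 * B)) ≤ W p ∧ W p ≤ hi * Real.exp (2 * B) := by
  filter_upwards [h.eq, h.kernel_bounds] with p hp hφ
  have h1 := abs_le.1 (h.left_le p.1)
  have h2 := abs_le.1 (h.right_le p.2)
  rw [hp]
  constructor
  · exact mul_le_mul hφ.1 (Real.exp_le_exp.2 (by linarith [h1.1, h2.1])) (Real.exp_pos _).le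
      (hlo.le.trans hφ.1)
  · exact mul_le_mul hφ.2 (Real.exp_le_exp.2 (by linarith [h1.2, h2.2])) (Real.exp_pos _).le
      (hlo.le.trans (hφ.1.trans hφ.2))

theorem mono (h : IsScaledDensity lo hi B φ W ρ₁ ρ₂ a b) {B₁ : ℝ} (hB : B ≤ B₁) :
    IsScaledDensity lo hi B₁ φ W ρ₁ ρ₂ a b :=
  { h with
    left_le := fun x => (h.left_le x).trans hB
    right_le := fun y => (h.right_le y).trans hB }

variable [IsProbabilityMeasure (volume : Measure α)] [IsProbabilityMeasure (volume : Measure β)]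

theorem integrable (h : IsScaledDensity lo hi B φ W ρ₁ ρ₂ a b) (hlo : 0 < lo) :
    Integrable W := by
  refine Integrable.of_bound h.meas (hi * Real.exp (2 * B)) ?_
  filter_upwards [h.bounds hlo] with p hp
  have := mul_pos hlo (Real.exp_pos (-(2 * B)))
  rw [Real.norm_eq_abs, abs_of_pos (by linarith [hp.1])]
  exact hp.2

/-- Hellinger stability of scaled densities in the kernel and the marginals. -/
theorem integral_sqrt_sub_sq_le (h : IsScaledDensity lo hi B φ W ρ₁ ρ₂ a b)
    (h' : IsScaledDensity lo hi B φ' W' ρ₁' ρ₂' a' b') (hlo : 0 < lo) :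
    ∫ p, (√(W p) - √(W' p)) ^ 2
      ≤ hi * Real.exp (2 * B) / lo * (∫ p, (√(φ p) - √(φ' p)) ^ 2)
        + B * (l1Dist ρ₁ ρ₁' + l1Dist ρ₂ ρ₂') := by
  set w := hi * Real.exp (2 * B) with hw
  have ha := h.left_meas
  have hb := h.right_meas
  have ha' := h'.left_meas
  have hb' := h'.right_meas
  have hd1 : ∀ x, |a x - a' x| ≤ 2 * B := fun x => (abs_sub _ _).trans
    (by linarith [h.left_le x, h'.left_le x])
  have hd2 : ∀ y, |b y - b' y| ≤ 2 * B := fun y => (abs_sub _ _).trans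
    (by linarith [h.right_le y, h'.right_le y])
  have hWi := h.integrable hlo
  have hWi' := h'.integrable hlo
  have hφi : Integrable (fun p => (√(φ p) - √(φ' p)) ^ 2) := by
    refine Integrable.of_bound (C := hi) ?_ ?_
    · exact (((Real.continuous_sqrt.comp_aestronglyMeasurable h.kernel_meas).sub
        (Real.continuous_sqrt.comp_aestronglyMeasurable h'.kernel_meas)).pow 2)
    · filter_upwards [h.kernel_bounds, h'.kernel_bounds] with p h1 h2
      rw [Real.norm_eq_abs, abs_of_nonneg (sq_nonneg _)]
      have e1 := Real.sqrt_nonneg (φ p)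
      have e2 := Real.sqrt_nonneg (φ' p)
      have e3 := Real.sq_sqrt (hlo.le.trans h1.1)
      have e4 := Real.sq_sqrt (hlo.le.trans h2.1)
      have e5 := mul_nonneg e1 e2
      rcases le_total (√(φ p)) (√(φ' p)) with e | e <;> nlinarith
  have hsi : Integrable (fun p : α × β => (W p - W' p)
      * ((a p.1 + b p.2) - (a' p.1 + b' p.2))) := by
    refine (hWi.sub hWi').mul_bdd (c := 4 * B) ?_ (Eventually.of_forall fun p => ?_)
    · exact Measurable.aestronglyMeasurable (by fun_prop)
    · rw [Real.norm_eq_abs]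
      have : (a p.1 + b p.2) - (a' p.1 + b' p.2) = (a p.1 - a' p.1) + (b p.2 - b' p.2) := by ring
      rw [this]
      exact (abs_add_le _ _).trans (by linarith [hd1 p.1, hd2 p.2])
  have hmono : ∫ p, 2 * (√(W p) - √(W' p)) ^ 2
      ≤ ∫ p, (2 * (w / lo) * (√(φ p) - √(φ' p)) ^ 2
        + (W p - W' p) * ((a p.1 + b p.2) - (a' p.1 + b' p.2))) := by
    refine integral_mono_of_nonneg (Eventually.of_forall fun p => by positivity)
      ((hφi.const_mul _).add hsi) ?_
    filter_upwards [h.eq, h'.eq, h.kernel_bounds, h'.kernel_bounds, h.bounds hlo, h'.bounds hlo]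
      with p e1 e2 e3 e4 e5 e6
    exact sqrt_sub_sq_le_of_scaled hlo e3.1 e4.1 e1 e2 e5.2 e6.2
  rw [integral_const_mul, integral_add (hφi.const_mul _) hsi, integral_const_mul] at hmono
  -- Differences of potentials are separable, so W and W' enter only through their marginals.
  -- Closeness of the potentials is never needed, only their boundedness.
  have hsplit : ∫ p : α × β, (W p - W' p) * ((a p.1 + b p.2) - (a' p.1 + b' p.2))
      = (∫ x, (ρ₁ x - ρ₁' x) * (a x - a' x)) + ∫ y, (ρ₂ y - ρ₂' y) * (b y - b' y) := by
    have i1 : ∀ V : α × β → ℝ, Integrable V → Integrable fun p : α × β => V p * (a p.1 - a' p.1) :=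
      fun V hV => hV.mul_bdd (c := 2 * B) (Measurable.aestronglyMeasurable (by fun_prop))
        (Eventually.of_forall fun p => hd1 p.1)
    have i2 : ∀ V : α × β → ℝ, Integrable V → Integrable fun p : α × β => V p * (b p.2 - b' p.2) :=
      fun V hV => hV.mul_bdd (c := 2 * B) (Measurable.aestronglyMeasurable (by fun_prop))
        (Eventually.of_forall fun p => hd2 p.2)
    have i3 : ∀ V : α → ℝ, Integrable V → Integrable fun x => V x * (a x - a' x) :=
      fun V hV => hV.mul_bdd (c := 2 * B) (Measurable.aestronglyMeasurable (by fun_prop))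
        (Eventually.of_forall fun x => hd1 x)
    have i4 : ∀ V : β → ℝ, Integrable V → Integrable fun y => V y * (b y - b' y) :=
      fun V hV => hV.mul_bdd (c := 2 * B) (Measurable.aestronglyMeasurable (by fun_prop))
        (Eventually.of_forall fun y => hd2 y)
    have e1 : ∀ p : α × β, (W p - W' p) * ((a p.1 + b p.2) - (a' p.1 + b' p.2))
        = (W p * (a p.1 - a' p.1) - W' p * (a p.1 - a' p.1))
          + (W p * (b p.2 - b' p.2) - W' p * (b p.2 - b' p.2)) := fun p => by ring
    have j1 : Integrable fun p : α × β => W p * (a p.1 - a' p.1) - W' p * (a p.1 - a' p.1) :=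
      (i1 W hWi).sub (i1 W' hWi')
    have j2 : Integrable fun p : α × β => W p * (b p.2 - b' p.2) - W' p * (b p.2 - b' p.2) :=
      (i2 W hWi).sub (i2 W' hWi')
    simp_rw [e1]
    rw [integral_add j1 j2, integral_sub (i1 W hWi) (i1 W' hWi'),
      integral_sub (i2 W hWi) (i2 W' hWi'),
      h.fst (fun x => a x - a' x) (by fun_prop) ⟨_, hd1⟩,
      h'.fst (fun x => a x - a' x) (by fun_prop) ⟨_, hd1⟩,
      h.snd (fun y => b y - b' y) (by fun_prop) ⟨_, hd2⟩,
      h'.snd (fun y => b y - b' y) (by fun_prop) ⟨_, hd2⟩,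
      ← integral_sub (i3 ρ₁ h.left_int) (i3 ρ₁' h'.left_int),
      ← integral_sub (i4 ρ₂ h.right_int) (i4 ρ₂' h'.right_int)]
    simp_rw [sub_mul]
  have hb1 : ∫ x, (ρ₁ x - ρ₁' x) * (a x - a' x) ≤ 2 * B * l1Dist ρ₁ ρ₁' := by
    rw [l1Dist, ← integral_const_mul]
    refine integral_mono ((h.left_int.sub h'.left_int).mul_bdd (c := 2 * B)
      (Measurable.aestronglyMeasurable (by fun_prop)) (Eventually.of_forall fun x => hd1 x))
      ((h.left_int.sub h'.left_int).abs.const_mul _) fun x => ?_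
    refine (le_abs_self _).trans ?_
    rw [abs_mul, mul_comm]
    exact mul_le_mul_of_nonneg_right (hd1 x) (abs_nonneg _)
  have hb2 : ∫ y, (ρ₂ y - ρ₂' y) * (b y - b' y) ≤ 2 * B * l1Dist ρ₂ ρ₂' := by
    rw [l1Dist, ← integral_const_mul]
    refine integral_mono ((h.right_int.sub h'.right_int).mul_bdd (c := 2 * B)
      (Measurable.aestronglyMeasurable (by fun_prop)) (Eventually.of_forall fun x => hd2 x))
      ((h.right_int.sub h'.right_int).abs.const_mul _) fun x => ?_
    refine (le_abs_self _).trans ?_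
    rw [abs_mul, mul_comm]
    exact mul_le_mul_of_nonneg_right (hd2 x) (abs_nonneg _)
  rw [hsplit] at hmono
  linarith

/-- The constant of the `L¹` stability estimate. -/
noncomputable def _root_.stabilityConst (lo hi B : ℝ) : ℝ :=
  2 * √(hi * Real.exp (2 * B)) * (√(hi * Real.exp (2 * B) / lo) + √B)

/-- `L¹` stability of scaled densities in the kernel and the marginals. -/
theorem integral_abs_sub_le (h : IsScaledDensity lo hi B φ W ρ₁ ρ₂ a b)
    (h' : IsScaledDensity lo hi B φ' W' ρ₁' ρ₂' a' b') (hlo : 0 < lo) (hhi : 0 ≤ hi) (hB : 0 ≤ B) :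
    ∫ p, |W p - W' p| ≤ stabilityConst lo hi B
      * (√(l1Dist ρ₁ ρ₁' + l1Dist ρ₂ ρ₂') + hellingerDist φ φ') := by
  have h1 := h.integral_sqrt_sub_sq_le h' hlo
  set w := hi * Real.exp (2 * B) with hw
  have hw0 : 0 ≤ w := by positivity
  have hsm : AEStronglyMeasurable (fun p => √(W p) - √(W' p)) :=
    (Real.continuous_sqrt.comp_aestronglyMeasurable h.meas).sub
      (Real.continuous_sqrt.comp_aestronglyMeasurable h'.meas)
  have hsb : ∀ᵐ p, |√(W p) - √(W' p)| ≤ √w := by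
    filter_upwards [h.bounds hlo, h'.bounds hlo] with p e1 e2
    have e3 := Real.sqrt_le_sqrt e1.2
    have e4 := Real.sqrt_le_sqrt e2.2
    rw [abs_le]
    constructor <;> linarith [Real.sqrt_nonneg (W p), Real.sqrt_nonneg (W' p)]
  have hsi : Integrable (fun p => √(W p) - √(W' p)) := Integrable.of_bound hsm _ hsb
  have hs2i : Integrable (fun p => |√(W p) - √(W' p)| ^ 2) := by
    refine Integrable.of_bound (C := √w ^ 2) ((continuous_abs.comp_aestronglyMeasurable hsm).pow 2)
      ?_
    filter_upwards [hsb] with p hp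
    rw [Real.norm_eq_abs, abs_of_nonneg (sq_nonneg _)]
    exact pow_le_pow_left₀ (abs_nonneg _) hp 2
  have h2 := sq_integral_le_integral_sq hsi.abs hs2i
  simp only [sq_abs] at h2
  -- Factoring W - W' through square roots costs 2√w. Cauchy–Schwarz then brings in the Hellinger
  -- estimate `h1`.
  have h3 : ∫ p, |W p - W' p| ≤ 2 * √w * ∫ p, |√(W p) - √(W' p)| := by
    rw [← integral_const_mul]
    refine integral_mono_ae ((h.integrable hlo).sub (h'.integrable hlo)).abs
      (hsi.abs.const_mul _) ?_
    filter_upwards [h.bounds hlo, h'.bounds hlo] with p e1 e2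
    have hc := mul_pos hlo (Real.exp_pos (-(2 * B)))
    have e : W p - W' p = (√(W p) + √(W' p)) * (√(W p) - √(W' p)) := by
      linear_combination -(Real.sq_sqrt (hc.le.trans e1.1)) + Real.sq_sqrt (hc.le.trans e2.1)
    rw [e, abs_mul, abs_of_nonneg (by positivity)]
    refine mul_le_mul_of_nonneg_right ?_ (abs_nonneg _)
    linarith [Real.sqrt_le_sqrt e1.2, Real.sqrt_le_sqrt e2.2]
  set S := ∫ p, |√(W p) - √(W' p)| with hS
  set l := l1Dist ρ₁ ρ₁' + l1Dist ρ₂ ρ₂' with hl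
  have hl0 : 0 ≤ l := add_nonneg (integral_nonneg fun _ => abs_nonneg _)
    (integral_nonneg fun _ => abs_nonneg _)
  have hd0 : 0 ≤ hellingerDist φ φ' := Real.sqrt_nonneg _
  have h4 : S ≤ √(w / lo) * hellingerDist φ φ' + √B * √l := by
    refine le_trans (Real.le_sqrt_of_sq_le (h2.trans h1)) ?_
    have e1 : ∀ x y : ℝ, 0 ≤ x → 0 ≤ y → √(x + y) ≤ √x + √y := fun x y hx hy =>
      Real.sqrt_le_iff.2 ⟨by positivity, by
        nlinarith [Real.sq_sqrt hx, Real.sq_sqrt hy, mul_nonneg (Real.sqrt_nonneg x)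
          (Real.sqrt_nonneg y)]⟩
    refine (e1 _ _ (mul_nonneg (by positivity) (integral_nonneg fun _ => sq_nonneg _))
      (mul_nonneg hB hl0)).trans (le_of_eq ?_)
    rw [Real.sqrt_mul (by positivity), Real.sqrt_mul hB]
    rfl
  have h5 : √(w / lo) * hellingerDist φ φ' + √B * √l
      ≤ (√(w / lo) + √B) * (√l + hellingerDist φ φ') := by
    have := mul_nonneg (Real.sqrt_nonneg (w / lo)) (Real.sqrt_nonneg l)
    have := mul_nonneg (Real.sqrt_nonneg B) hd0
    linarith
  refine h3.trans ?_
  unfold stabilityConst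
  rw [mul_assoc (2 * √(hi * Real.exp (2 * B)))]
  exact mul_le_mul_of_nonneg_left (h4.trans h5) (by positivity)

end IsScaledDensity

end Stability

/-! ### Limits of scaled densities -/

section L1

variable {Ω : Type*} [MeasurableSpace Ω] {μ : Measure Ω}

/-- Completeness of L¹, with the distance written as an integral of functions rather than of
classes. -/
theorem exists_integrable_tendsto_of_cauchy {W : ℕ → Ω → ℝ} (hW : ∀ k, Integrable (W k) μ)
    (hc : ∀ ε > 0, ∃ N, ∀ k ≥ N, ∀ l ≥ N, ∫ x, |W k x - W l x| ∂μ < ε) :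
    ∃ V, Integrable V μ ∧ Tendsto (fun k => ∫ x, |W k x - V x| ∂μ) atTop (𝓝 0) := by
  have hd : ∀ (f g : Ω → ℝ) (hf : Integrable f μ) (hg : Integrable g μ),
      dist (hf.toL1 f) (hg.toL1 g) = ∫ x, |f x - g x| ∂μ := by
    intro f g hf hg
    rw [L1.dist_eq_integral_dist]
    refine integral_congr_ae ?_
    filter_upwards [hf.coeFn_toL1, hg.coeFn_toL1] with x h1 h2
    rw [h1, h2, Real.dist_eq]
  have hcs : CauchySeq fun k => (hW k).toL1 (W k) := by
    refine Metric.cauchySeq_iff.2 fun ε hε => ?_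
    obtain ⟨N, hN⟩ := hc ε hε
    exact ⟨N, fun k hk l hl => by rw [hd]; exact hN k hk l hl⟩
  obtain ⟨V, hV⟩ := cauchySeq_tendsto_of_complete hcs
  refine ⟨V, L1.integrable_coeFn V, ?_⟩
  refine (tendsto_iff_dist_tendsto_zero.1 hV).congr fun k => ?_
  rw [← hd _ _ (hW k) (L1.integrable_coeFn V), Integrable.toL1_coeFn]

/-- L¹ convergence implies convergence in measure, which yields an almost everywhere convergent
subsequence. -/
theorem exists_subseq_tendsto_ae_of_integral_tendsto {F : ℕ → Ω → ℝ}
    (hF : ∀ k, Integrable (F k) μ) (h : Tendsto (fun k => ∫ x, |F k x| ∂μ) atTop (𝓝 0)) :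
    ∃ s : ℕ → ℕ, StrictMono s ∧ ∀ᵐ x ∂μ, Tendsto (fun i => F (s i) x) atTop (𝓝 0) := by
  have h1 : Tendsto (fun k => eLpNorm (F k - fun _ => 0) 1 μ) atTop (𝓝 0) := by
    have : ∀ k, eLpNorm (F k - fun _ => 0) 1 μ = ENNReal.ofReal (∫ x, |F k x| ∂μ) := by
      intro k
      rw [eLpNorm_one_eq_lintegral_enorm, ← ofReal_integral_norm_eq_lintegral_enorm]
      · simp
      · exact (hF k).sub (integrable_zero _ _ _)
    simp_rw [this]
    simpa using ENNReal.tendsto_ofReal h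
  exact (tendstoInMeasure_of_tendsto_eLpNorm one_ne_zero (fun k => (hF k).1)
    aestronglyMeasurable_const h1).exists_seq_tendsto_ae

theorem tendsto_integral_mul_of_l1 {V : ℕ → Ω → ℝ} {V₀ f : Ω → ℝ} {C : ℝ}
    (hV : ∀ k, Integrable (V k) μ) (hV₀ : Integrable V₀ μ)
    (h : Tendsto (fun k => ∫ x, |V k x - V₀ x| ∂μ) atTop (𝓝 0)) (hf : Measurable f)
    (hC : ∀ x, |f x| ≤ C) :
    Tendsto (fun k => ∫ x, V k x * f x ∂μ) atTop (𝓝 (∫ x, V₀ x * f x ∂μ)) := by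
  have hi : ∀ U : Ω → ℝ, Integrable U μ → Integrable (fun x => U x * f x) μ := fun U hU =>
    hU.mul_bdd (c := C) hf.aestronglyMeasurable (Eventually.of_forall hC)
  refine tendsto_iff_dist_tendsto_zero.2 (squeeze_zero (g := fun k => C * ∫ x, |V k x - V₀ x| ∂μ)
    (fun _ => dist_nonneg) (fun k => ?_) (by simpa using h.const_mul C))
  rw [Real.dist_eq, ← integral_sub (hi _ (hV k)) (hi _ hV₀), ← integral_const_mul]
  refine abs_integral_le_integral_abs.trans (integral_mono
    ((hi _ (hV k)).sub (hi _ hV₀)).abs (((hV k).sub hV₀).abs.const_mul C) fun x => ?_)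
  beta_reduce
  rw [← sub_mul, abs_mul, mul_comm]
  exact mul_le_mul_of_nonneg_right (hC x) (abs_nonneg _)

theorem abs_integral_le_of_abs_le [IsProbabilityMeasure μ] {f : Ω → ℝ} {C : ℝ}
    (hf : ∀ x, |f x| ≤ C) : |∫ x, f x ∂μ| ≤ C := by
  simpa using norm_integral_le_of_norm_le_const (μ := μ) (f := f) (C := C)
    (Eventually.of_forall hf)

theorem tendsto_integral_of_abs_le [IsFiniteMeasure μ] {f : ℕ → Ω → ℝ} {g : Ω → ℝ} {C : ℝ}
    (hm : ∀ i, Measurable (f i)) (hf : ∀ i x, |f i x| ≤ C)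
    (hl : ∀ᵐ x ∂μ, Tendsto (fun i => f i x) atTop (𝓝 (g x))) :
    Tendsto (fun i => ∫ x, f i x ∂μ) atTop (𝓝 (∫ x, g x ∂μ)) :=
  tendsto_integral_of_dominated_convergence (fun _ => C)
    (fun i => (hm i).aestronglyMeasurable) (integrable_const _)
    (fun i => Eventually.of_forall (hf i)) hl

end L1

section Limit

variable {α β : Type*} [MeasureSpace α] [MeasureSpace β]

theorem l1Dist_triangle {f g h : α → ℝ} (hf : Integrable f) (hg : Integrable g)
    (hh : Integrable h) : l1Dist f h ≤ l1Dist f g + l1Dist g h := by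
  have h1 : Integrable fun x => |f x - g x| := (hf.sub hg).abs
  have h2 : Integrable fun x => |g x - h x| := (hg.sub hh).abs
  unfold l1Dist
  rw [← integral_add h1 h2]
  exact integral_mono (hf.sub hh).abs (h1.add h2) fun x => abs_sub_le _ _ _

theorem l1Dist_comm (f g : α → ℝ) : l1Dist f g = l1Dist g f := by
  simp_rw [l1Dist, abs_sub_comm]

theorem sqrt_sub_sq_le_abs_sub {x y : ℝ} (hx : 0 ≤ x) (hy : 0 ≤ y) :
    (√x - √y) ^ 2 ≤ |x - y| := by
  have e1 := Real.sq_sqrt hx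
  have e2 := Real.sq_sqrt hy
  have e3 := Real.sqrt_nonneg x
  have e4 := Real.sqrt_nonneg y
  rcases le_total x y with h | h
  · rw [abs_sub_comm, abs_of_nonneg (sub_nonneg.2 h)]
    nlinarith [Real.sqrt_le_sqrt h]
  · rw [abs_of_nonneg (sub_nonneg.2 h)]
    nlinarith [Real.sqrt_le_sqrt h]

theorem hellingerDist_le_sqrt_l1Dist {f g : α → ℝ} (hf : Integrable f) (hg : Integrable g)
    (hf0 : ∀ᵐ x, 0 ≤ f x) (hg0 : ∀ᵐ x, 0 ≤ g x) : hellingerDist f g ≤ √(l1Dist f g) := by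
  refine Real.sqrt_le_sqrt (integral_mono_of_nonneg (Eventually.of_forall fun _ => sq_nonneg _)
    (hf.sub hg).abs ?_)
  filter_upwards [hf0, hg0] with x h1 h2
  exact sqrt_sub_sq_le_abs_sub h1 h2

variable [IsProbabilityMeasure (volume : Measure α)] [IsProbabilityMeasure (volume : Measure β)]

/-- An almost everywhere limit of functions `a x + b y` with bounded `a`, `b` is of this form. -/
theorem exists_add_of_tendsto_ae {B : ℝ} {a : ℕ → α → ℝ} {b : ℕ → β → ℝ}
    (ha : ∀ i, Measurable (a i)) (hb : ∀ i, Measurable (b i)) (haB : ∀ i x, |a i x| ≤ B)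
    (hbB : ∀ i y, |b i y| ≤ B) {h : α × β → ℝ}
    (hlim : ∀ᵐ p, Tendsto (fun i => a i p.1 + b i p.2) atTop (𝓝 (h p))) :
    ∃ (a' : α → ℝ) (b' : β → ℝ), Measurable a' ∧ Measurable b' ∧ (∀ x, |a' x| ≤ 4 * B) ∧
      (∀ y, |b' y| ≤ 4 * B) ∧ ∀ᵐ p, h p = a' p.1 + b' p.2 := by
  -- A version of the limit that is measurable and bounded everywhere, obtained by clipping a
  -- limsup, so that its partial integrals can be used without exceptions.
  obtain ⟨H, hHm, hHB, hHlim⟩ : ∃ H : α × β → ℝ, Measurable H ∧ (∀ p, |H p| ≤ 2 * B) ∧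
      ∀ᵐ p, Tendsto (fun i => a i p.1 + b i p.2) atTop (𝓝 (H p)) := by
    have hab : ∀ i (p : α × β), |a i p.1 + b i p.2| ≤ 2 * B := fun i p =>
      (abs_add_le _ _).trans (by linarith [haB i p.1, hbB i p.2])
    refine ⟨fun p => max (-(2 * B)) (min (limsup (fun i => a i p.1 + b i p.2) atTop) (2 * B)),
      ?_, fun p => ?_, ?_⟩
    · refine measurable_const.max (Measurable.min (Measurable.limsup fun i => ?_) measurable_const)
      have := ha i
      have := hb i
      fun_prop
    · have h0 := (abs_nonneg _).trans (hab 0 p)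
      exact abs_le.2 ⟨le_max_left _ _, max_le (by linarith) (min_le_right _ _)⟩
    · filter_upwards [hlim] with p hp
      rw [hp.limsup_eq, min_eq_left, max_eq_right]
      · exact hp
      · exact ge_of_tendsto' hp fun i => (abs_le.1 (hab i p)).1
      · exact le_of_tendsto' hp fun i => (abs_le.1 (hab i p)).2
  obtain ⟨x₀⟩ : Nonempty α := nonempty_of_isProbabilityMeasure (volume : Measure α)
  have hB0 : 0 ≤ B := (abs_nonneg _).trans (haB 0 x₀)
  -- The sequences a i and b i need not converge separately, since constants can move between them.
  -- Their partial averages a i + ∫ b i and ∫ a i + b i do converge, and T corrects for the mean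
  -- counted twice.
  set T := ∫ x, ∫ y, H (x, y) with hT
  have hax : ∀ x, |∫ y, H (x, y)| ≤ 2 * B := fun x => abs_integral_le_of_abs_le fun y => hHB _
  have hbx : ∀ y, |∫ x, H (x, y)| ≤ 2 * B := fun y => abs_integral_le_of_abs_le fun x => hHB _
  have hTB : |T| ≤ 2 * B := abs_integral_le_of_abs_le hax
  have hsl1 : ∀ᵐ x : α, ∀ᵐ y : β, Tendsto (fun i => a i x + b i y) atTop (𝓝 (H (x, y))) := by
    rw [Measure.volume_eq_prod] at hHlim
    exact Measure.ae_ae_of_ae_prod hHlim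
  have hsl2 : ∀ᵐ y : β, ∀ᵐ x : α, Tendsto (fun i => a i x + b i y) atTop (𝓝 (H (x, y))) := by
    have h1 := hHlim
    rw [Measure.volume_eq_prod, ← Measure.prod_swap] at h1
    exact Measure.ae_ae_of_ae_prod (ae_of_ae_map measurable_swap.aemeasurable h1)
  have hab : ∀ i x y, |a i x + b i y| ≤ 2 * B := fun i x y =>
    (abs_add_le _ _).trans (by linarith [haB i x, hbB i y])
  have hai : ∀ i, Integrable (a i) := fun i =>
    Integrable.of_bound (ha i).aestronglyMeasurable B (Eventually.of_forall (haB i))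
  have hbi : ∀ i, Integrable (b i) := fun i =>
    Integrable.of_bound (hb i).aestronglyMeasurable B (Eventually.of_forall (hbB i))
  have hL1 : ∀ᵐ x : α, Tendsto (fun i => a i x + ∫ y, b i y) atTop (𝓝 (∫ y, H (x, y))) := by
    filter_upwards [hsl1] with x hx
    refine (tendsto_integral_of_abs_le (fun i => (hb i).const_add (a i x)) (fun i => hab i x)
      hx).congr fun i => ?_
    rw [integral_add (integrable_const _) (hbi i)]
    simp
  have hL2 : ∀ᵐ y : β, Tendsto (fun i => (∫ x, a i x) + b i y) atTop (𝓝 (∫ x, H (x, y))) := by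
    filter_upwards [hsl2] with y hy
    refine (tendsto_integral_of_abs_le (fun i => (ha i).add_const (b i y)) (fun i x => hab i x y)
      hy).congr fun i => ?_
    rw [integral_add (hai i) (integrable_const _)]
    simp
  have hL3 : Tendsto (fun i => (∫ x, a i x) + ∫ y, b i y) atTop (𝓝 T) := by
    refine (tendsto_integral_of_abs_le (C := 2 * B) (fun i => (ha i).add_const (∫ y, b i y))
      (fun i x => ?_) hL1).congr fun i => ?_
    · exact (abs_add_le _ _).trans
        (by linarith [haB i x, abs_integral_le_of_abs_le (μ := volume) (hbB i)])
    · rw [integral_add (hai i) (integrable_const _)]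
      simp
  refine ⟨fun x => ∫ y, H (x, y), fun y => (∫ x, H (x, y)) - T, ?_, ?_,
    fun x => (hax x).trans (by linarith), fun y => (abs_sub _ _).trans (by linarith [hbx y]), ?_⟩
  · exact (hHm.stronglyMeasurable.integral_prod_right' (ν := volume)).measurable
  · exact (hHm.stronglyMeasurable.integral_prod_left' (μ := volume)).measurable.sub_const T
  · have h1 : ∀ᵐ p : α × β, Tendsto (fun i => a i p.1 + ∫ y, b i y) atTop
        (𝓝 (∫ y, H (p.1, y))) := by
      rw [Measure.volume_eq_prod]
      exact Measure.quasiMeasurePreserving_fst.ae hL1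
    have h2 : ∀ᵐ p : α × β, Tendsto (fun i => (∫ x, a i x) + b i p.2) atTop
        (𝓝 (∫ x, H (x, p.2))) := by
      rw [Measure.volume_eq_prod]
      exact Measure.quasiMeasurePreserving_snd.ae hL2
    filter_upwards [h1, h2, hlim] with p e1 e2 e3
    have e4 := (e1.add e2).sub hL3
    refine tendsto_nhds_unique e3 ?_
    rw [← add_sub_assoc]
    refine e4.congr fun i => ?_
    ring

namespace IsScaledDensity

/-- A limit of scaled densities along convergent kernels and marginals is a scaled density. -/
theorem exists_limit {lo hi B : ℝ} {φs Ws : ℕ → α × β → ℝ} {φ : α × β → ℝ} {ρ₁s : ℕ → α → ℝ}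
    {ρ₂s : ℕ → β → ℝ} {ρ₁ : α → ℝ} {ρ₂ : β → ℝ} {a : ℕ → α → ℝ} {b : ℕ → β → ℝ}
    (h : ∀ k, IsScaledDensity lo hi B (φs k) (Ws k) (ρ₁s k) (ρ₂s k) (a k) (b k)) (hlo : 0 < lo)
    (hφ : Integrable φ) (hρ₁ : Integrable ρ₁) (hρ₂ : Integrable ρ₂)
    (hφl : Tendsto (fun k => l1Dist (φs k) φ) atTop (𝓝 0))
    (hρ₁l : Tendsto (fun k => l1Dist (ρ₁s k) ρ₁) atTop (𝓝 0))
    (hρ₂l : Tendsto (fun k => l1Dist (ρ₂s k) ρ₂) atTop (𝓝 0)) :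
    ∃ W a' b', IsScaledDensity lo hi (4 * B) φ W ρ₁ ρ₂ a' b' := by
  obtain ⟨x₀⟩ : Nonempty α := nonempty_of_isProbabilityMeasure (volume : Measure α)
  have hB0 : 0 ≤ B := (abs_nonneg _).trans ((h 0).left_le x₀)
  have hhi : 0 ≤ hi := by
    obtain ⟨p, hp⟩ := (h 0).kernel_bounds.exists
    linarith
  have hWi : ∀ k, Integrable (Ws k) := fun k => (h k).integrable hlo
  have hφi : ∀ k, Integrable (φs k) := fun k => by
    refine Integrable.of_bound (h k).kernel_meas hi ?_
    filter_upwards [(h k).kernel_bounds] with p hp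
    rw [Real.norm_eq_abs, abs_of_pos (by linarith)]
    exact hp.2
  have hφ0 : ∀ k, ∀ᵐ p, 0 ≤ φs k p := fun k => by
    filter_upwards [(h k).kernel_bounds] with p hp
    linarith
  obtain ⟨S, hS⟩ : ∃ S, S = stabilityConst lo hi B := ⟨_, rfl⟩
  have hS0 : 0 ≤ S := by
    rw [hS]
    unfold stabilityConst
    positivity
  obtain ⟨e, he⟩ : ∃ e : ℕ → ℝ, e = fun k => l1Dist (ρ₁s k) ρ₁ + l1Dist (ρ₂s k) ρ₂ :=
    ⟨_, rfl⟩
  have hel : Tendsto e atTop (𝓝 0) := by simpa [he] using hρ₁l.add hρ₂l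
  -- Stability compares any two members of the sequence, and both distances are routed through the
  -- prescribed limits.
  have hcauchy : ∀ k l, ∫ p, |Ws k p - Ws l p|
      ≤ S * (√(e k + e l) + √(l1Dist (φs k) φ + l1Dist (φs l) φ)) := by
    intro k l
    refine ((h k).integral_abs_sub_le (h l) hlo hhi hB0).trans ?_
    rw [← hS]
    refine mul_le_mul_of_nonneg_left (add_le_add (Real.sqrt_le_sqrt ?_) ?_) hS0
    · have h1 := l1Dist_triangle (h k).left_int hρ₁ (h l).left_int
      have h2 := l1Dist_triangle (h k).right_int hρ₂ (h l).right_int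
      rw [l1Dist_comm ρ₁] at h1
      rw [l1Dist_comm ρ₂] at h2
      simp only [he]
      linarith
    · refine (hellingerDist_le_sqrt_l1Dist (hφi k) (hφi l) (hφ0 k) (hφ0 l)).trans
        (Real.sqrt_le_sqrt ?_)
      have h1 := l1Dist_triangle (hφi k) hφ (hφi l)
      rwa [l1Dist_comm φ] at h1
  have hlim2 : Tendsto (fun q : ℕ × ℕ => S * (√(e q.1 + e q.2)
      + √(l1Dist (φs q.1) φ + l1Dist (φs q.2) φ))) (atTop ×ˢ atTop) (𝓝 0) := by
    have h1 := ((hel.comp tendsto_fst).add (hel.comp (tendsto_snd (f := atTop (α := ℕ))))).sqrt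
    have h2 := ((hφl.comp tendsto_fst).add
      (hφl.comp (tendsto_snd (f := atTop (α := ℕ))))).sqrt
    simpa using (h1.add h2).const_mul S
  obtain ⟨W, hWint, hWlim⟩ := exists_integrable_tendsto_of_cauchy hWi (by
    intro ε hε
    rw [prod_atTop_atTop_eq] at hlim2
    obtain ⟨⟨N₁, N₂⟩, hN⟩ := eventually_atTop.1 (hlim2.eventually (gt_mem_nhds hε))
    exact ⟨max N₁ N₂, fun k hk l hl => (hcauchy k l).trans_lt
      (hN (k, l) ⟨(le_max_left _ _).trans hk, (le_max_right _ _).trans hl⟩)⟩)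
  -- Adding the two deviations provides a single subsequence along which kernels and densities
  -- converge almost everywhere.
  have hFi : ∀ k, Integrable fun p => |φs k p - φ p| + |Ws k p - W p| := fun k =>
    ((hφi k).sub hφ).abs.add ((hWi k).sub hWint).abs
  obtain ⟨s, -, hs⟩ := exists_subseq_tendsto_ae_of_integral_tendsto hFi (by
    have h1 := hφl.add hWlim
    rw [add_zero] at h1
    refine h1.congr fun k => ?_
    rw [l1Dist, ← integral_add (f := fun p => |φs k p - φ p|) (g := fun p => |Ws k p - W p|)
      ((hφi k).sub hφ).abs ((hWi k).sub hWint).abs]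
    refine integral_congr_ae (Eventually.of_forall fun p => ?_)
    exact (abs_of_nonneg (add_nonneg (abs_nonneg _) (abs_nonneg _))).symm)
  have hae : ∀ᵐ p, Tendsto (fun i => φs (s i) p) atTop (𝓝 (φ p)) ∧
      Tendsto (fun i => Ws (s i) p) atTop (𝓝 (W p)) := by
    filter_upwards [hs] with p hp
    constructor <;> refine tendsto_iff_dist_tendsto_zero.2 (squeeze_zero (fun _ => dist_nonneg)
      (fun i => ?_) hp) <;> rw [Real.dist_eq] <;>
      linarith [abs_nonneg (φs (s i) p - φ p), abs_nonneg (Ws (s i) p - W p)]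
  have hkb : ∀ᵐ p, lo ≤ φ p ∧ φ p ≤ hi := by
    filter_upwards [hae, ae_all_iff.2 fun k => (h k).kernel_bounds] with p hp hk
    exact ⟨ge_of_tendsto' hp.1 fun i => (hk _).1, le_of_tendsto' hp.1 fun i => (hk _).2⟩
  have hWb : ∀ᵐ p, lo * Real.exp (-(2 * B)) ≤ W p := by
    filter_upwards [hae, ae_all_iff.2 fun k => (h k).bounds hlo] with p hp hk
    exact ge_of_tendsto' hp.2 fun i => (hk _).1
  -- The lower bounds on φ and W keep the logarithm continuous, so the log-ratio of the limit is a
  -- limit of separable functions.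
  have hlog : ∀ᵐ p, Tendsto (fun i => a (s i) p.1 + b (s i) p.2) atTop
      (𝓝 (Real.log (W p / φ p))) := by
    filter_upwards [hae, hkb, hWb, ae_all_iff.2 fun k => (h k).eq,
      ae_all_iff.2 fun k => (h k).kernel_bounds] with p hp hk hw heq hki
    have hφp : 0 < φ p := hlo.trans_le hk.1
    have hWp : 0 < W p := (mul_pos hlo (Real.exp_pos _)).trans_le hw
    refine ((hp.2.div hp.1 hφp.ne').log (div_pos hWp hφp).ne').congr fun i => ?_
    change Real.log (Ws (s i) p / φs (s i) p) = _
    rw [heq, mul_div_cancel_left₀ _ (hlo.trans_le (hki _).1).ne', Real.log_exp]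
  obtain ⟨a', b', ha', hb', ha'B, hb'B, hab⟩ := exists_add_of_tendsto_ae
    (fun i => (h (s i)).left_meas) (fun i => (h (s i)).right_meas) (fun i => (h (s i)).left_le)
    (fun i => (h (s i)).right_le) hlog
  refine ⟨W, a', b', hφ.1, hkb, ha', hb', ha'B, hb'B, ?_, hρ₁, hρ₂, ?_, ?_⟩
  · filter_upwards [hab, hkb, hWb] with p e1 e2 e3
    have hφp : 0 < φ p := hlo.trans_le e2.1
    have hWp : 0 < W p := (mul_pos hlo (Real.exp_pos _)).trans_le e3
    rw [← e1, Real.exp_log (div_pos hWp hφp), mul_div_cancel₀ _ hφp.ne']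
  · rintro f hf ⟨C, hC⟩
    have h1 := tendsto_integral_mul_of_l1 hWi hWint hWlim (hf.comp measurable_fst)
      (C := C) fun p => hC p.1
    have h2 := tendsto_integral_mul_of_l1 (fun k => (h k).left_int) hρ₁ hρ₁l hf hC
    refine tendsto_nhds_unique h1 (h2.congr fun k => ?_)
    exact ((h k).fst f hf ⟨C, hC⟩).symm
  · rintro f hf ⟨C, hC⟩
    have h1 := tendsto_integral_mul_of_l1 hWi hWint hWlim (hf.comp measurable_snd)
      (C := C) fun p => hC p.2
    have h2 := tendsto_integral_mul_of_l1 (fun k => (h k).right_int) hρ₂ hρ₂l hf hC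
    refine tendsto_nhds_unique h1 (h2.congr fun k => ?_)
    exact ((h k).snd f hf ⟨C, hC⟩).symm

end IsScaledDensity

end Limit

/-! ### Schrödinger bridges with bounded potentials -/

section Bridge

open InformationTheory

variable {α β : Type*} [MeasurableSpace α] [MeasurableSpace β]

theorem integral_add_eq_of_marginals {H : Measure (α × β)} [IsFiniteMeasure H] {a : α → ℝ}
    {b : β → ℝ} {B : ℝ} (ha : Measurable a) (hb : Measurable b) (haB : ∀ x, |a x| ≤ B)
    (hbB : ∀ y, |b y| ≤ B) :
    ∫ p, (a p.1 + b p.2) ∂H = (∫ x, a x ∂H.fst) + ∫ y, b y ∂H.snd := by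
  rw [Measure.fst, Measure.snd, integral_map measurable_fst.aemeasurable ha.aestronglyMeasurable,
    integral_map measurable_snd.aemeasurable hb.aestronglyMeasurable]
  refine integral_add ?_ ?_
  · exact Integrable.of_bound (ha.comp measurable_fst).aestronglyMeasurable B
      (Eventually.of_forall fun p => haB p.1)
  · exact Integrable.of_bound (hb.comp measurable_snd).aestronglyMeasurable B
      (Eventually.of_forall fun p => hbB p.2)

variable {Q : Measure (α × β)} [IsProbabilityMeasure Q] {a : α → ℝ} {b : β → ℝ} {B : ℝ}

theorem integrable_exp_add_of_abs_le {H : Measure (α × β)} [IsFiniteMeasure H]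
    (ha : Measurable a) (hb : Measurable b) (haB : ∀ x, |a x| ≤ B) (hbB : ∀ y, |b y| ≤ B) :
    Integrable (fun p : α × β => Real.exp (a p.1 + b p.2)) H := by
  refine Integrable.of_bound (Measurable.aestronglyMeasurable (by fun_prop)) (Real.exp (2 * B))
    (Eventually.of_forall fun p => ?_)
  rw [Real.norm_eq_abs, abs_of_pos (Real.exp_pos _), Real.exp_le_exp]
  linarith [(abs_le.1 (haB p.1)).2, (abs_le.1 (hbB p.2)).2]

theorem integrable_add_of_abs_le {H : Measure (α × β)} [IsFiniteMeasure H]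
    (ha : Measurable a) (hb : Measurable b) (haB : ∀ x, |a x| ≤ B) (hbB : ∀ y, |b y| ≤ B) :
    Integrable (fun p : α × β => a p.1 + b p.2) H := by
  refine Integrable.of_bound (Measurable.aestronglyMeasurable (by fun_prop)) (2 * B)
    (Eventually.of_forall fun p => ?_)
  exact (abs_add_le _ _).trans (by linarith [haB p.1, hbB p.2])

/-- The Pythagorean identity of the relative entropy for a bridge with bounded potentials. -/
theorem klDiv_tilted_add_klDiv {H : Measure (α × β)} (ha : Measurable a) (hb : Measurable b)
    (haB : ∀ x, |a x| ≤ B) (hbB : ∀ y, |b y| ≤ B)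
    (h1 : H.fst = (Q.tilted fun p => a p.1 + b p.2).fst)
    (h2 : H.snd = (Q.tilted fun p => a p.1 + b p.2).snd) (hH : klDiv H Q ≠ ⊤) :
    klDiv H Q = klDiv H (Q.tilted fun p => a p.1 + b p.2)
      + klDiv (Q.tilted fun p => a p.1 + b p.2) Q := by
  have hfR := integrable_exp_add_of_abs_le (H := Q) ha hb haB hbB
  obtain ⟨π, hπ⟩ : ∃ π, π = Q.tilted fun p => a p.1 + b p.2 := ⟨_, rfl⟩
  have hπp : IsProbabilityMeasure π := hπ ▸ isProbabilityMeasure_tilted hfR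
  rw [← hπ] at h1 h2 ⊢
  have hHp : IsProbabilityMeasure H := ⟨by
    rw [← Measure.fst_univ, h1, Measure.fst_univ, measure_univ]⟩
  obtain ⟨hac, hint⟩ := klDiv_ne_top_iff.1 hH
  have hfH := integrable_add_of_abs_le (H := H) ha hb haB hbB
  have hfπ := integrable_add_of_abs_le (H := π) ha hb haB hbB
  have hacπ : H ≪ π := hπ ▸ hac.trans (absolutelyContinuous_tilted hfR)
  have hπQ : π ≪ Q := hπ ▸ tilted_absolutelyContinuous Q _
  have hllr : llr π Q =ᵐ[π] fun p => a p.1 + b p.2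
      - Real.log (∫ z, Real.exp (a z.1 + b z.2) ∂Q) := by
    have e1 := llr_tilted_left (μ := Q) (ν := Q) Measure.AbsolutelyContinuous.rfl hfR
      (Measurable.aemeasurable (by fun_prop))
    rw [← hπ] at e1
    refine hπQ.ae_le ?_
    filter_upwards [e1, llr_self Q] with p h3 h4
    rw [h3, h4]
    simp
  have hintπ : Integrable (llr π Q) π :=
    (hfπ.sub (integrable_const (Real.log (∫ z, Real.exp (a z.1 + b z.2) ∂Q)))).congr hllr.symm
  have hintH : Integrable (llr H π) H := hπ ▸ integrable_llr_tilted_right hac hfH hint hfR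
  rw [← ENNReal.toReal_eq_toReal_iff' hH
    (ENNReal.add_ne_top.2 ⟨klDiv_ne_top hacπ hintH, klDiv_ne_top hπQ hintπ⟩),
    ENNReal.toReal_add (klDiv_ne_top hacπ hintH) (klDiv_ne_top hπQ hintπ),
    toReal_klDiv_of_measure_eq hac (by simp), toReal_klDiv_of_measure_eq hacπ (by simp),
    toReal_klDiv_of_measure_eq hπQ (by simp), integral_congr_ae hllr,
    integral_sub hfπ (integrable_const _)]
  -- Replacing Q by the tilted measure changes the entropy of H by the integral of a ⊕ b - log Z.
  -- This integral depends only on the marginals, so it has the same value for H and for the tilted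
  -- measure, where it is the entropy relative to Q.
  have h3 := integral_llr_tilted_right hac hfH hfR hint
  rw [← hπ] at h3
  rw [h3, integral_add_eq_of_marginals (H := H) ha hb haB hbB,
    integral_add_eq_of_marginals (H := π) ha hb haB hbB, h1, h2]
  simp

/-- The log-density a ⊕ b - log Z is bounded, hence integrable. -/
theorem klDiv_tilted_ne_top (ha : Measurable a) (hb : Measurable b)
    (haB : ∀ x, |a x| ≤ B) (hbB : ∀ y, |b y| ≤ B) :
    klDiv (Q.tilted fun p => a p.1 + b p.2) Q ≠ ⊤ := by
  have hfR := integrable_exp_add_of_abs_le (H := Q) ha hb haB hbB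
  have hπp := isProbabilityMeasure_tilted hfR
  have hac := tilted_absolutelyContinuous Q fun p => a p.1 + b p.2
  refine klDiv_ne_top hac ?_
  refine ((integrable_add_of_abs_le (H := Q.tilted fun p => a p.1 + b p.2) ha hb haB hbB).sub
    (integrable_const (Real.log (∫ z, Real.exp (a z.1 + b z.2) ∂Q)))).congr
    (EventuallyEq.symm (hac.ae_le ?_))
  filter_upwards [llr_tilted_left (μ := Q) (ν := Q) Measure.AbsolutelyContinuous.rfl hfR
      (Measurable.aemeasurable (by fun_prop)), llr_self Q] with p h3 h4
  rw [h3, h4]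
  simp

/-- An exponential tilt of the reference measure by bounded potentials is the only bridge between
its marginals. -/
theorem isSchrodingerBridge_iff_eq_tilted {μ₀ : Measure α} {μ₁ : Measure β} (ha : Measurable a)
    (hb : Measurable b) (haB : ∀ x, |a x| ≤ B) (hbB : ∀ y, |b y| ≤ B)
    (h1 : (Q.tilted fun p => a p.1 + b p.2).fst = μ₀)
    (h2 : (Q.tilted fun p => a p.1 + b p.2).snd = μ₁) (π : Measure (α × β)) :
    IsSchrodingerBridge μ₀ μ₁ Q π ↔ π = Q.tilted fun p => a p.1 + b p.2 := by
  have hfin := klDiv_tilted_ne_top (Q := Q) ha hb haB hbB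
  have hpyth : ∀ H : Measure (α × β), H.fst = μ₀ → H.snd = μ₁ → klDiv H Q ≠ ⊤ →
      klDiv H Q = klDiv H (Q.tilted fun p => a p.1 + b p.2)
        + klDiv (Q.tilted fun p => a p.1 + b p.2) Q := fun H e1 e2 hH =>
    klDiv_tilted_add_klDiv ha hb haB hbB (e1.trans h1.symm) (e2.trans h2.symm) hH
  have hπp := isProbabilityMeasure_tilted (integrable_exp_add_of_abs_le (H := Q) ha hb haB hbB)
  constructor
  · rintro ⟨⟨e1, e2⟩, hmin⟩
    have hle := hmin _ h1 h2
    have hne := ne_top_of_le_ne_top hfin hle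
    have hp : IsProbabilityMeasure π := ⟨by
      rw [← Measure.fst_univ, e1, ← h1, Measure.fst_univ, measure_univ]⟩
    -- Minimality leaves no room for the first summand of the Pythagorean identity. The second is
    -- finite and can be cancelled, so π has zero entropy relative to the tilted measure.
    rw [hpyth π e1 e2 hne] at hle
    refine klDiv_eq_zero_iff.1 (le_antisymm ?_ zero_le)
    exact (ENNReal.add_le_add_iff_right hfin).1 (hle.trans_eq (zero_add _).symm)
  · rintro rfl
    refine ⟨⟨h1, h2⟩, fun H e1 e2 => ?_⟩
    by_cases hH : klDiv H Q = ⊤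
    · rw [hH]
      exact le_top
    · rw [hpyth H e1 e2 hH]
      exact le_add_self

end Bridge

/-! ### Bridges as Lebesgue densities -/

section Density

variable {α β : Type*} [MeasureSpace α] [MeasureSpace β]

theorem densityMeasure_apply {f : α → ℝ} (hf : Integrable f) (hf0 : ∀ᵐ x, 0 ≤ f x) {S : Set α}
    (hS : MeasurableSet S) :
    densityMeasure f S = ENNReal.ofReal (∫ x, f x * S.indicator (fun _ => (1 : ℝ)) x) := by
  have h1 : ∫ x, f x * S.indicator (fun _ => (1 : ℝ)) x = ∫ x in S, f x := by
    rw [← integral_indicator hS]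
    refine integral_congr_ae (Eventually.of_forall fun x => ?_)
    by_cases hx : x ∈ S <;> simp [hx]
  rw [densityMeasure, withDensity_apply _ hS, h1,
    ofReal_integral_eq_lintegral_ofReal hf.integrableOn (ae_restrict_of_ae hf0)]

theorem IsProbDensity.isProbabilityMeasure {f : α → ℝ} (hf : IsProbDensity f) :
    IsProbabilityMeasure (densityMeasure f) := ⟨by
  rw [densityMeasure_apply hf.integrable hf.nonneg MeasurableSet.univ]
  simp [hf.integral_eq]⟩

namespace IsScaledDensity

variable {lo hi B : ℝ} {φ W : α × β → ℝ} {ρ₁ : α → ℝ} {ρ₂ : β → ℝ} {a : α → ℝ} {b : β → ℝ}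

theorem nonneg (h : IsScaledDensity lo hi B φ W ρ₁ ρ₂ a b) (hlo : 0 < lo) : ∀ᵐ p, 0 ≤ W p := by
  filter_upwards [h.bounds hlo] with p hp
  exact (mul_pos hlo (Real.exp_pos _)).le.trans hp.1

/-- The normalizing constant of the tilt equals ∫ W, which is one because the marginal ρ₁ has mass
one. -/
theorem densityMeasure_eq_tilted (h : IsScaledDensity lo hi B φ W ρ₁ ρ₂ a b) (hlo : 0 < lo)
    (hρ₁ : IsProbDensity ρ₁) :
    densityMeasure W = (densityMeasure φ).tilted fun p => a p.1 + b p.2 := by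
  have ha := h.left_meas
  have hb := h.right_meas
  have hφm : AEMeasurable (fun p => ENNReal.ofReal (φ p)) :=
    h.kernel_meas.aemeasurable.ennreal_ofReal
  have hZ : ∫ p, Real.exp (a p.1 + b p.2) ∂(densityMeasure φ) = 1 := by
    rw [densityMeasure, integral_withDensity_eq_integral_toReal_smul₀ hφm
      (Eventually.of_forall fun _ => ENNReal.ofReal_lt_top)]
    have h1 := h.fst (fun _ => 1) measurable_const ⟨1, fun _ => by simp⟩
    simp only [mul_one, hρ₁.integral_eq] at h1
    rw [← h1]
    refine integral_congr_ae ?_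
    filter_upwards [h.eq, h.kernel_bounds] with p h2 h3
    rw [h2, ENNReal.toReal_ofReal (by linarith), smul_eq_mul]
  rw [Measure.tilted, hZ, densityMeasure, densityMeasure,
    ← withDensity_mul₀ hφm (Measurable.aemeasurable (by fun_prop))]
  refine withDensity_congr_ae ?_
  filter_upwards [h.eq, h.kernel_bounds] with p h2 h3
  rw [h2, Pi.mul_apply, div_one, ENNReal.ofReal_mul (by linarith)]

variable [IsProbabilityMeasure (volume : Measure α)] [IsProbabilityMeasure (volume : Measure β)]

theorem fst_densityMeasure (h : IsScaledDensity lo hi B φ W ρ₁ ρ₂ a b) (hlo : 0 < lo)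
    (hρ₁ : IsProbDensity ρ₁) : (densityMeasure W).fst = densityMeasure ρ₁ := by
  ext S hS
  rw [Measure.fst_apply hS, densityMeasure_apply hρ₁.integrable hρ₁.nonneg hS,
    densityMeasure_apply (h.integrable hlo) (h.nonneg hlo) (measurable_fst hS),
    ← h.fst _ (measurable_const.indicator hS) ⟨1, fun x => by
      by_cases hx : x ∈ S <;> simp [hx]⟩]
  rfl

theorem snd_densityMeasure (h : IsScaledDensity lo hi B φ W ρ₁ ρ₂ a b) (hlo : 0 < lo)
    (hρ₂ : IsProbDensity ρ₂) : (densityMeasure W).snd = densityMeasure ρ₂ := by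
  ext S hS
  rw [Measure.snd_apply hS, densityMeasure_apply hρ₂.integrable hρ₂.nonneg hS,
    densityMeasure_apply (h.integrable hlo) (h.nonneg hlo) (measurable_snd hS),
    ← h.snd _ (measurable_const.indicator hS) ⟨1, fun x => by
      by_cases hx : x ∈ S <;> simp [hx]⟩]
  rfl

end IsScaledDensity

end Density

namespace IsScaledDensity

variable {lo hi B : ℝ} {φ W : unitInterval × unitInterval → ℝ} {ρ₁ ρ₂ a b : unitInterval → ℝ}

theorem isSchrodingerBridge_iff (h : IsScaledDensity lo hi B φ W ρ₁ ρ₂ a b) (hlo : 0 < lo)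
    (hφ : IsProbDensity φ) (hρ₁ : IsProbDensity ρ₁) (hρ₂ : IsProbDensity ρ₂)
    (π : Measure (unitInterval × unitInterval)) :
    IsSchrodingerBridge (densityMeasure ρ₁) (densityMeasure ρ₂) (densityMeasure φ) π
      ↔ π = densityMeasure W := by
  have hp := hφ.isProbabilityMeasure
  have h1 := h.fst_densityMeasure hlo hρ₁
  have h2 := h.snd_densityMeasure hlo hρ₂
  rw [h.densityMeasure_eq_tilted hlo hρ₁] at h1 h2 ⊢
  exact isSchrodingerBridge_iff_eq_tilted h.left_meas h.right_meas h.left_le h.right_le h1 h2 π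

/-- Uniqueness of the minimizer identifies the bridge picked by choice. -/
theorem limitBridge_eq (h : IsScaledDensity lo hi B φ W ρ₁ ρ₂ a b) (hlo : 0 < lo)
    (hφ : IsProbDensity φ) (hρ₁ : IsProbDensity ρ₁) (hρ₂ : IsProbDensity ρ₂) :
    limitBridge ρ₁ ρ₂ φ = densityMeasure W := by
  have hex : ∃ π, IsSchrodingerBridge (densityMeasure ρ₁) (densityMeasure ρ₂)
      (densityMeasure φ) π := ⟨_, (h.isSchrodingerBridge_iff hlo hφ hρ₁ hρ₂ _).2 rfl⟩
  rw [limitBridge, schrodingerBridge, dif_pos hex]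
  exact (h.isSchrodingerBridge_iff hlo hφ hρ₁ hρ₂ _).1 hex.choose_spec

theorem limitBridgeDensity_ae_eq (h : IsScaledDensity lo hi B φ W ρ₁ ρ₂ a b) (hlo : 0 < lo)
    (hφ : IsProbDensity φ) (hρ₁ : IsProbDensity ρ₁) (hρ₂ : IsProbDensity ρ₂) :
    limitBridgeDensity ρ₁ ρ₂ φ =ᵐ[volume] W := by
  have h1 : (densityMeasure W).rnDeriv volume =ᵐ[volume] fun p => ENNReal.ofReal (W p) :=
    Measure.rnDeriv_withDensity₀ _ h.meas.aemeasurable.ennreal_ofReal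
  filter_upwards [h1, h.nonneg hlo] with p h2 h3
  rw [limitBridgeDensity, h.limitBridge_eq hlo hφ hρ₁ hρ₂, h2, ENNReal.toReal_ofReal h3]

end IsScaledDensity

/-! ### Step functions of vectors and matrices -/

/-- The indicator of the `i`-th of the `m` half-open cells of `[0, 1]`. -/
noncomputable def cellIndicator (m : ℕ) (i : Fin m) (x : unitInterval) : ℝ :=
  if ⌈(m : ℝ) * (x : ℝ)⌉ = (i : ℤ) + 1 then 1 else 0

/-- The step function with value `u i` on the `i`-th cell. -/
noncomputable def stepFunction {m : ℕ} (u : Fin m → ℝ) (x : unitInterval) : ℝ :=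
  ∑ i, cellIndicator m i x * u i

section Cells

variable {m n : ℕ}

/-- The cells are disjoint. The first alternative cannot be dropped, since the point 0 lies in no
half-open cell. -/
theorem cellIndicator_cases (m : ℕ) (x : unitInterval) :
    (∀ j, cellIndicator m j x = 0) ∨ ∃ i, ∀ j, cellIndicator m j x = if j = i then 1 else 0 := by
  by_cases h : ∃ i : Fin m, ⌈(m : ℝ) * (x : ℝ)⌉ = (i : ℤ) + 1
  · obtain ⟨i, hi⟩ := h
    refine Or.inr ⟨i, fun j => ?_⟩
    unfold cellIndicator
    rw [hi]
    refine if_congr ?_ rfl rfl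
    rw [Fin.ext_iff]
    omega
  · push Not at h
    exact Or.inl fun j => if_neg (h j)

theorem ae_exists_cellIndicator (hm : 0 < m) :
    ∀ᵐ x : unitInterval, ∃ i, ∀ j, cellIndicator m j x = if j = i then 1 else 0 := by
  have h0 : ∀ᵐ x : unitInterval, x ≠ 0 := by
    rw [ae_iff]
    simp
  filter_upwards [h0] with x hx
  refine (cellIndicator_cases m x).resolve_left fun h => ?_
  have hx0 : 0 < (x : ℝ) := unitInterval.pos_iff_ne_zero.2 hx
  have hm' : (0 : ℝ) < m := Nat.cast_pos.2 hm
  have h1 : 0 < ⌈(m : ℝ) * (x : ℝ)⌉ := Int.ceil_pos.2 (by positivity)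
  have h2 : ⌈(m : ℝ) * (x : ℝ)⌉ ≤ m := by
    refine Int.ceil_le.2 ?_
    have := x.2.2
    push_cast
    nlinarith
  -- The ceiling runs from 1 to m for x ≠ 0, whereas indices of `Fin m` start at 0.
  have h3 := h ⟨(⌈(m : ℝ) * (x : ℝ)⌉ - 1).toNat, by omega⟩
  unfold cellIndicator at h3
  rw [if_pos] at h3
  · exact one_ne_zero h3
  · simp only
    omega

theorem cellIndicator_nonneg (i : Fin m) (x : unitInterval) : 0 ≤ cellIndicator m i x := by
  unfold cellIndicator
  split_ifs <;> norm_num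

theorem cellIndicator_le_one (i : Fin m) (x : unitInterval) : cellIndicator m i x ≤ 1 := by
  unfold cellIndicator
  split_ifs <;> norm_num

theorem measurableSet_cell (i : Fin m) :
    MeasurableSet {x : unitInterval | ⌈(m : ℝ) * (x : ℝ)⌉ = (i : ℤ) + 1} := by
  have h : Measurable fun x : unitInterval => ⌈(m : ℝ) * (x : ℝ)⌉ :=
    (measurable_subtype_coe.const_mul _).ceil
  exact h (measurableSet_singleton _)

@[fun_prop]
theorem measurable_cellIndicator (i : Fin m) : Measurable (cellIndicator m i) :=
  Measurable.ite (measurableSet_cell i) measurable_const measurable_const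

theorem integral_cellIndicator (i : Fin m) : ∫ x, cellIndicator m i x = 1 / m := by
  have hm' : (0 : ℝ) < m := Nat.cast_pos.2 i.pos
  have hi : ((i : ℕ) : ℝ) + 1 ≤ m := by exact_mod_cast i.2
  let s : unitInterval := ⟨(i : ℕ) / m, by positivity, by rw [div_le_one hm']; linarith⟩
  let t : unitInterval := ⟨((i : ℕ) + 1) / m, by positivity, by rw [div_le_one hm']; linarith⟩
  have hset : {x : unitInterval | ⌈(m : ℝ) * (x : ℝ)⌉ = (i : ℤ) + 1} = Set.Ioc s t := by
    ext x
    rw [Set.mem_ofPred_eq, Int.ceil_eq_iff, Set.mem_Ioc, ← Subtype.coe_lt_coe,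
      ← Subtype.coe_le_coe]
    change _ ↔ ((i : ℕ) : ℝ) / m < x ∧ (x : ℝ) ≤ ((i : ℕ) + 1) / m
    rw [div_lt_iff₀ hm', le_div_iff₀ hm', mul_comm (x : ℝ)]
    push_cast
    rw [add_sub_cancel_right]
  have h1 : cellIndicator m i = (Set.Ioc s t).indicator fun _ => (1 : ℝ) := by
    ext x
    rw [← hset, Set.indicator_apply]
    exact if_congr (by rw [Set.mem_ofPred_eq]) rfl rfl
  rw [h1, integral_indicator_const _ measurableSet_Ioc, measureReal_def, unitInterval.volume_Ioc]
  have h2 : (t : ℝ) - s = 1 / m := by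
    change (((i : ℕ) : ℝ) + 1) / m - (i : ℕ) / m = 1 / m
    ring
  rw [h2, ENNReal.toReal_ofReal (by positivity), smul_eq_mul, mul_one]

@[fun_prop]
theorem measurable_stepFunction (u : Fin m → ℝ) : Measurable (stepFunction u) := by
  unfold stepFunction
  fun_prop

theorem abs_stepFunction_le {u : Fin m → ℝ} {B : ℝ} (hB : 0 ≤ B) (hu : ∀ i, |u i| ≤ B)
    (x : unitInterval) : |stepFunction u x| ≤ B := by
  unfold stepFunction
  rcases cellIndicator_cases m x with h | ⟨i, h⟩
  · simpa [h] using hB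
  · simpa [h] using hu i

theorem marginDensity_eq (v : Fin m → ℝ) (x : unitInterval) :
    marginDensity v x = m / (∑ i, v i) * stepFunction v x := by
  simp [marginDensity, stepFunction, cellIndicator]

theorem matrixDensity_eq (N : ℝ) (A : Matrix (Fin m) (Fin n) ℝ)
    (p : unitInterval × unitInterval) :
    matrixDensity N A p = m * n / N
      * ∑ i, ∑ j, cellIndicator m i p.1 * cellIndicator n j p.2 * A i j := by
  unfold matrixDensity cellIndicator
  congr 1
  refine Finset.sum_congr rfl fun i _ => Finset.sum_congr rfl fun j _ => ?_
  split_ifs with h1 h2 h3 h2 h3 <;> simp_all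

theorem measurable_matrixDensity (N : ℝ) (A : Matrix (Fin m) (Fin n) ℝ) :
    Measurable (matrixDensity N A) := by
  have : matrixDensity N A = fun p => m * n / N
      * ∑ i, ∑ j, cellIndicator m i p.1 * cellIndicator n j p.2 * A i j :=
    funext (matrixDensity_eq N A)
  rw [this]
  fun_prop

/-- Almost every point of the unit square lies in exactly one cell of the grid. -/
theorem ae_exists_cell (hm : 0 < m) (hn : 0 < n) :
    ∀ᵐ p : unitInterval × unitInterval, ∃ i j,
      (∀ u : Fin m → ℝ, stepFunction u p.1 = u i) ∧ (∀ v : Fin n → ℝ, stepFunction v p.2 = v j) ∧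
      ∀ N A, matrixDensity (m := m) (n := n) N A p = m * n / N * A i j := by
  have h1 : ∀ᵐ p : unitInterval × unitInterval,
      ∃ i, ∀ j, cellIndicator m j p.1 = if j = i then 1 else 0 := by
    rw [Measure.volume_eq_prod]
    exact Measure.quasiMeasurePreserving_fst.ae (ae_exists_cellIndicator hm)
  have h2 : ∀ᵐ p : unitInterval × unitInterval,
      ∃ i, ∀ j, cellIndicator n j p.2 = if j = i then 1 else 0 := by
    rw [Measure.volume_eq_prod]
    exact Measure.quasiMeasurePreserving_snd.ae (ae_exists_cellIndicator hn)
  filter_upwards [h1, h2] with p ⟨i, hi⟩ ⟨j, hj⟩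
  refine ⟨i, j, fun u => by simp [stepFunction, hi], fun v => by simp [stepFunction, hj],
    fun N A => ?_⟩
  rw [matrixDensity_eq]
  simp [hi, hj]

theorem integrable_matrixDensity (N : ℝ) (A : Matrix (Fin m) (Fin n) ℝ) :
    Integrable (matrixDensity N A) := by
  refine Integrable.of_bound (measurable_matrixDensity N A).aestronglyMeasurable
    (|(m : ℝ) * n / N| * entryNorm A) (Eventually.of_forall fun p => ?_)
  rw [matrixDensity_eq, norm_mul]
  refine mul_le_mul_of_nonneg_left ((norm_sum_le _ _).trans (Finset.sum_le_sum fun i _ =>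
    (norm_sum_le _ _).trans (Finset.sum_le_sum fun j _ => ?_))) (norm_nonneg _)
  rw [norm_mul, norm_mul, Real.norm_of_nonneg (cellIndicator_nonneg _ _),
    Real.norm_of_nonneg (cellIndicator_nonneg _ _)]
  exact mul_le_of_le_one_left (norm_nonneg _) (mul_le_one₀ (cellIndicator_le_one _ _)
    (cellIndicator_nonneg _ _) (cellIndicator_le_one _ _))

theorem integrable_cell_mul {g : unitInterval × unitInterval → ℝ} (hg : Integrable g) (i : Fin m)
    (j : Fin n) :
    Integrable fun p => cellIndicator m i p.1 * cellIndicator n j p.2 * g p := by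
  refine hg.bdd_mul (c := 1) (Measurable.aestronglyMeasurable (by fun_prop))
    (Eventually.of_forall fun p => ?_)
  rw [norm_mul, Real.norm_of_nonneg (cellIndicator_nonneg _ _),
    Real.norm_of_nonneg (cellIndicator_nonneg _ _)]
  exact mul_le_one₀ (cellIndicator_le_one _ _) (cellIndicator_nonneg _ _)
    (cellIndicator_le_one _ _)

theorem integral_matrixDensity_mul (N : ℝ) (A : Matrix (Fin m) (Fin n) ℝ)
    {g : unitInterval × unitInterval → ℝ} (hg : Integrable g) :
    ∫ p, matrixDensity N A p * g p = m * n / N * ∑ i, ∑ j, A i j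
      * ∫ p, cellIndicator m i p.1 * cellIndicator n j p.2 * g p := by
  have h1 : ∀ p, matrixDensity N A p * g p = m * n / N * ∑ i, ∑ j, A i j
      * (cellIndicator m i p.1 * cellIndicator n j p.2 * g p) := by
    intro p
    rw [matrixDensity_eq, mul_assoc, Finset.sum_mul]
    congr 1
    refine Finset.sum_congr rfl fun i _ => ?_
    rw [Finset.sum_mul]
    exact Finset.sum_congr rfl fun j _ => by ring
  simp_rw [h1]
  rw [integral_const_mul, integral_finsetSum]
  · congr 1
    refine Finset.sum_congr rfl fun i _ => ?_
    rw [integral_finsetSum]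
    · simp_rw [integral_const_mul]
    · exact fun j _ => (integrable_cell_mul hg i j).const_mul _
  · exact fun i _ => integrable_finsetSum _ fun j _ => (integrable_cell_mul hg i j).const_mul _

theorem integral_cell_mul_fst (f : unitInterval → ℝ) (i : Fin m) (j : Fin n) :
    ∫ p : unitInterval × unitInterval, cellIndicator m i p.1 * cellIndicator n j p.2 * f p.1
      = (∫ x, cellIndicator m i x * f x) * (1 / n) := by
  rw [← integral_cellIndicator j, ← integral_prod_mul, ← Measure.volume_eq_prod]
  exact integral_congr_ae (Eventually.of_forall fun p => by ring)

theorem integral_cell_mul_snd (f : unitInterval → ℝ) (i : Fin m) (j : Fin n) :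
    ∫ p : unitInterval × unitInterval, cellIndicator m i p.1 * cellIndicator n j p.2 * f p.2
      = (1 / m) * ∫ x, cellIndicator n j x * f x := by
  rw [← integral_cellIndicator i, ← integral_prod_mul, ← Measure.volume_eq_prod]
  exact integral_congr_ae (Eventually.of_forall fun p => by ring)

theorem integral_cell (i : Fin m) (j : Fin n) :
    ∫ p : unitInterval × unitInterval, cellIndicator m i p.1 * cellIndicator n j p.2
      = 1 / (m * n) := by
  have := integral_cell_mul_fst (fun _ => 1) i j
  simp only [mul_one, integral_cellIndicator] at this
  rw [this]
  ring

/-- Every cell has area 1/(mn). The mass need not be one, because N is the mass of the margin and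
not of the matrix. -/
theorem integral_matrixDensity (N : ℝ) {A : Matrix (Fin m) (Fin n) ℝ} (hA : ∀ i j, 0 ≤ A i j)
    (hm : 0 < m) (hn : 0 < n) : ∫ p, matrixDensity N A p = entryNorm A / N := by
  have h := integral_matrixDensity_mul N A (g := fun _ => 1) (integrable_const _)
  simp only [mul_one, integral_cell] at h
  rw [h, entryNorm]
  simp_rw [abs_of_nonneg (hA _ _), ← Finset.sum_mul]
  have : (0 : ℝ) < m := Nat.cast_pos.2 hm
  have : (0 : ℝ) < n := Nat.cast_pos.2 hn
  field_simp

theorem integrable_cell_mul' {f : unitInterval → ℝ} {C : ℝ} (hf : Measurable f)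
    (hC : ∀ x, |f x| ≤ C) (i : Fin m) : Integrable fun x => cellIndicator m i x * f x := by
  refine Integrable.of_bound (Measurable.aestronglyMeasurable (by fun_prop)) C
    (Eventually.of_forall fun x => ?_)
  rw [norm_mul, Real.norm_of_nonneg (cellIndicator_nonneg _ _)]
  exact (mul_le_of_le_one_left (norm_nonneg _) (cellIndicator_le_one _ _)).trans (hC x)

theorem integral_marginDensity_mul {f : unitInterval → ℝ} {C : ℝ} (hf : Measurable f)
    (hC : ∀ x, |f x| ≤ C) (v : Fin m → ℝ) :
    ∫ x, marginDensity v x * f x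
      = m / (∑ i, v i) * ∑ i, v i * ∫ x, cellIndicator m i x * f x := by
  have h1 : ∀ x, marginDensity v x * f x
      = m / (∑ i, v i) * ∑ i, v i * (cellIndicator m i x * f x) := by
    intro x
    rw [marginDensity_eq, stepFunction, mul_assoc, Finset.sum_mul]
    congr 1
    exact Finset.sum_congr rfl fun i _ => by ring
  simp_rw [h1]
  rw [integral_const_mul, integral_finsetSum]
  · simp_rw [integral_const_mul]
  · exact fun i _ => (integrable_cell_mul' hf hC i).const_mul _

theorem integrable_marginDensity (v : Fin m → ℝ) : Integrable (marginDensity v) := by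
  have h1 : marginDensity v = fun x => m / (∑ i, v i) * stepFunction v x :=
    funext (marginDensity_eq v)
  rw [h1]
  refine Integrable.const_mul (Integrable.of_bound (measurable_stepFunction v).aestronglyMeasurable
    (∑ i, |v i|) (Eventually.of_forall (abs_stepFunction_le
      (Finset.sum_nonneg fun _ _ => abs_nonneg _) fun i =>
      Finset.single_le_sum (f := fun i => |v i|) (fun _ _ => abs_nonneg _)
        (Finset.mem_univ i)))) _

/-- The step functions of a scaled matrix form a scaled density. -/
theorem isScaledDensity_matrixDensity {N lo hi B : ℝ} {r : Fin m → ℝ} {c : Fin n → ℝ}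
    {Λ Z : Matrix (Fin m) (Fin n) ℝ} {α : Fin m → ℝ} {β : Fin n → ℝ} (hm : 0 < m) (hn : 0 < n)
    (hr : ∑ i, r i = N) (hc : ∑ j, c j = N) (hB : 0 ≤ B)
    (hΛ : ∀ i j, lo ≤ m * n / N * Λ i j ∧ m * n / N * Λ i j ≤ hi) (hα : ∀ i, |α i| ≤ B)
    (hβ : ∀ j, |β j| ≤ B) (hZ : ∀ i j, Z i j = Λ i j * Real.exp (α i + β j))
    (hrow : ∀ i, ∑ j, Z i j = r i) (hcol : ∀ j, ∑ i, Z i j = c j) :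
    IsScaledDensity lo hi B (matrixDensity N Λ) (matrixDensity N Z) (marginDensity r)
      (marginDensity c) (stepFunction α) (stepFunction β) := by
  have hm' : (m : ℝ) ≠ 0 := Nat.cast_ne_zero.2 hm.ne'
  have hn' : (n : ℝ) ≠ 0 := Nat.cast_ne_zero.2 hn.ne'
  refine ⟨(measurable_matrixDensity N Λ).aestronglyMeasurable, ?_, measurable_stepFunction α,
    measurable_stepFunction β, abs_stepFunction_le hB hα, abs_stepFunction_le hB hβ, ?_,
    integrable_marginDensity r, integrable_marginDensity c, ?_, ?_⟩
  · filter_upwards [ae_exists_cell (m := m) (n := n) hm hn] with p ⟨i, j, _, _, h⟩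
    rw [h]
    exact hΛ i j
  · filter_upwards [ae_exists_cell (m := m) (n := n) hm hn] with p ⟨i, j, h1, h2, h⟩
    rw [h, h, h1, h2, hZ, mul_assoc]
  · rintro f hf ⟨C, hC⟩
    have hfi : Integrable fun p : unitInterval × unitInterval => f p.1 :=
      Integrable.of_bound (hf.comp measurable_fst).aestronglyMeasurable C
        (Eventually.of_forall fun p => hC p.1)
    rw [integral_matrixDensity_mul N Z hfi, integral_marginDensity_mul hf hC, hr]
    simp_rw [integral_cell_mul_fst, ← Finset.sum_mul, hrow, ← mul_assoc, ← Finset.sum_mul]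
    field_simp
  · rintro f hf ⟨C, hC⟩
    have hfi : Integrable fun p : unitInterval × unitInterval => f p.2 :=
      Integrable.of_bound (hf.comp measurable_snd).aestronglyMeasurable C
        (Eventually.of_forall fun p => hC p.2)
    rw [integral_matrixDensity_mul N Z hfi, integral_marginDensity_mul hf hC, hc,
      Finset.sum_comm]
    simp_rw [integral_cell_mul_snd, ← Finset.sum_mul, hcol, Finset.mul_sum]
    refine Finset.sum_congr rfl fun j _ => ?_
    field_simp

/-- The average of `g` over the cell `(i, j)`. -/
noncomputable def cellAverage (m n : ℕ) (g : unitInterval × unitInterval → ℝ) (i : Fin m)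
    (j : Fin n) : ℝ :=
  m * n * ∫ p, cellIndicator m i p.1 * cellIndicator n j p.2 * g p

/-- A step function sees a test function only through its cell averages, which reduces the integral
against g to the finite sum handled by the matrix estimates. -/
theorem integral_mul_matrixDensity (N : ℝ) (A : Matrix (Fin m) (Fin n) ℝ)
    {g : unitInterval × unitInterval → ℝ} (hg : Integrable g) :
    ∫ p, g p * matrixDensity N A p = (∑ i, ∑ j, cellAverage m n g i j * A i j) / N := by
  simp_rw [mul_comm (g _)]
  rw [integral_matrixDensity_mul N A hg, Finset.mul_sum, Finset.sum_div]
  refine Finset.sum_congr rfl fun i _ => ?_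
  rw [Finset.mul_sum, Finset.sum_div]
  exact Finset.sum_congr rfl fun j _ => by rw [cellAverage]; ring

theorem abs_cellAverage_le {g : unitInterval × unitInterval → ℝ} {G : ℝ}
    (hg : AEStronglyMeasurable g) (hG : ∀ᵐ p, |g p| ≤ G) (i : Fin m) (j : Fin n) :
    |cellAverage m n g i j| ≤ G := by
  have hm : (0 : ℝ) < m := Nat.cast_pos.2 i.pos
  have hn : (0 : ℝ) < n := Nat.cast_pos.2 j.pos
  have hgi : Integrable g := Integrable.of_bound hg G hG
  have h1 : |∫ p, cellIndicator m i p.1 * cellIndicator n j p.2 * g p|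
      ≤ ∫ p : unitInterval × unitInterval, cellIndicator m i p.1 * cellIndicator n j p.2 * G := by
    refine abs_integral_le_integral_abs.trans (integral_mono_ae (integrable_cell_mul hgi i j).abs
      (integrable_cell_mul (integrable_const G) i j) ?_)
    filter_upwards [hG] with p hp
    rw [abs_mul, abs_of_nonneg (mul_nonneg (cellIndicator_nonneg _ _) (cellIndicator_nonneg _ _))]
    exact mul_le_mul_of_nonneg_left hp
      (mul_nonneg (cellIndicator_nonneg _ _) (cellIndicator_nonneg _ _))
  rw [integral_mul_const, integral_cell] at h1
  rw [cellAverage, abs_mul, abs_of_pos (by positivity)]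
  calc (m : ℝ) * n * |∫ p, cellIndicator m i p.1 * cellIndicator n j p.2 * g p|
      ≤ m * n * (1 / (m * n) * G) := mul_le_mul_of_nonneg_left h1 (by positivity)
    _ = G := by field_simp

end Cells

/-! ### Explicit deviation scales -/

/-- The admissible range of the Chernoff parameter for weights bounded by `A`. -/
noncomputable def chernoffRange (A R : ℝ) : ℝ := 1 / (2 * A * R)

/-- The deviation scale of the linear functional. -/
noncomputable def linearConst (A σ R : ℝ) : ℝ :=
  (2 + chernoffRange A R ^ 2 * (σ ^ 2 * A ^ 2)) / chernoffRange A R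

/-- The deviation scale of the row and column sums. -/
noncomputable def marginConst (A σ R D : ℝ) : ℝ :=
  (D + 10 + chernoffRange A R ^ 2 * (σ ^ 2 * A ^ 2)) / chernoffRange A R

/-- A weighted row sum fluctuates on the scale √(M log M). The hypothesis `hlarge` says that the
allowed deviation √ε δ L / M is a large multiple of this scale. -/
theorem exists_margin_chernoff_param {A σ R D δ M L : ℝ} (hA : 0 < A) (hR : 0 < R) (hD : 0 < D)
    (hδ : 0 < δ) (hM : 2 ≤ M) (hL : 0 < L)
    (hlarge : marginConst A σ R D ^ 2 * (M ^ (3 / 2 : ℝ) * √(Real.log M)) ≤ δ ^ 2 * √D * L) :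
    ∃ s, 0 ≤ s ∧ s ≤ chernoffRange A R ∧
      8 * M * Real.exp (-(s * (√(M ^ (3 / 2 : ℝ) * √(D * Real.log M) / L) * (δ * L / M)))
        + s ^ 2 * σ ^ 2 * (M * A ^ 2)) ≤ M ^ (-D) := by
  have hM0 : 0 < M := by linarith
  set s₀ := chernoffRange A R with hs₀
  have hs₀0 : 0 < s₀ := by
    rw [hs₀]
    unfold chernoffRange
    positivity
  set Θ := marginConst A σ R D with hΘ
  have hΘs : s₀ * Θ = D + 10 + s₀ ^ 2 * (σ ^ 2 * A ^ 2) := by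
    rw [hΘ, marginConst, ← hs₀, mul_div_cancel₀ _ hs₀0.ne']
  have hΘ0 : 0 < Θ := by
    have : 0 < s₀ * Θ := by rw [hΘs]; positivity
    exact pos_of_mul_pos_right this hs₀0.le
  set l := Real.log M with hl
  have hl0 : 0 < l := Real.log_pos (by linarith)
  have hlM : l ≤ M := (Real.log_le_sub_one_of_pos hM0).trans (by linarith)
  set q := M ^ (3 / 2 : ℝ) with hq
  have hq0 : 0 < q := Real.rpow_pos_of_pos hM0 _
  have hq2 : q ^ 2 = M ^ 3 := by
    rw [hq, ← Real.rpow_natCast, ← Real.rpow_mul hM0.le, ← Real.rpow_natCast]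
    norm_num
  -- After squaring this is `hlarge` multiplied by q √l / M², since q² = M³.
  have hdev : Θ * √(M * l) ≤ √(q * √(D * l) / L) * (δ * L / M) := by
    refine le_of_sq_le_sq ?_ (by positivity)
    rw [mul_pow, mul_pow, Real.sq_sqrt (by positivity), Real.sq_sqrt (by positivity),
      Real.sqrt_mul hD.le]
    have h1 : q * (√D * √l) / L * (δ * L / M) ^ 2
        = (δ ^ 2 * √D * L) * (q * √l / M ^ 2) := by
      field_simp
    have h2 : Θ ^ 2 * (M * l) = Θ ^ 2 * (q * √l) * (q * √l / M ^ 2) := by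
      have : q * √l * (q * √l / M ^ 2) = q ^ 2 * √l ^ 2 / M ^ 2 := by ring
      rw [mul_assoc, this, hq2, Real.sq_sqrt hl0.le]
      field_simp
    rw [h1, h2]
    exact mul_le_mul_of_nonneg_right hlarge (by positivity)
  -- With s proportional to √(log M / M) both the linear and the quadratic part of the exponent
  -- become multiples of log M. It stays below s₀ because log M ≤ M.
  refine ⟨s₀ * √(l / M), by positivity, mul_le_of_le_one_right hs₀0.le
    (Real.sqrt_le_one.2 ((div_le_one hM0).2 hlM)), ?_⟩
  have h3 : √(l / M) * √(M * l) = l := by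
    rw [← Real.sqrt_mul (by positivity)]
    have : l / M * (M * l) = l ^ 2 := by field_simp
    rw [this, Real.sqrt_sq hl0.le]
  have h4 : s₀ * √(l / M) * (Θ * √(M * l)) = s₀ * Θ * l := by
    linear_combination s₀ * Θ * h3
  have h5 : (s₀ * √(l / M)) ^ 2 * σ ^ 2 * (M * A ^ 2) = s₀ ^ 2 * (σ ^ 2 * A ^ 2) * l := by
    rw [mul_pow, Real.sq_sqrt (by positivity)]
    field_simp
  have h6 := mul_le_mul_of_nonneg_left hdev (by positivity : 0 ≤ s₀ * √(l / M))
  rw [h4, hΘs] at h6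
  have h7 : Real.exp (-(s₀ * √(l / M) * (√(q * √(D * l) / L) * (δ * L / M)))
        + (s₀ * √(l / M)) ^ 2 * σ ^ 2 * (M * A ^ 2)) ≤ M ^ (-D) / M ^ 10 := by
    have h8 : M ^ (-D) / M ^ 10 = Real.exp (-(D + 10) * l) := by
      rw [← Real.rpow_natCast, ← Real.rpow_sub hM0, Real.rpow_def_of_pos hM0, ← hl]
      congr 1
      push_cast
      ring
    rw [h8, h5, Real.exp_le_exp]
    linarith
  refine (mul_le_mul_of_nonneg_left h7 (by positivity)).trans ?_
  have h9 : 0 < M ^ (-D) := Real.rpow_pos_of_pos hM0 _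
  -- The summand 10 in `marginConst` provides the factor M^{-10}, which absorbs the union bound over
  -- rows and columns.
  have h10 : 8 * M ≤ M ^ 10 := by
    have : (2 : ℝ) ^ 9 ≤ M ^ 9 := pow_le_pow_left₀ (by norm_num) hM 9
    nlinarith
  rw [← mul_div_assoc, div_le_iff₀ (by positivity)]
  nlinarith

/-- The ratio in the second branch of the minimum is at most one. Thus an error e^{-√M/8} can be
charged to the row-alignment term. -/
theorem rowAlignmentRate_le_sqrt {m n : ℕ} {Λ : Matrix (Fin m) (Fin n) ℝ} {σ R : ℝ} (hm : 0 < m)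
    (hn : 0 < n) (hΛ : ∀ i j, 0 < Λ i j) (hσ : 0 < σ) (hR : 0 < R) :
    rowAlignmentRate Λ σ R ≤ √(n : ℝ) := by
  refine (min_le_right _ _).trans (mul_le_of_le_one_right (Real.sqrt_nonneg _) ?_)
  have h1 := hΛ ⟨0, hm⟩ ⟨0, hn⟩
  have h2 := minEntry_le Λ ⟨0, hm⟩ ⟨0, hn⟩
  have h3 := le_maxEntry Λ ⟨0, hm⟩ ⟨0, hn⟩
  exact div_le_one_of_le₀ (by linarith) (by linarith)

/-- A subexponential matrix is typical up to polynomially small and row-alignment errors. -/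
theorem IsSubexponentialMatrix.measure_not_isTypical_le_rpow {m n : ℕ} {Ω : Type*}
    [MeasurableSpace Ω] {P : Measure Ω} [IsProbabilityMeasure P]
    {X : Ω → Matrix (Fin m) (Fin n) ℝ} {Λ : Matrix (Fin m) (Fin n) ℝ} {σ' R' σ R : ℝ}
    (hX : IsSubexponentialMatrix P X Λ σ' R') (hσ : σ' ≤ σ) (hR : R' ≤ R) (hm : 0 < m)
    (hn : 0 < n) {w h : Fin m → Fin n → ℝ} {δ A D : ℝ} (hA : 0 < A) (hw : ∀ i j, |w i j| ≤ A)
    (hwh : ∀ i j, |w i j * h i j| ≤ A) (hδ : 0 < δ) (hD : 0 < D)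
    (hM : 2 ≤ max (m : ℝ) n) (hDM : Real.log 2 ≤ D * Real.log (max (m : ℝ) n))
    (hlarge : marginConst A σ R D ^ 2 * (max (m : ℝ) n ^ (3 / 2 : ℝ) * √(Real.log (max (m : ℝ) n)))
      ≤ δ ^ 2 * √D * entryNorm Λ) :
    P.real {ω | ¬ IsTypical δ
        √(max (m : ℝ) n ^ (3 / 2 : ℝ) * √(D * Real.log (max (m : ℝ) n)) / entryNorm Λ)
        (linearConst A σ R
          * (max (m : ℝ) n ^ (3 / 2 : ℝ) * √(D * Real.log (max (m : ℝ) n)) / entryNorm Λ))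
        Λ (X ω) w h}
      ≤ 2 * max (m : ℝ) n ^ (-D)
        + (m : ℝ) ^ 2 * Real.exp (-(1 / 8) * rowAlignmentRate Λ σ' R') := by
  have : Nonempty (Fin m) := ⟨⟨0, hm⟩⟩
  have : Nonempty (Fin n) := ⟨⟨0, hn⟩⟩
  have hL := entryNorm_pos hX.mean_pos
  set M := max (m : ℝ) n with hMdef
  set L := entryNorm Λ with hLdef
  have hM0 : 0 < M := by linarith
  have hmM : (m : ℝ) ≤ M := le_max_left _ _
  have hnM : (n : ℝ) ≤ M := le_max_right _ _
  have hR0 : 0 < R := hX.R_pos.trans_le hR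
  set s₀ := chernoffRange A R with hs₀
  have hs₀0 : 0 < s₀ := by
    rw [hs₀]
    unfold chernoffRange
    positivity
  -- The Chernoff parameters are chosen for the uniform bounds σ and R. They remain admissible for
  -- the smaller σ' and R'.
  have hrange : ∀ s, 0 ≤ s → s ≤ s₀ → s * A * R' ≤ 1 / 2 := by
    intro s hs hss
    have h1 : s * A * R' ≤ s₀ * A * R := by
      have := hX.R_pos
      gcongr
    refine h1.trans (le_of_eq ?_)
    rw [hs₀, chernoffRange]
    field_simp
  have hσ2 : σ' ^ 2 ≤ σ ^ 2 := pow_le_pow_left₀ hX.sigma_pos.le hσ 2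
  obtain ⟨s₁, hs₁, hs₁', h₁⟩ := exists_margin_chernoff_param (σ := σ) hA hR0 hD hδ hM hL hlarge
  obtain ⟨s₂, hs₂, hs₂', h₂⟩ := exists_linear_chernoff_param (M := M)
    (x := D * Real.log M) (s₀ := s₀) (V := σ ^ 2 * A ^ 2) (C₁ := linearConst A σ R)
    (by linarith) hDM hs₀0 (by positivity)
    (by rw [linearConst, ← hs₀, mul_div_cancel₀ _ hs₀0.ne'])
  refine (hX.measure_not_isTypical_le hm hn hw hwh hs₁ hs₂ (hrange s₁ hs₁ hs₁')
    (hrange s₂ hs₂ hs₂') hmM hnM (Real.sqrt_nonneg _) hδ.le).trans ?_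
  have e1 : Real.exp (-(s₁ * (√(M ^ (3 / 2 : ℝ) * √(D * Real.log M) / L) * (δ * L / M)))
        + s₁ ^ 2 * σ' ^ 2 * (M * A ^ 2))
      ≤ Real.exp (-(s₁ * (√(M ^ (3 / 2 : ℝ) * √(D * Real.log M) / L) * (δ * L / M)))
        + s₁ ^ 2 * σ ^ 2 * (M * A ^ 2)) := by
    gcongr
  have e2 : Real.exp (-(s₂ * (linearConst A σ R
          * (M ^ (3 / 2 : ℝ) * √(D * Real.log M) / L) * L))
        + s₂ ^ 2 * σ' ^ 2 * (m * n * A ^ 2))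
      ≤ Real.exp (-(s₂ * (linearConst A σ R * (M ^ (3 / 2 : ℝ) * √(D * Real.log M))))
        + s₂ ^ 2 * (σ ^ 2 * A ^ 2) * M ^ 2) := by
    rw [mul_assoc (linearConst A σ R), div_mul_cancel₀ _ hL.ne', Real.exp_le_exp]
    refine add_le_add le_rfl ?_
    calc s₂ ^ 2 * σ' ^ 2 * (m * n * A ^ 2) ≤ s₂ ^ 2 * σ ^ 2 * (M * M * A ^ 2) := by gcongr
      _ = _ := by ring
  have e3 : Real.exp (-(D * Real.log M)) = M ^ (-D) := by
    rw [Real.rpow_def_of_pos hM0]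
    congr 1
    ring
  -- The union bound over pairs of distinct rows uses only m² - m copies of the alignment term. The
  -- m unused copies absorb the leftover of the linear functional.
  have e4 : Real.exp (-(√M / 8)) ≤ m * Real.exp (-(1 / 8) * rowAlignmentRate Λ σ' R') := by
    have h3 := rowAlignmentRate_le_sqrt hm hn hX.mean_pos hX.sigma_pos hX.R_pos
    have h4 := Real.sqrt_le_sqrt hnM
    have h5 : Real.exp (-(√M / 8)) ≤ Real.exp (-(1 / 8) * rowAlignmentRate Λ σ' R') :=
      Real.exp_le_exp.2 (by linarith)
    have h6 : (1 : ℝ) ≤ m := by exact_mod_cast hm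
    exact h5.trans (le_mul_of_one_le_left (Real.exp_pos _).le h6)
  rw [e3] at h₂
  have e5 := mul_le_mul_of_nonneg_left e1 (by positivity : 0 ≤ 8 * M)
  linarith

/-! ### Convergence of the scaled mean densities -/

/-- A lower bound for the kernel densities. -/
noncomputable def kernelLower (K δ : ℝ) : ℝ := δ ^ 2 * Real.exp (-K) / 2

/-- An upper bound for the kernel densities. -/
noncomputable def kernelUpper (K δ : ℝ) : ℝ := 2 * Real.exp K / δ ^ 2

theorem kernelLower_pos {K δ : ℝ} (hδ : 0 < δ) : 0 < kernelLower K δ := by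
  unfold kernelLower
  positivity

theorem kernelUpper_pos {K δ : ℝ} (hδ : 0 < δ) : 0 < kernelUpper K δ := by
  unfold kernelUpper
  positivity

/-- Bounded cost replaces Λ by r c L / N² up to e^{±K}. Smoothness of the margins gives δ^{±2}, and
L / N ∈ [1/2, 2] gives the factors of 2. -/
theorem HasBoundedCost.kernel_bounds {m n : ℕ} {K δ : ℝ} {r : Fin m → ℝ} {c : Fin n → ℝ}
    {Λ : Matrix (Fin m) (Fin n) ℝ} (hK : HasBoundedCost K r c Λ) (hs : IsSmoothMargin δ r c)
    (hδ : 0 < δ) (hΛ : ∀ i j, 0 < Λ i j) (h1 : 1 / 2 ≤ entryNorm Λ / ∑ i, r i)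
    (h2 : entryNorm Λ / ∑ i, r i ≤ 2) (i : Fin m) (j : Fin n) :
    kernelLower K δ ≤ m * n / (∑ i, r i) * Λ i j ∧
      m * n / (∑ i, r i) * Λ i j ≤ kernelUpper K δ := by
  have := hs.nonempty_left
  have := hs.nonempty_right
  have hm := hs.left_pos
  have hn := hs.right_pos
  have hN := hs.mass_pos
  have hL := entryNorm_pos hΛ
  obtain ⟨e1, e2⟩ := hK.bounds (hs.row_pos hδ) (hs.col_pos hδ) hΛ hL hN i j
  have hr := hs.row_bounds i
  have hc := hs.col_bounds j
  have hri := hs.row_pos hδ i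
  have hcj := hs.col_pos hδ j
  set N := ∑ i, r i with hNdef
  set L := entryNorm Λ with hLdef
  rw [le_div_iff₀ hN] at h1
  rw [div_le_iff₀ hN] at h2
  have hΛij := hΛ i j
  unfold kernelLower kernelUpper
  constructor
  · have h3 : δ * N / m * (δ * N / n) * L ≤ Real.exp K * (Λ i j * N ^ 2) := by
      refine le_trans ?_ e2
      gcongr
      · exact hr.1
      · exact hc.1
    have h4 : δ * N / m * (δ * N / n) * (1 / 2 * N) ≤ Real.exp K * (Λ i j * N ^ 2) :=
      le_trans (by gcongr) h3
    rw [Real.exp_neg]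
    have h5 : δ * N / m * (δ * N / n) * (1 / 2 * N)
        = δ ^ 2 * (Real.exp K)⁻¹ / 2 * (Real.exp K * N ^ 3 / (m * n)) := by
      field_simp
    have h6 : Real.exp K * (Λ i j * N ^ 2)
        = m * n / N * Λ i j * (Real.exp K * N ^ 3 / (m * n)) := by
      field_simp
    rw [h5, h6] at h4
    exact le_of_mul_le_mul_right h4 (by positivity)
  · have h3 : Λ i j * N ^ 2 ≤ Real.exp K * (N / (δ * m) * (N / (δ * n)) * (2 * N)) := by
      refine e1.trans ?_
      gcongr
      · exact hr.2
      · exact hc.2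
    have h5 : Real.exp K * (N / (δ * m) * (N / (δ * n)) * (2 * N))
        = 2 * Real.exp K / δ ^ 2 * (N ^ 3 / (m * n)) := by
      field_simp
    have h6 : Λ i j * N ^ 2 = m * n / N * Λ i j * (N ^ 3 / (m * n)) := by
      field_simp
    rw [h5, h6] at h3
    exact le_of_mul_le_mul_right h3 (by positivity)

/-- The column potentials lie within 2K of log(N / L), which is at most 1 in absolute value since L
/ N ∈ [1/2, 2]. Hence the bound 2K + 1. -/
theorem IsPotentialPair.isScaledDensity {m n : ℕ} {K δ : ℝ} {r : Fin m → ℝ} {c : Fin n → ℝ}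
    {Λ : Matrix (Fin m) (Fin n) ℝ} {α : Fin m → ℝ} {β : Fin n → ℝ}
    (h : IsPotentialPair K r c Λ α β) (hK0 : 0 ≤ K) (hK : HasBoundedCost K r c Λ)
    (hs : IsSmoothMargin δ r c) (hδ : 0 < δ) (hΛ : ∀ i j, 0 < Λ i j)
    (h1 : 1 / 2 ≤ entryNorm Λ / ∑ i, r i) (h2 : entryNorm Λ / ∑ i, r i ≤ 2) :
    IsScaledDensity (kernelLower K δ) (kernelUpper K δ) (2 * K + 1)
      (matrixDensity (∑ i, r i) Λ)
      (matrixDensity (∑ i, r i) (fun i j => Λ i j * Real.exp (α i + β j)))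
      (marginDensity r) (marginDensity c) (stepFunction α) (stepFunction β) := by
  have := hs.nonempty_left
  have := hs.nonempty_right
  have hN := hs.mass_pos
  have hL := entryNorm_pos hΛ
  refine isScaledDensity_matrixDensity (Nat.cast_pos.1 hs.left_pos) (Nat.cast_pos.1 hs.right_pos)
    rfl hs.mass_eq.symm (by linarith) (hK.kernel_bounds hs hδ hΛ h1 h2)
    (fun i => (h.left_le i).trans (by linarith)) (fun j => ?_) (fun _ _ => rfl) h.row h.col
  have h3 := abs_le.1 (h.right_le j)
  have h4 : Real.log ((∑ i, r i) / entryNorm Λ) = -Real.log (entryNorm Λ / ∑ i, r i) := by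
    rw [← Real.log_inv, inv_div]
  have h5 : Real.log (entryNorm Λ / ∑ i, r i) ≤ 1 :=
    (Real.log_le_sub_one_of_pos (div_pos hL hN)).trans (by linarith)
  have h6 : -1 ≤ Real.log (entryNorm Λ / ∑ i, r i) := by
    have := Real.one_sub_inv_le_log_of_pos (div_pos hL hN)
    have h7 : (entryNorm Λ / ∑ i, r i)⁻¹ ≤ (1 / 2)⁻¹ := inv_anti₀ (by norm_num) h1
    rw [inv_div (1 : ℝ) 2, div_one] at h7
    linarith
  rw [abs_le]
  constructor <;> linarith

namespace MarginKernelConvergence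

variable {K δ : ℝ} {m n : ℕ → ℕ} {r : ∀ k, Fin (m k) → ℝ} {c : ∀ k, Fin (n k) → ℝ}
  {Λ : ∀ k, Matrix (Fin (m k)) (Fin (n k)) ℝ} {ρr ρc : unitInterval → ℝ}
  {φ : unitInterval × unitInterval → ℝ}

/-- L / N is the integral of the kernel density, and the limiting density has integral one. -/
theorem tendsto_entryNorm_div (h : MarginKernelConvergence K δ r c Λ ρr ρc φ)
    (hΛ : ∀ k i j, 0 < Λ k i j) :
    Tendsto (fun k => entryNorm (Λ k) / ∑ i, r k i) atTop (𝓝 1) := by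
  refine tendsto_iff_dist_tendsto_zero.2 (squeeze_zero (fun _ => dist_nonneg) (fun k => ?_)
    h.kernel_tendsto)
  have hi := integrable_matrixDensity (∑ i, r k i) (Λ k)
  rw [Real.dist_eq, ← h.kernel_density.integral_eq, ← integral_matrixDensity (∑ i, r k i)
    (fun i j => (hΛ k i j).le) (Nat.cast_pos.1 (h.smooth k).left_pos)
    (Nat.cast_pos.1 (h.smooth k).right_pos), ← integral_sub hi h.kernel_density.integrable]
  exact abs_integral_le_integral_abs

theorem eventually_entryNorm_div (h : MarginKernelConvergence K δ r c Λ ρr ρc φ)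
    (hΛ : ∀ k i j, 0 < Λ k i j) :
    ∀ᶠ k in atTop, HasBoundedCost K (r k) (c k) (Λ k) ∧
      1 / 2 ≤ entryNorm (Λ k) / ∑ i, r k i ∧ entryNorm (Λ k) / ∑ i, r k i ≤ 2 := by
  have h1 := h.tendsto_entryNorm_div hΛ
  exact h.cost.and ((h1.eventually (le_mem_nhds (by norm_num))).and
    (h1.eventually (ge_mem_nhds (by norm_num))))

/-- The limiting kernel has a scaling to the limiting marginals, with bounded potentials. -/
theorem exists_isScaledDensity (h : MarginKernelConvergence K δ r c Λ ρr ρc φ)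
    (hK0 : 0 ≤ K) (hδ : 0 < δ) (hΛ : ∀ k i j, 0 < Λ k i j) :
    ∃ W a b, IsScaledDensity (kernelLower K δ) (kernelUpper K δ) (4 * (2 * K + 1)) φ W ρr ρc a
      b := by
  -- The cost and mass bounds hold only from some index on, so the sequence is shifted by that
  -- index.
  obtain ⟨k₀, hk₀⟩ := eventually_atTop.1 (h.eventually_entryNorm_div hΛ)
  have hex : ∀ k, ∃ (α : Fin (m (k + k₀)) → ℝ) (β : Fin (n (k + k₀)) → ℝ),
      IsPotentialPair K (r (k + k₀)) (c (k + k₀)) (Λ (k + k₀)) α β := fun k =>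
    exists_isPotentialPair (h.smooth _) hδ (hk₀ _ (Nat.le_add_left _ _)).1 (hΛ _)
  choose α β hαβ using hex
  exact IsScaledDensity.exists_limit (fun k => (hαβ k).isScaledDensity hK0
      (hk₀ _ (Nat.le_add_left _ _)).1 (h.smooth _) hδ (hΛ _) (hk₀ _ (Nat.le_add_left _ _)).2.1
      (hk₀ _ (Nat.le_add_left _ _)).2.2)
    (kernelLower_pos hδ) h.kernel_density.integrable h.row_density.integrable
    h.col_density.integrable (h.kernel_tendsto.comp (tendsto_add_atTop_nat k₀))
    (h.row_tendsto.comp (tendsto_add_atTop_nat k₀))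
    (h.col_tendsto.comp (tendsto_add_atTop_nat k₀))

end MarginKernelConvergence

/-! ### Assembly of the error bound -/

/-- The constant of the final error bound. -/
noncomputable def bridgeConst (K δ G σ R : ℝ) : ℝ :=
  linearConst (Real.exp (3 * K) * (1 + projectionConst K G)) σ R
    + (2 * potentialConst K δ + 8 * projectionConst K G * potentialConst K δ ^ 2)
    + G * stabilityConst (kernelLower K δ) (kernelUpper K δ) (4 * (2 * K + 1))

/-- The scaled mean Z is inserted between the scaled sample Z' and the limit. The first difference
is a finite sum against cell averages, the second is bounded in L¹. -/
theorem integral_mul_sub_le {m n : ℕ} {N G E₁ E₂ : ℝ} (hN : 0 < N)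
    {Z Z' : Matrix (Fin m) (Fin n) ℝ} {W W' g : unitInterval × unitInterval → ℝ}
    (hg : AEStronglyMeasurable g) (hG : ∀ᵐ p, |g p| ≤ G) (hW : Integrable W)
    (hWW' : W' =ᵐ[volume] W)
    (h1 : |∑ i, ∑ j, cellAverage m n g i j * (Z' i j - Z i j)| ≤ E₁ * N)
    (h2 : ∫ p, |matrixDensity N Z p - W p| ≤ E₂) (hG0 : 0 ≤ G) :
    |∫ p, g p * (matrixDensity N Z' p - W' p)| ≤ E₁ + G * E₂ := by
  have hgi : ∀ V, Integrable V → Integrable fun p => g p * V p := fun V hV =>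
    hV.bdd_mul (c := G) hg hG
  have hZi := integrable_matrixDensity N Z
  have hZi' := integrable_matrixDensity N Z'
  have e1 : ∫ p, g p * (matrixDensity N Z' p - W' p)
      = ((∫ p, g p * matrixDensity N Z' p) - ∫ p, g p * matrixDensity N Z p)
        + ∫ p, g p * (matrixDensity N Z p - W p) := by
    have hd : Integrable fun p => g p * matrixDensity N Z' p - g p * matrixDensity N Z p :=
      (hgi _ hZi').sub (hgi _ hZi)
    have hd' : Integrable fun p => g p * (matrixDensity N Z p - W p) := hgi _ (hZi.sub hW)
    rw [← integral_sub (hgi _ hZi') (hgi _ hZi), ← integral_add hd hd']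
    refine integral_congr_ae ?_
    filter_upwards [hWW'] with p hp
    rw [hp]
    ring
  have e2 : (∫ p, g p * matrixDensity N Z' p) - ∫ p, g p * matrixDensity N Z p
      = (∑ i, ∑ j, cellAverage m n g i j * (Z' i j - Z i j)) / N := by
    have hgi : Integrable g := Integrable.of_bound hg G hG
    rw [integral_mul_matrixDensity N Z' hgi, integral_mul_matrixDensity N Z hgi, ← sub_div]
    simp only [mul_sub, Finset.sum_sub_distrib]
  have e3 : |∫ p, g p * (matrixDensity N Z p - W p)| ≤ G * E₂ := by
    refine le_trans ?_ (mul_le_mul_of_nonneg_left h2 hG0)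
    rw [← integral_const_mul]
    refine abs_integral_le_integral_abs.trans (integral_mono_ae (hgi _ (hZi.sub hW)).abs
      ((hZi.sub hW).abs.const_mul _) ?_)
    filter_upwards [hG] with p hp
    rw [abs_mul]
    exact mul_le_mul_of_nonneg_right hp (abs_nonneg _)
  rw [e1, e2]
  refine (abs_add_le _ _).trans (add_le_add ?_ e3)
  rw [abs_div, abs_of_pos hN, div_le_iff₀ hN]
  exact h1

theorem linearConst_pos {A σ R : ℝ} (hA : 0 < A) (hR : 0 < R) : 0 < linearConst A σ R := by
  unfold linearConst chernoffRange
  positivity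

theorem potentialConst_pos {K δ : ℝ} (hδ : 0 < δ) : 0 < potentialConst K δ := by
  have := alignConst_pos (K := K) hδ
  unfold potentialConst
  positivity

theorem projectionConst_nonneg {K G : ℝ} (hG : 0 ≤ G) : 0 ≤ projectionConst K G := by
  unfold projectionConst
  positivity

theorem stabilityConst_nonneg {lo hi B : ℝ} : 0 ≤ stabilityConst lo hi B := by
  unfold stabilityConst
  positivity

theorem bridgeConst_pos {K δ G σ R : ℝ} (hδ : 0 < δ) (hG : 0 ≤ G) (hR : 0 < R) :
    0 < bridgeConst K δ G σ R := by
  have h1 := potentialConst_pos (K := K) hδ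
  have h2 := projectionConst_nonneg (K := K) hG
  have h3 := linearConst_pos (σ := σ) (A := Real.exp (3 * K) * (1 + projectionConst K G))
    (by positivity) hR
  have h4 := stabilityConst_nonneg (lo := kernelLower K δ) (hi := kernelUpper K δ)
    (B := 4 * (2 * K + 1))
  unfold bridgeConst
  positivity

/-- A subexponential random matrix is scalable, with scaling close to the limit `W`, with high probability. -/
theorem IsSubexponentialMatrix.le_measure_scaling {m n : ℕ} {Ω : Type*}
    [MeasurableSpace Ω] {P : Measure Ω} [IsProbabilityMeasure P]
    {X : Ω → Matrix (Fin m) (Fin n) ℝ} {Λ : Matrix (Fin m) (Fin n) ℝ} {σ' R' σ R K δ G D : ℝ}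
    {r : Fin m → ℝ} {c : Fin n → ℝ} {ρr ρc a b : unitInterval → ℝ}
    {φ W W' g : unitInterval × unitInterval → ℝ}
    (hX : IsSubexponentialMatrix P X Λ σ' R') (hσ : σ' ≤ σ) (hR : R' ≤ R)
    (hs : IsSmoothMargin δ r c) (hK0 : 0 ≤ K) (hδ : 0 < δ) (hK : HasBoundedCost K r c Λ)
    (hN₁ : 1 / 2 ≤ entryNorm Λ / ∑ i, r i) (hN₂ : entryNorm Λ / ∑ i, r i ≤ 2)
    (hW : IsScaledDensity (kernelLower K δ) (kernelUpper K δ) (4 * (2 * K + 1)) φ W ρr ρc a b)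
    (hWW' : W' =ᵐ[volume] W) (hg : AEStronglyMeasurable g) (hG0 : 0 ≤ G)
    (hG : ∀ᵐ p, |g p| ≤ G) (hD : 0 < D)
    (hM : 2 ≤ max (m : ℝ) n) (hDM : Real.log 2 ≤ D * Real.log (max (m : ℝ) n))
    (hlarge : marginConst (Real.exp (3 * K) * (1 + projectionConst K G)) σ R D ^ 2
      * (max (m : ℝ) n ^ (3 / 2 : ℝ) * √(Real.log (max (m : ℝ) n))) ≤ δ ^ 2 * √D * entryNorm Λ)
    (hsmall : potentialConst K δ
      * √(max (m : ℝ) n ^ (3 / 2 : ℝ) * √(D * Real.log (max (m : ℝ) n)) / entryNorm Λ) ≤ 1 / 2) :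
    1 - 2 * max (m : ℝ) n ^ (-D)
        - (m : ℝ) ^ 2 * Real.exp (-(1 / 8) * rowAlignmentRate Λ σ' R')
      ≤ P.real {ω | X ω ∈ scalableSet r c ∧
          |∫ p, g p * (matrixDensity (∑ i, r i) (sinkhornRescale r c (X ω)) p - W' p)|
            ≤ bridgeConst K δ G σ R
              * (max (m : ℝ) n ^ (3 / 2 : ℝ) * √(D * Real.log (max (m : ℝ) n)) / entryNorm Λ
                + √(l1Dist ρr (marginDensity r) + l1Dist ρc (marginDensity c))
                + hellingerDist (matrixDensity (∑ i, r i) Λ) φ)} := by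
  have := hs.nonempty_left
  have := hs.nonempty_right
  have hΛ := hX.mean_pos
  have hL := entryNorm_pos hΛ
  have hN := hs.mass_pos
  have hR0 : 0 < R := hX.R_pos.trans_le hR
  set ε := max (m : ℝ) n ^ (3 / 2 : ℝ) * √(D * Real.log (max (m : ℝ) n)) / entryNorm Λ with hε
  have hε0 : 0 ≤ ε := by positivity
  have hproj := projectionConst_nonneg (K := K) hG0
  -- One bound for both families of weights: e^{3K} for w, and e^{3K} times the projection bound for
  -- w h.
  set A := Real.exp (3 * K) * (1 + projectionConst K G) with hAdef
  have hA0 : 0 < A := by positivity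
  obtain ⟨α, β, hp⟩ := exists_isPotentialPair hs hδ hK hΛ
  obtain ⟨p, q, horow, hocol, hpq⟩ := hp.exists_projection hs hδ hK hΛ hG0
    (g := cellAverage m n g) (fun i j => abs_cellAverage_le hg hG i j)
  have hw : ∀ i j, |entryNorm Λ / (∑ i, r i) * Real.exp (α i + β j)| ≤ Real.exp (3 * K) := by
    intro i j
    rw [abs_of_pos (mul_pos (div_pos hL hN) (Real.exp_pos _))]
    exact (hp.exp_bounds hL hN i j).2
  have hprob := hX.measure_not_isTypical_le_rpow hσ hR (Nat.cast_pos.1 hs.left_pos)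
    (Nat.cast_pos.1 hs.right_pos) (w := fun i j => entryNorm Λ / (∑ i, r i) * Real.exp (α i + β j))
    (h := fun i j => cellAverage m n g i j - p i - q j) hA0
    (fun i j => (hw i j).trans (le_mul_of_one_le_right (Real.exp_pos _).le (by linarith)))
    (fun i j => by
      rw [abs_mul]
      exact mul_le_mul (hw i j) ((hpq i j).trans (by linarith)) (abs_nonneg _)
        (Real.exp_pos _).le) hδ hD hM hDM hlarge
  rw [← hε] at hprob
  -- The limit potentials carry the bound 4(2K + 1), so the potentials of the mean are relaxed to it
  -- before stability is applied.
  have hstab := (hp.isScaledDensity hK0 hK hs hδ hΛ hN₁ hN₂).mono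
      (by linarith : 2 * K + 1 ≤ 4 * (2 * K + 1))
    |>.integral_abs_sub_le hW (kernelLower_pos hδ) (kernelUpper_pos hδ).le (by linarith)
  rw [l1Dist_comm _ ρr, l1Dist_comm _ ρc] at hstab
  set E := √(l1Dist ρr (marginDensity r) + l1Dist ρc (marginDensity c))
    + hellingerDist (matrixDensity (∑ i, r i) Λ) φ with hE
  have hE0 : 0 ≤ E := add_nonneg (Real.sqrt_nonneg _) (Real.sqrt_nonneg _)
  set S := stabilityConst (kernelLower K δ) (kernelUpper K δ) (4 * (2 * K + 1)) with hS
  have hS0 : 0 ≤ S := stabilityConst_nonneg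
  set C₁ := linearConst A σ R with hC₁
  have hC₁0 : 0 < C₁ := linearConst_pos hA0 hR0
  set C₂ := 2 * potentialConst K δ + 8 * projectionConst K G * potentialConst K δ ^ 2 with hC₂
  have hC₂0 : 0 < C₂ := by
    have := potentialConst_pos (K := K) hδ
    positivity
  have hgood : ∀ ω, IsTypical δ √ε (C₁ * ε) Λ (X ω)
        (fun i j => entryNorm Λ / (∑ i, r i) * Real.exp (α i + β j))
        (fun i j => cellAverage m n g i j - p i - q j) →
      X ω ∈ scalableSet r c ∧
        |∫ p, g p * (matrixDensity (∑ i, r i) (sinkhornRescale r c (X ω)) p - W' p)|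
          ≤ bridgeConst K δ G σ R * (ε + E) := by
    intro ω hω
    obtain ⟨h1, h2⟩ := hp.scaling_of_isTypical hs hδ hK0 hK hΛ hG0 horow hocol hpq
      (Real.sqrt_nonneg ε) hsmall hω
    refine ⟨h1, ?_⟩
    -- Margins are controlled only at the scale √ε. The second-order expansion squares this to ε.
    rw [Real.sq_sqrt hε0] at h2
    refine (integral_mul_sub_le hN hg hG (hW.integrable (kernelLower_pos hδ)) hWW' h2 hstab
      hG0).trans ?_
    have h3 : bridgeConst K δ G σ R = C₁ + C₂ + G * S := rfl
    rw [h3]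
    nlinarith [mul_nonneg (add_nonneg hC₁0.le hC₂0.le) hE0,
      mul_nonneg (mul_nonneg hG0 hS0) hε0]
  simp_rw [add_assoc ε]
  rw [← hE]
  set T := {ω | ¬ IsTypical δ √ε (C₁ * ε) Λ (X ω)
        (fun i j => entryNorm Λ / (∑ i, r i) * Real.exp (α i + β j))
        (fun i j => cellAverage m n g i j - p i - q j)} with hT
  set S' := {ω | X ω ∈ scalableSet r c ∧
        |∫ p, g p * (matrixDensity (∑ i, r i) (sinkhornRescale r c (X ω)) p - W' p)|
          ≤ bridgeConst K δ G σ R * (ε + E)} with hS'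
  have hcover : (Set.univ : Set Ω) ⊆ S' ∪ T := by
    intro ω _
    by_cases hω : ω ∈ T
    · exact Or.inr hω
    · exact Or.inl (hgood ω (not_not.1 hω))
  have h1 : P.real Set.univ ≤ P.real S' + P.real T :=
    (measureReal_mono hcover).trans (measureReal_union_le _ _)
  rw [probReal_univ] at h1
  linarith

theorem eventually_mul_le_of_isLittleO {f g : ℕ → ℝ} (h : f =o[atTop] g) (hg : ∀ k, 0 < g k)
    {B₁ B₂ : ℝ} (hB₁ : 0 ≤ B₁) (hB₂ : 0 < B₂) : ∀ᶠ k in atTop, B₁ * f k ≤ B₂ * g k := by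
  -- The denominator is B₁ + 1 because B₁ may vanish.
  filter_upwards [h.bound (div_pos hB₂ (by linarith : 0 < B₁ + 1))] with k hk
  rw [Real.norm_of_nonneg (hg k).le] at hk
  have h1 := (le_abs_self (f k)).trans hk
  calc B₁ * f k ≤ B₁ * (B₂ / (B₁ + 1) * g k) := mul_le_mul_of_nonneg_left h1 hB₁
    _ = B₁ / (B₁ + 1) * (B₂ * g k) := by ring
    _ ≤ B₂ * g k := mul_le_of_le_one_left (mul_nonneg hB₂.le (hg k).le)
        (div_le_one_of_le₀ (by linarith) (by linarith))

theorem mainTheorem1 :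
    ∃ c₀ : ℝ, 0 < c₀ ∧
    ∀ K δ G σ R : ℝ, 0 ≤ K → 0 < δ → 0 ≤ G → 0 < σ → 0 < R →
    ∃ C : ℝ, 0 < C ∧
    ∀ (m n : ℕ → ℕ) (r : ∀ k, Fin (m k) → ℝ) (c : ∀ k, Fin (n k) → ℝ)
      (Λ : ∀ k, Matrix (Fin (m k)) (Fin (n k)) ℝ)
      (ρr ρc : unitInterval → ℝ) (φ : unitInterval × unitInterval → ℝ)
      (Ω : ℕ → Type*) [∀ k, MeasurableSpace (Ω k)]
      (P : ∀ k, Measure (Ω k)) [∀ k, IsProbabilityMeasure (P k)]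
      (X : ∀ k, Ω k → Matrix (Fin (m k)) (Fin (n k)) ℝ)
      (σs Rs : ℕ → ℝ) (γ : ℝ),
    MarginKernelConvergence K δ r c Λ ρr ρc φ →
    (∀ k, IsSubexponentialMatrix (P k) (X k) (Λ k) (σs k) (Rs k)) →
    (∀ k, σs k ≤ σ) → (∀ k, Rs k ≤ R) →
    0 < γ →
    γ ≤ liminf (fun k => min ((m k : ℝ) / n k) ((n k : ℝ) / m k)) atTop →
    ((fun k => (max (m k) (n k) : ℝ) ^ (3 / 2 : ℝ) * √(Real.log (max (m k) (n k) : ℝ)))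
      =o[atTop] (fun k => entryNorm (Λ k))) →
    (∃! π, IsSchrodingerBridge (densityMeasure ρr) (densityMeasure ρc) (densityMeasure φ) π) ∧
    limitBridge ρr ρc φ ≪ volume ∧
    ∀ D : ℝ, 0 < D →
    ∀ g : unitInterval × unitInterval → ℝ, MemLp g ⊤ volume →
      (eLpNorm g ⊤ volume).toReal ≤ G →
    ∀ᶠ k in atTop,
      1 - 2 * (max (m k) (n k) : ℝ) ^ (-D)
        - (m k : ℝ) ^ 2 * Real.exp (-c₀ * rowAlignmentRate (Λ k) (σs k) (Rs k))
        - 2 * Real.exp (-(entryNorm (Λ k) ^ 2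
            / (2 * (m k * n k * σ ^ 2 + R * entryNorm (Λ k)))))
      ≤ (P k).real {ω | X k ω ∈ scalableSet (r k) (c k) ∧
          |∫ p, g p * (matrixDensity (∑ i, r k i) (sinkhornRescale (r k) (c k) (X k ω)) p
              - limitBridgeDensity ρr ρc φ p)|
            ≤ C * ((max (m k) (n k) : ℝ) ^ (3 / 2 : ℝ)
                  * √(D * Real.log (max (m k) (n k) : ℝ)) / entryNorm (Λ k)
                + √(l1Dist ρr (marginDensity (r k)) + l1Dist ρc (marginDensity (c k)))
                + hellingerDist (matrixDensity (∑ i, r k i) (Λ k)) φ)} := by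
  -- The absolute constant is that of the row-alignment bound.
  refine ⟨1 / 8, by norm_num, fun K δ G σ R hK0 hδ hG hσ hR =>
    ⟨bridgeConst K δ G σ R, bridgeConst_pos hδ hG hR, ?_⟩⟩
  intro m n r c Λ ρr ρc φ Ω _ P _ X σs Rs γ hconv hX hσs hRs _ _ hlo
  have hΛ : ∀ k i j, 0 < Λ k i j := fun k => (hX k).mean_pos
  have hφ := hconv.kernel_density
  have hρr := hconv.row_density
  have hρc := hconv.col_density
  obtain ⟨W, a, b, hW⟩ := hconv.exists_isScaledDensity hK0 hδ hΛ
  have hbridge := hW.isSchrodingerBridge_iff (kernelLower_pos hδ) hφ hρr hρc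
  refine ⟨⟨densityMeasure W, (hbridge _).2 rfl, fun π hπ => (hbridge π).1 hπ⟩, ?_, ?_⟩
  · rw [hW.limitBridge_eq (kernelLower_pos hδ) hφ hρr hρc]
    exact withDensity_absolutelyContinuous _ _
  intro D hD g hg hgG
  have hgb : ∀ᵐ p, |g p| ≤ G := by
    filter_upwards [ae_le_eLpNormEssSup (f := g) (μ := volume)] with p hp
    rw [← eLpNorm_exponent_top] at hp
    refine le_trans ?_ hgG
    rw [← Real.norm_eq_abs, ← toReal_enorm]
    exact ENNReal.toReal_mono hg.eLpNorm_ne_top hp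
  have hL : ∀ k, 0 < entryNorm (Λ k) := fun k => by
    have := (hconv.smooth k).nonempty_left
    have := (hconv.smooth k).nonempty_right
    exact entryNorm_pos (hΛ k)
  have hpot := potentialConst_pos (K := K) hδ
  filter_upwards [hconv.eventually_entryNorm_div hΛ,
    eventually_mul_le_of_isLittleO hlo hL (sq_nonneg
      (marginConst (Real.exp (3 * K) * (1 + projectionConst K G)) σ R D))
      (by positivity : 0 < δ ^ 2 * √D),
    eventually_mul_le_of_isLittleO hlo hL (Real.sqrt_nonneg D)
      (by positivity : 0 < (1 / (2 * potentialConst K δ)) ^ 2)] with k hk hlarge hsmall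
  have hm : (1 : ℝ) ≤ m k := by exact_mod_cast Nat.cast_pos.1 (hconv.smooth k).left_pos
  have hM1 : (1 : ℝ) ≤ max (m k : ℝ) (n k) := hm.trans (le_max_left _ _)
  rcases lt_or_ge (D * Real.log (max (m k : ℝ) (n k))) (Real.log 2) with hDM | hDM
  -- If D log M < log 2, then M^{-D} > 1/2 and the claimed lower bound on the probability is
  -- negative.
  · refine le_trans ?_ measureReal_nonneg
    have h1 : 1 / 2 < max (m k : ℝ) (n k) ^ (-D) := by
      rw [Real.rpow_def_of_pos (by linarith), ← Real.log_lt_iff_lt_exp (by norm_num), one_div,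
        Real.log_inv]
      linarith
    have h2 : 0 ≤ (m k : ℝ) ^ 2
        * Real.exp (-(1 / 8) * rowAlignmentRate (Λ k) (σs k) (Rs k)) := by positivity
    have h3 := Real.exp_pos (-(entryNorm (Λ k) ^ 2
      / (2 * (m k * n k * σ ^ 2 + R * entryNorm (Λ k)))))
    linarith
  · have hM2 : (2 : ℝ) ≤ max (m k : ℝ) (n k) := by
      have h1 : (1 : ℝ) < max (m k : ℝ) (n k) := by
        refine lt_of_le_of_ne hM1 fun h => ?_
        rw [← h, Real.log_one, mul_zero] at hDM
        exact absurd hDM (not_le.2 (Real.log_pos (by norm_num)))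
      -- M is an integer, so M > 1 already gives M ≥ 2.
      rw [← Nat.cast_max] at h1 ⊢
      exact_mod_cast h1
    refine le_trans ?_ ((hX k).le_measure_scaling (hσs k) (hRs k) (hconv.smooth k) hK0 hδ hk.1
      hk.2.1 hk.2.2 hW (hW.limitBridgeDensity_ae_eq (kernelLower_pos hδ) hφ hρr hρc)
      hg.aestronglyMeasurable hG hgb hD hM2 hDM hlarge ?_)
    -- The estimate holds without the last exponential term, and subtracting a positive number only
    -- weakens it.
    · have h3 := Real.exp_pos (-(entryNorm (Λ k) ^ 2
        / (2 * (m k * n k * σ ^ 2 + R * entryNorm (Λ k)))))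
      linarith
    · have h1 : max (m k : ℝ) (n k) ^ (3 / 2 : ℝ) * √(D * Real.log (max (m k : ℝ) (n k)))
          / entryNorm (Λ k) ≤ (1 / (2 * potentialConst K δ)) ^ 2 := by
        rw [div_le_iff₀ (hL k), Real.sqrt_mul hD.le]
        linarith
      have h2 := Real.sqrt_le_sqrt h1
      rw [Real.sqrt_sq (by positivity)] at h2
      refine (mul_le_mul_of_nonneg_left h2 hpot.le).trans (le_of_eq ?_)
      field_simp
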